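/- Let $0<q<1<p<\infty$, $p':=\frac p{p-1}$, $r:=\frac{pq}{p-q}$ and $0<\theta<\infty$. A weight is a nonnegative Lebesgue measurable function $w$ on $(0,\infty)$ with $0<\int_0^t w(s)\,ds<\infty$ for all $t>0$. A $\theta$-regular kernel is a measurable function $U:[0,\infty)^2\to[0,\infty)$ such that $U(x,y)$ is nonincreasing in $x$ and nondecreasing in $y$, $U(x,z)\le\theta\,(U(x,y)+U(y,z))$ for all $0\le x<y<z<\infty$, and $U(0,y)>0$ for all $y>0$. Let $v,w$ be weights and let $U$ be a $\theta$-regular kernel. Then the following assertions are equivalent (with the conventions $0\cdot\infty=0$ and $0^{-a}=\infty$ for $a>0$): (i) There exists a constant $C\in(0,\infty)$ such that the inequality $$\left(\int_0^\infty\left(\int_0^t f(x)U(x,t)\,dx\right)^q w(t)\,dt\right)^{1/q}\le C\left(\int_0^\infty f^p(t)v(t)\,dt\right)^{1/p}\qquad(*)$$ holds for all nonnegative measurable functions $f$ on $(0,\infty)$. (ii) Both conditions $$A_1^*:=\int_0^\infty\left(\int_t^\infty w(x)\,dx\right)^{r/p}w(t)\left(\int_0^t U^{p'}(z,t)\,v^{1-p'}(z)\,dz\right)^{r/p'}dt<\infty$$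 and $$A_2^*:=\int_0^\infty\left(\int_t^\infty w(x)\,U^q(t,x)\,dx\right)^{r/p}w(t)\ \sup_{z\in(0,t]}U^q(z,t)\left(\int_0^z v^{1-p'}(s)\,ds\right)^{r/p'}dt<\infty$$ are satisfied. Moreover, if these assertions hold, there is a least constant $C\in[0,\infty)$ such that $(*)$ holds for all nonnegative measurable functions $f$ on $(0,\infty)$, and it satisfies $C^r\approx A_1^*+A_2^*$, that is, $K^{-1}(A_1^*+A_2^*)\le C^r\le K(A_1^*+A_2^*)$ with a constant $K\in(0,\infty)$ depending only on $p$, $q$ and $\theta$. -/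

import Mathlib

open MeasureTheory Set
open scoped NNReal ENNReal

noncomputable section

/-- Functions in the cone of nonnegative Lebesgue measurable functions on `(0, ∞)`; the values
outside `(0, ∞)` are irrelevant. Almost everywhere measurability with respect to Lebesgue measure
is the same as Lebesgue measurability. -/
def NonnegMeasurable (f : ℝ → ℝ≥0) : Prop :=
  AEMeasurable f (volume.restrict (Ioi (0 : ℝ)))

/-- A weight: a nonnegative measurable function `w` on `(0, ∞)` such that
`0 < ∫₀ᵗ w < ∞` for all `t > 0`. -/
structure IsWeight (w : ℝ → ℝ≥0) : Prop where
  measurable : NonnegMeasurable w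
  pos : ∀ t : ℝ, 0 < t → 0 < ∫⁻ s in Ioo 0 t, (w s : ℝ≥0∞)
  finite : ∀ t : ℝ, 0 < t → ∫⁻ s in Ioo 0 t, (w s : ℝ≥0∞) < ∞

/-- A `θ`-regular kernel `U : [0, ∞)² → [0, ∞)`; the values outside `[0, ∞)²` are irrelevant. -/
structure IsRegularKernel (θ : ℝ) (U : ℝ → ℝ → ℝ≥0) : Prop where
  measurable : AEMeasurable (Function.uncurry U)
    ((volume : Measure (ℝ × ℝ)).restrict (Ici (0 : ℝ) ×ˢ Ici (0 : ℝ)))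
  antitone_left : ∀ y : ℝ, 0 ≤ y → AntitoneOn (fun x => U x y) (Ici 0)
  monotone_right : ∀ x : ℝ, 0 ≤ x → MonotoneOn (fun y => U x y) (Ici 0)
  regular : ∀ x y z : ℝ, 0 ≤ x → x < y → y < z →
    (U x z : ℝ) ≤ θ * ((U x y : ℝ) + (U y z : ℝ))
  pos : ∀ y : ℝ, 0 < y → 0 < U 0 y

/-- The conjugate exponent `p' = p / (p - 1)`. -/
def conjExp (p : ℝ) : ℝ := p / (p - 1)

/-- The exponent `r = p q / (p - q)`. -/
def rExp (p q : ℝ) : ℝ := p * q / (p - q)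

/-- The Hardy-type operator `H f (t) = ∫₀ᵗ f(x) U(x, t) dx`. -/
def hardyOp (U : ℝ → ℝ → ℝ≥0) (f : ℝ → ℝ≥0) (t : ℝ) : ℝ≥0∞ :=
  ∫⁻ x in Ioo 0 t, (f x : ℝ≥0∞) * (U x t : ℝ≥0∞)

/-- `(∫₀^∞ g^s w)^(1/s)`, the weighted (quasi)norm of a nonnegative function `g`. -/
def weightedNorm (s : ℝ) (w : ℝ → ℝ≥0) (g : ℝ → ℝ≥0∞) : ℝ≥0∞ :=
  (∫⁻ t in Ioi (0 : ℝ), g t ^ s * (w t : ℝ≥0∞)) ^ (1 / s)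

/-- The weighted Hardy-type inequality holds with constant `C` for all nonnegative measurable
functions on `(0, ∞)`. -/
def HardyInequality (p q : ℝ) (U : ℝ → ℝ → ℝ≥0) (v w : ℝ → ℝ≥0) (C : ℝ≥0) : Prop :=
  ∀ f : ℝ → ℝ≥0, NonnegMeasurable f →
    weightedNorm q w (hardyOp U f) ≤ (C : ℝ≥0∞) * weightedNorm p v (fun t => (f t : ℝ≥0∞))

/-- `A₁* = ∫₀^∞ (∫ₜ^∞ w)^(r/p) w(t) (∫₀ᵗ U^{p'}(z,t) v^{1-p'}(z) dz)^(r/p') dt`. -/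
def condAOne (p q : ℝ) (U : ℝ → ℝ → ℝ≥0) (v w : ℝ → ℝ≥0) : ℝ≥0∞ :=
  ∫⁻ t in Ioi (0 : ℝ),
    (∫⁻ x in Ioi t, (w x : ℝ≥0∞)) ^ (rExp p q / p) * (w t : ℝ≥0∞) *
      (∫⁻ z in Ioo 0 t, (U z t : ℝ≥0∞) ^ conjExp p * (v z : ℝ≥0∞) ^ (1 - conjExp p)) ^
        (rExp p q / conjExp p)

/-- `A₂* = ∫₀^∞ (∫ₜ^∞ w(x) U^q(t,x) dx)^(r/p) w(t)
sup_{z ∈ (0,t]} U^q(z,t) (∫₀ᶻ v^{1-p'})^(r/p') dt`. -/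
def condATwo (p q : ℝ) (U : ℝ → ℝ → ℝ≥0) (v w : ℝ → ℝ≥0) : ℝ≥0∞ :=
  ∫⁻ t in Ioi (0 : ℝ),
    (∫⁻ x in Ioi t, (w x : ℝ≥0∞) * (U t x : ℝ≥0∞) ^ q) ^ (rExp p q / p) * (w t : ℝ≥0∞) *
      ⨆ z ∈ Ioc 0 t, (U z t : ℝ≥0∞) ^ q *
        (∫⁻ s in Ioo 0 z, (v s : ℝ≥0∞) ^ (1 - conjExp p)) ^ (rExp p q / conjExp p)

end

noncomputable section

theorem rExp_pos {p q : ℝ} (hq0 : 0 < q) (hq1 : q < 1) (hp : 1 < p) : 0 < rExp p q :=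
  div_pos (mul_pos (by linarith) hq0) (by linarith)

theorem rExp_div_right {p q : ℝ} (hq0 : 0 < q) (hq1 : q < 1) (hp : 1 < p) :
    rExp p q / q = rExp p q / p + 1 := by
  have : p - q ≠ 0 := by linarith
  have : p ≠ 0 := by linarith
  unfold rExp; field_simp; ring

theorem div_add_div_rExp {p q : ℝ} (hq0 : 0 < q) (hq1 : q < 1) (hp : 1 < p) :
    q / p + q / rExp p q = 1 := by
  have : p - q ≠ 0 := by linarith
  have : p ≠ 0 := by linarith
  unfold rExp; field_simp; ring

theorem mul_rExp_div_left {p q : ℝ} (hq0 : 0 < q) (hq1 : q < 1) (hp : 1 < p) :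
    q * (rExp p q / p) + q = rExp p q := by
  have : p - q ≠ 0 := by linarith
  have : p ≠ 0 := by linarith
  unfold rExp; field_simp; ring

theorem conjExp_pos {p : ℝ} (hp : 1 < p) : 0 < conjExp p :=
  div_pos (by linarith) (by linarith)

theorem holderConjugate_conjExp {p : ℝ} (hp : 1 < p) : p.HolderConjugate (conjExp p) :=
  Real.HolderConjugate.conjExponent hp

theorem rExp_div_conjExp_add {p q : ℝ} (hp : 1 < p) :
    rExp p q / conjExp p + rExp p q / p = rExp p q := by
  have : p - 1 ≠ 0 := by linarith
  have : p ≠ 0 := by linarith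
  unfold conjExp; field_simp; ring

theorem ENNReal.rpow_add_le_two_rpow_mul {s : ℝ} (hs : 0 ≤ s) (a b : ℝ≥0∞) :
    (a + b) ^ s ≤ 2 ^ s * (a ^ s + b ^ s) := by
  have h : a + b ≤ 2 * max a b := by
    rw [two_mul]; exact add_le_add (le_max_left _ _) (le_max_right _ _)
  calc (a + b) ^ s ≤ (2 * max a b) ^ s := ENNReal.rpow_le_rpow h hs
    _ = 2 ^ s * (max a b) ^ s := ENNReal.mul_rpow_of_nonneg _ _ hs
    _ ≤ _ := by
      gcongr
      rcases le_total a b with h | h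
      · rw [max_eq_right h]; exact le_add_self
      · rw [max_eq_left h]; exact le_self_add

theorem ENNReal.rpow_finset_sum_le {ι : Type*} (s : Finset ι) (a : ι → ℝ≥0∞) {q : ℝ} (hq0 : 0 < q)
    (hq1 : q ≤ 1) : (∑ i ∈ s, a i) ^ q ≤ ∑ i ∈ s, a i ^ q := by
  classical
  induction s using Finset.induction_on with
  | empty => simp [hq0]
  | insert i s hi ih =>
    rw [Finset.sum_insert hi, Finset.sum_insert hi]
    exact (ENNReal.rpow_add_le_add_rpow _ _ hq0.le hq1).trans (by gcongr)

theorem ENNReal.rpow_tsum_le (a : ℕ → ℝ≥0∞) {q : ℝ} (hq0 : 0 < q)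
    (hq1 : q ≤ 1) : (∑' i, a i) ^ q ≤ ∑' i, a i ^ q := by
  rw [← ENNReal.le_rpow_inv_iff hq0, ENNReal.tsum_eq_iSup_sum]
  refine iSup_le fun s => ?_
  rw [ENNReal.le_rpow_inv_iff hq0]
  exact (ENNReal.rpow_finset_sum_le s a hq0 hq1).trans (ENNReal.sum_le_tsum s)

theorem ENNReal.tsum_rpow_mul_rpow_le (a b : ℕ → ℝ≥0∞) {s t : ℝ} (hs : 0 ≤ s) (ht : 0 ≤ t)
    (hst : s + t = 1) : ∑' i, a i ^ s * b i ^ t ≤ (∑' i, a i) ^ s * (∑' i, b i) ^ t := by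
  simpa only [lintegral_count] using ENNReal.lintegral_mul_norm_pow_le (μ := Measure.count)
    (f := a) (g := b) (measurable_of_countable _).aemeasurable
    (measurable_of_countable _).aemeasurable hs ht hst

theorem ENNReal.sum_rpow_mul_rpow_le (S : Finset ℕ) (a b : ℕ → ℝ≥0∞) {s t : ℝ} (hs : 0 ≤ s)
    (ht : 0 ≤ t) (hst : s + t = 1) :
    ∑ i ∈ S, a i ^ s * b i ^ t ≤ (∑ i ∈ S, a i) ^ s * (∑ i ∈ S, b i) ^ t := by
  have := ENNReal.lintegral_mul_norm_pow_le (μ := (Measure.count : Measure ℕ).restrict S)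
    (f := a) (g := b) (measurable_of_countable _).aemeasurable
    (measurable_of_countable _).aemeasurable hs ht hst
  have key (f : ℕ → ℝ≥0∞) : ∫⁻ i in (S : Set ℕ), f i ∂Measure.count = ∑ i ∈ S, f i := by
    rw [← lintegral_indicator S.measurableSet, lintegral_count,
      tsum_eq_sum (s := S) (fun i hi => by simp [hi])]
    exact Finset.sum_congr rfl fun i hi => by simp [hi]
  simpa only [key] using this

theorem tsum_sum_Ico_eq {j : ℕ → ℕ} (hj : StrictMono j) (g : ℕ → ℝ≥0∞) :
    ∑' n, ∑ k ∈ Finset.Ico (j n) (j (n + 1)), g k = ∑' k, g (j 0 + k) := by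
  have h (L : ℕ) : ∑ n ∈ Finset.range L, ∑ k ∈ Finset.Ico (j n) (j (n + 1)), g k
      = ∑ k ∈ Finset.range (j L - j 0), g (j 0 + k) := by
    rw [← Finset.sum_Ico_eq_sum_range]
    induction L with
    | zero => simp
    | succ L ih =>
      rw [Finset.sum_range_succ, ih, Finset.sum_Ico_consecutive _ (hj.monotone (Nat.zero_le L))
        (hj.monotone (Nat.le_succ L))]
  rw [ENNReal.tsum_eq_iSup_nat, ENNReal.tsum_eq_iSup_nat]
  refine le_antisymm (iSup_le fun L => ?_) (iSup_le fun L => ?_)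
  · rw [h]; exact le_iSup (fun L => ∑ k ∈ Finset.range L, g (j 0 + k)) _
  · refine le_trans ?_ (le_iSup _ (L + j 0))
    rw [h]
    refine Finset.sum_le_sum_of_subset (Finset.range_mono ?_)
    have := hj.le_apply (x := L + j 0)
    omega

theorem tsum_sum_Ico_le {j : ℕ → ℕ} (hj : StrictMono j) (g : ℕ → ℝ≥0∞) :
    ∑' n, ∑ k ∈ Finset.Ico (j n) (j (n + 1)), g k ≤ ∑' k, g k := by
  rw [tsum_sum_Ico_eq hj]
  exact ENNReal.tsum_comp_le_tsum_of_injective (add_right_injective (j 0)) g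

theorem tsum_sum_Icc_le {j : ℕ → ℕ} (hj : StrictMono j) (g : ℕ → ℝ≥0∞) :
    ∑' n, ∑ k ∈ Finset.Icc (j n) (j (n + 2)), g k ≤ 3 * ∑' k, g k := by
  have h (n : ℕ) : ∑ k ∈ Finset.Icc (j n) (j (n + 2)), g k ≤
      ∑ k ∈ Finset.Ico (j n) (j (n + 1)), g k + ∑ k ∈ Finset.Ico (j (n + 1)) (j (n + 1 + 1)), g k
        + ∑ k ∈ Finset.Ico (j (n + 2)) (j (n + 2 + 1)), g k := by
    rw [Finset.sum_Ico_consecutive _ (hj.monotone (by omega)) (hj.monotone (by omega)),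
      Finset.sum_Ico_consecutive _ (hj.monotone (by omega)) (hj.monotone (by omega))]
    refine Finset.sum_le_sum_of_subset fun k hk => ?_
    have := hj (show n + 2 < n + 2 + 1 by omega)
    simp only [Finset.mem_Icc, Finset.mem_Ico] at hk ⊢
    omega
  refine (ENNReal.tsum_le_tsum h).trans ?_
  rw [ENNReal.tsum_add, ENNReal.tsum_add]
  have h1 := tsum_sum_Ico_le hj g
  have h2 := tsum_sum_Ico_le (j := fun n => j (n + 1)) (fun a b hab => hj (by omega)) g
  have h3 := tsum_sum_Ico_le (j := fun n => j (n + 2)) (fun a b hab => hj (by omega)) g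
  calc _ ≤ ∑' k, g k + ∑' k, g k + ∑' k, g k := add_le_add (add_le_add h1 h2) h3
    _ = _ := by ring

theorem exists_block_sequence {Φ : ℕ → ℝ≥0∞} {ε : ℝ≥0∞} (hε : ε ≤ 1)
    (h : ∀ j, ∃ k, j < k ∧ Φ k ≤ ε * Φ j) :
    ∃ j : ℕ → ℕ, StrictMono j ∧ j 0 = 0 ∧ (∀ n, Φ (j (n + 1)) ≤ ε * Φ (j n)) ∧
      ∀ n k, j n ≤ k → k < j (n + 1) → ε * Φ (j n) ≤ Φ k := by
  classical
  have h' (x : ℕ) : ∃ k, (x < k ∧ Φ k ≤ ε * Φ x) ∧ ∀ i, i < k → ¬ (x < i ∧ Φ i ≤ ε * Φ x) :=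
    ⟨Nat.find (h x), Nat.find_spec (h x), fun i hi => Nat.find_min (h x) hi⟩
  choose nxt hnxt hmin using h'
  let j : ℕ → ℕ := fun n => Nat.rec 0 (fun _ x => nxt x) n
  have hs (n : ℕ) : j (n + 1) = nxt (j n) := rfl
  refine ⟨j, strictMono_nat_of_lt_succ fun n => ?_, rfl, fun n => ?_, fun n k h1 h2 => ?_⟩
  · rw [hs]; exact (hnxt (j n)).1
  · rw [hs]; exact (hnxt (j n)).2
  · rw [hs] at h2
    rcases h1.eq_or_lt with rfl | h1
    · exact mul_le_of_le_one_left zero_le hε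
    · by_contra hk
      exact hmin (j n) k h2 ⟨h1, (not_le.1 hk).le⟩

end

noncomputable section

/-- A kernel on `[0, ∞)²`, nonincreasing in the first and nondecreasing in the second variable,
with the regularity inequality (constant `Θ ≥ 1`) also for coinciding arguments. -/
structure IsMonotoneKernel (Θ : ℝ≥0) (U : ℝ → ℝ → ℝ≥0) : Prop where
  one_le : 1 ≤ Θ
  anti : ∀ {x x' y : ℝ}, 0 ≤ x → x ≤ x' → 0 ≤ y → (U x' y : ℝ≥0∞) ≤ U x y
  mono : ∀ {x y y' : ℝ}, 0 ≤ x → 0 ≤ y → y ≤ y' → (U x y : ℝ≥0∞) ≤ U x y'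
  reg : ∀ {x y z : ℝ}, 0 ≤ x → x ≤ y → y ≤ z → (U x z : ℝ≥0∞) ≤ Θ * (U x y + U y z)

theorem IsRegularKernel.isMonotoneKernel {θ : ℝ} {U : ℝ → ℝ → ℝ≥0} (hU : IsRegularKernel θ U) :
    IsMonotoneKernel (max θ.toNNReal 1) U where
  one_le := le_max_right _ _
  anti hx hxx hy := by
    exact_mod_cast hU.antitone_left _ hy (mem_Ici.2 hx) (mem_Ici.2 (hx.trans hxx)) hxx
  mono hx hy hyy := by
    exact_mod_cast hU.monotone_right _ hx (mem_Ici.2 hy) (mem_Ici.2 (hy.trans hyy)) hyy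
  reg {x y z} hx hxy hyz := by
    have h1 : (1 : ℝ≥0) ≤ max θ.toNNReal 1 := le_max_right _ _
    have key : U x z ≤ max θ.toNNReal 1 * (U x y + U y z) := by
      rcases hxy.eq_or_lt with rfl | hxy
      · calc U x z ≤ 1 * (U x x + U x z) := by rw [one_mul]; exact le_add_self
          _ ≤ _ := by gcongr
      rcases hyz.eq_or_lt with rfl | hyz
      · calc U x y ≤ 1 * (U x y + U y y) := by rw [one_mul]; exact le_self_add
          _ ≤ _ := by gcongr
      have h := hU.regular x y z hx hxy hyz
      rw [← NNReal.coe_le_coe]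
      push_cast
      refine h.trans (mul_le_mul_of_nonneg_right ?_ (by positivity))
      exact (Real.le_coe_toNNReal θ).trans (le_max_left _ _)
    exact_mod_cast key

namespace IsMonotoneKernel

variable {Θ : ℝ≥0} {U : ℝ → ℝ → ℝ≥0}

theorem anti_rpow (hU : IsMonotoneKernel Θ U) {x x' y s : ℝ} (hx : 0 ≤ x) (hxx : x ≤ x')
    (hy : 0 ≤ y) (hs : 0 ≤ s) : (U x' y : ℝ≥0∞) ^ s ≤ (U x y : ℝ≥0∞) ^ s :=
  ENNReal.rpow_le_rpow (hU.anti hx hxx hy) hs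

theorem mono_rpow (hU : IsMonotoneKernel Θ U) {x y y' s : ℝ} (hx : 0 ≤ x) (hy : 0 ≤ y)
    (hyy : y ≤ y') (hs : 0 ≤ s) : (U x y : ℝ≥0∞) ^ s ≤ (U x y' : ℝ≥0∞) ^ s :=
  ENNReal.rpow_le_rpow (hU.mono hx hy hyy) hs

theorem one_le_rpow (hU : IsMonotoneKernel Θ U) {q : ℝ} (hq : 0 ≤ q) : (1 : ℝ≥0∞) ≤ (Θ : ℝ≥0∞) ^ q := by
  simpa using ENNReal.rpow_le_rpow (show (1 : ℝ≥0∞) ≤ Θ by exact_mod_cast hU.one_le) hq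

theorem reg_rpow (hU : IsMonotoneKernel Θ U) {x y z q : ℝ} (hx : 0 ≤ x) (hxy : x ≤ y) (hyz : y ≤ z)
    (hq0 : 0 < q) (hq1 : q < 1) :
    (U x z : ℝ≥0∞) ^ q ≤ (Θ : ℝ≥0∞) ^ q * ((U x y : ℝ≥0∞) ^ q + (U y z : ℝ≥0∞) ^ q) := by
  refine (ENNReal.rpow_le_rpow (hU.reg hx hxy hyz) hq0.le).trans ?_
  rw [ENNReal.mul_rpow_of_nonneg _ _ hq0.le]
  gcongr
  exact ENNReal.rpow_add_le_add_rpow _ _ hq0.le hq1.le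

theorem aemeasurable_left (hU : IsMonotoneKernel Θ U) {y : ℝ} (hy : 0 ≤ y) {s : Set ℝ}
    (hs : MeasurableSet s) (h0 : s ⊆ Ici 0) : AEMeasurable (fun x => U x y) (volume.restrict s) :=
  aemeasurable_restrict_of_antitoneOn hs fun a ha b _ hab => by
    exact_mod_cast hU.anti (h0 ha) hab hy

end IsMonotoneKernel

/-- `∫₀ᶻ v^{1-p'}`. -/
def sigmaInt (p : ℝ) (v : ℝ → ℝ≥0) (z : ℝ) : ℝ≥0∞ :=
  ∫⁻ s in Ioo 0 z, (v s : ℝ≥0∞) ^ (1 - conjExp p)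

/-- `∫₀ᵗ U^{p'}(z, t) v^{1-p'}(z) dz`. -/
def kerInt (p : ℝ) (U : ℝ → ℝ → ℝ≥0) (v : ℝ → ℝ≥0) (t : ℝ) : ℝ≥0∞ :=
  ∫⁻ z in Ioo 0 t, (U z t : ℝ≥0∞) ^ conjExp p * (v z : ℝ≥0∞) ^ (1 - conjExp p)

/-- `sup_{z ∈ (0,t]} U^q(z, t) (∫₀ᶻ v^{1-p'})^(r/p')`. -/
def kerSup (p q : ℝ) (U : ℝ → ℝ → ℝ≥0) (v : ℝ → ℝ≥0) (t : ℝ) : ℝ≥0∞ :=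
  ⨆ z ∈ Ioc 0 t, (U z t : ℝ≥0∞) ^ q * sigmaInt p v z ^ (rExp p q / conjExp p)

/-- Measurable weights that are bounded away from zero. -/
structure IsBddBelowWeight (v : ℝ → ℝ≥0) : Prop where
  measurable : NonnegMeasurable v
  exists_le : ∃ ε : ℝ≥0, 0 < ε ∧ ∀ x, ε ≤ v x

theorem IsBddBelowWeight.ne_zero {v : ℝ → ℝ≥0} (hv : IsBddBelowWeight v) (x : ℝ) : v x ≠ 0 := by
  obtain ⟨ε, h0, h⟩ := hv.exists_le
  exact (h0.trans_le (h x)).ne'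

theorem one_sub_conjExp_neg {p : ℝ} (hp : 1 < p) : 1 - conjExp p < 0 := by
  have := (holderConjugate_conjExp hp).symm.lt
  linarith

theorem IsBddBelowWeight.exists_rpow_le {v : ℝ → ℝ≥0} (hv : IsBddBelowWeight v) {p : ℝ}
    (hp : 1 < p) : ∃ c : ℝ≥0∞, c ≠ ∞ ∧ ∀ x, (v x : ℝ≥0∞) ^ (1 - conjExp p) ≤ c := by
  obtain ⟨ε, h0, h⟩ := hv.exists_le
  refine ⟨(ε : ℝ≥0∞) ^ (1 - conjExp p), ?_, fun x => ?_⟩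
  · simp [ENNReal.rpow_eq_top_iff, h0.ne']
  · rw [← neg_sub (conjExp p) 1, ENNReal.rpow_neg, ENNReal.rpow_neg, ENNReal.inv_le_inv]
    exact ENNReal.rpow_le_rpow (by exact_mod_cast h x) (by linarith [one_sub_conjExp_neg hp])

theorem sigmaInt_mono {p : ℝ} {v : ℝ → ℝ≥0} : Monotone (sigmaInt p v) := fun _ _ h =>
  lintegral_mono_set (Ioo_subset_Ioo_right h)

theorem sigmaInt_ne_top {p : ℝ} (hp : 1 < p) {v : ℝ → ℝ≥0} (hv : IsBddBelowWeight v) (z : ℝ) :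
    sigmaInt p v z ≠ ∞ := by
  obtain ⟨c, hc, h⟩ := hv.exists_rpow_le hp
  refine ((setLIntegral_mono measurable_const fun x _ => h x).trans_lt ?_).ne
  simp [ENNReal.mul_lt_top_iff, hc.lt_top]

theorem NonnegMeasurable.coe_restrict {v : ℝ → ℝ≥0} (hv : NonnegMeasurable v) {s : Set ℝ}
    (hs : s ⊆ Ioi 0) : AEMeasurable (fun x => (v x : ℝ≥0∞)) (volume.restrict s) :=
  (hv.mono_measure (Measure.restrict_mono_set _ hs)).coe_nnreal_ennreal

theorem sigmaInt_pos {p : ℝ} {v : ℝ → ℝ≥0} (hv : IsBddBelowWeight v) {z : ℝ}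
    (hz : 0 < z) : 0 < sigmaInt p v z := by
  refine pos_iff_ne_zero.2 fun h => ?_
  rw [sigmaInt, lintegral_eq_zero_iff'
    ((hv.measurable.coe_restrict Ioo_subset_Ioi_self).pow_const _)] at h
  have h' : ∀ᵐ x ∂volume.restrict (Ioo 0 z), False := h.mono fun x hx => by
    simp [ENNReal.rpow_eq_zero_iff, hv.ne_zero x] at hx
  rw [ae_iff] at h'
  simp at h'
  linarith

section

variable {Θ : ℝ≥0} {U : ℝ → ℝ → ℝ≥0} {v : ℝ → ℝ≥0} {p q : ℝ}

theorem kerInt_mono (hU : IsMonotoneKernel Θ U) (hp : 1 < p) : Monotone (kerInt p U v) := by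
  intro t t' h
  refine (setLIntegral_mono_ae' measurableSet_Ioo (Filter.Eventually.of_forall fun z hz => ?_)).trans
    (lintegral_mono_set (Ioo_subset_Ioo_right h))
  gcongr ?_ * _
  exact hU.mono_rpow hz.1.le (hz.1.trans hz.2).le h (conjExp_pos hp).le

theorem rpow_mul_sigmaInt_le_kerInt (hU : IsMonotoneKernel Θ U) (hp : 1 < p) {z t : ℝ} (hz : 0 ≤ z)
    (hzt : z ≤ t) : (U z t : ℝ≥0∞) ^ conjExp p * sigmaInt p v z ≤ kerInt p U v t := by
  unfold sigmaInt kerInt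
  rw [← lintegral_const_mul' _ _ (by simp [ENNReal.rpow_eq_top_iff, (conjExp_pos hp).not_gt])]
  refine (setLIntegral_mono_ae' measurableSet_Ioo (Filter.Eventually.of_forall fun x hx => ?_)).trans
    (lintegral_mono_set (Ioo_subset_Ioo_right hzt))
  gcongr ?_ * _
  exact hU.anti_rpow hx.1.le hx.2.le (hz.trans hzt) (conjExp_pos hp).le

theorem kerInt_ne_top (hU : IsMonotoneKernel Θ U) (hp : 1 < p) (hv : IsBddBelowWeight v) {t : ℝ}
    (ht : 0 ≤ t) : kerInt p U v t ≠ ∞ := by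
  have hc : (U 0 t : ℝ≥0∞) ^ conjExp p ≠ ∞ := by
    simp [ENNReal.rpow_eq_top_iff, (conjExp_pos hp).not_gt]
  have : kerInt p U v t ≤ (U 0 t : ℝ≥0∞) ^ conjExp p * sigmaInt p v t := by
    unfold sigmaInt kerInt
    rw [← lintegral_const_mul' _ _ hc]
    refine setLIntegral_mono_ae' measurableSet_Ioo (Filter.Eventually.of_forall fun x hx => ?_)
    gcongr ?_ * _
    exact hU.anti_rpow le_rfl hx.1.le ht (conjExp_pos hp).le
  exact (this.trans_lt (ENNReal.mul_lt_top hc.lt_top (sigmaInt_ne_top hp hv t).lt_top)).ne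

theorem rpow_rExp_mul_sigmaInt_le_kerInt (hU : IsMonotoneKernel Θ U) (hq0 : 0 < q) (hq1 : q < 1)
    (hp : 1 < p) {z t : ℝ} (hz : 0 ≤ z) (hzt : z ≤ t) :
    (U z t : ℝ≥0∞) ^ rExp p q * sigmaInt p v z ^ (rExp p q / conjExp p) ≤
      kerInt p U v t ^ (rExp p q / conjExp p) := by
  have hp' := conjExp_pos hp
  have hs : 0 ≤ rExp p q / conjExp p := (div_pos (rExp_pos hq0 hq1 hp) hp').le
  refine le_trans (le_of_eq ?_)
    (ENNReal.rpow_le_rpow (rpow_mul_sigmaInt_le_kerInt (v := v) hU hp hz hzt) hs)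
  rw [ENNReal.mul_rpow_of_nonneg _ _ hs, ← ENNReal.rpow_mul, mul_div_cancel₀ _ hp'.ne']

theorem le_kerSup {z t : ℝ} (hz : 0 < z) (hzt : z ≤ t) :
    (U z t : ℝ≥0∞) ^ q * sigmaInt p v z ^ (rExp p q / conjExp p) ≤ kerSup p q U v t :=
  le_iSup₂_of_le z ⟨hz, hzt⟩ le_rfl

theorem kerSup_mono (hU : IsMonotoneKernel Θ U) (hq0 : 0 < q) : Monotone (kerSup p q U v) := by
  intro t t' h
  refine iSup₂_le fun z hz => le_trans ?_ (le_kerSup hz.1 (hz.2.trans h))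
  gcongr ?_ * _
  exact hU.mono_rpow hz.1.le (hz.1.le.trans hz.2) h hq0.le

theorem kerSup_ne_top (hU : IsMonotoneKernel Θ U) (hq0 : 0 < q) (hq1 : q < 1) (hp : 1 < p)
    (hv : IsBddBelowWeight v) {t : ℝ} (ht : 0 ≤ t) : kerSup p q U v t ≠ ∞ := by
  have hs : 0 ≤ rExp p q / conjExp p := (div_pos (rExp_pos hq0 hq1 hp) (conjExp_pos hp)).le
  refine (lt_of_le_of_lt (iSup₂_le fun z hz => mul_le_mul'
    (hU.anti_rpow le_rfl hz.1.le ht hq0.le) (ENNReal.rpow_le_rpow (sigmaInt_mono hz.2) hs))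
    (ENNReal.mul_lt_top ?_ ?_)).ne
  · exact ENNReal.rpow_lt_top_of_nonneg hq0.le (by simp)
  · exact ENNReal.rpow_lt_top_of_nonneg hs (sigmaInt_ne_top hp hv t)

theorem lintegral_mul_kernel_le (hU : IsMonotoneKernel Θ U) (hp : 1 < p) (hv : IsBddBelowWeight v)
    {f : ℝ → ℝ≥0} (hf : NonnegMeasurable f) {E : Set ℝ} (hE : MeasurableSet E) (hE0 : E ⊆ Ioi 0)
    {T : ℝ} (hT : 0 ≤ T) :
    ∫⁻ x in E, (f x : ℝ≥0∞) * U x T ≤ (∫⁻ x in E, (f x : ℝ≥0∞) ^ p * v x) ^ (1 / p) *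
      (∫⁻ x in E, (U x T : ℝ≥0∞) ^ conjExp p * (v x : ℝ≥0∞) ^ (1 - conjExp p)) ^ (1 / conjExp p) := by
  have hpq := holderConjugate_conjExp hp
  have hp0 : 0 < p := by linarith
  have mU : AEMeasurable (fun x => (U x T : ℝ≥0∞)) (volume.restrict E) :=
    (hU.aemeasurable_left hT hE (hE0.trans Ioi_subset_Ici_self)).coe_nnreal_ennreal
  have mf := hf.coe_restrict hE0
  have mv := hv.measurable.coe_restrict hE0
  have h := ENNReal.lintegral_mul_le_Lp_mul_Lq (volume.restrict E) hpq
    (f := fun x => (f x : ℝ≥0∞) * (v x : ℝ≥0∞) ^ (1 / p))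
    (g := fun x => (U x T : ℝ≥0∞) * (v x : ℝ≥0∞) ^ (-(1 / p)))
    (mf.mul (mv.pow_const _)) (mU.mul (mv.pow_const _))
  have hv0 (x : ℝ) : (v x : ℝ≥0∞) ≠ 0 := by exact_mod_cast hv.ne_zero x
  refine le_trans (le_of_eq ?_) (h.trans (le_of_eq ?_))
  · refine lintegral_congr fun x => ?_
    simp only [Pi.mul_apply]
    rw [mul_mul_mul_comm, ← ENNReal.rpow_add _ _ (hv0 x) ENNReal.coe_ne_top]
    simp
  · congr 3
    · ext x
      rw [ENNReal.mul_rpow_of_nonneg _ _ hp0.le, ← ENNReal.rpow_mul, one_div_mul_cancel hp0.ne',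
        ENNReal.rpow_one]
    · ext x
      rw [ENNReal.mul_rpow_of_nonneg _ _ hpq.symm.pos.le, ← ENNReal.rpow_mul]
      congr 2
      have : p - 1 ≠ 0 := by linarith
      unfold conjExp; field_simp; ring

theorem lintegral_le_sigmaInt (hp : 1 < p) (hv : IsBddBelowWeight v)
    {f : ℝ → ℝ≥0} (hf : NonnegMeasurable f) {E : Set ℝ} (hE : MeasurableSet E) (hE0 : E ⊆ Ioi 0) :
    ∫⁻ x in E, (f x : ℝ≥0∞) ≤ (∫⁻ x in E, (f x : ℝ≥0∞) ^ p * v x) ^ (1 / p) *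
      (∫⁻ x in E, (v x : ℝ≥0∞) ^ (1 - conjExp p)) ^ (1 / conjExp p) := by
  have hU : IsMonotoneKernel 1 (fun _ _ => (1 : ℝ≥0)) :=
    ⟨le_rfl, fun _ _ _ => le_rfl, fun _ _ _ => le_rfl, fun _ _ _ => by simp⟩
  simpa using lintegral_mul_kernel_le hU hp hv hf hE hE0 le_rfl

/-- On a set to the left of `y`, the kernel at a later time `T` splits through `y`. -/
theorem lintegral_mul_kernel_rpow_le_of_le (hU : IsMonotoneKernel Θ U) (hq0 : 0 < q) (hq1 : q < 1)
    (hp : 1 < p) (hv : IsBddBelowWeight v) {f : ℝ → ℝ≥0} (hf : NonnegMeasurable f) {E : Set ℝ}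
    (hE : MeasurableSet E) {y T : ℝ} (hEy : E ⊆ Ioc 0 y) (hy : 0 ≤ y) (hyT : y ≤ T) :
    (∫⁻ x in E, (f x : ℝ≥0∞) * U x T) ^ q ≤ (Θ : ℝ≥0∞) ^ q *
      ((∫⁻ x in E, (f x : ℝ≥0∞) ^ p * v x) ^ (q / p) * (kerInt p U v y ^ (q / conjExp p) +
        (U y T : ℝ≥0∞) ^ q * sigmaInt p v y ^ (q / conjExp p))) := by
  have hp' := conjExp_pos hp
  have hp0 : 0 < p := by linarith
  have hE0 : E ⊆ Ioi 0 := hEy.trans Ioc_subset_Ioi_self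
  have h1 : ∫⁻ x in E, (f x : ℝ≥0∞) * U x T ≤
      Θ * ((∫⁻ x in E, (f x : ℝ≥0∞) * U x y) + U y T * ∫⁻ x in E, (f x : ℝ≥0∞)) := by
    rw [← lintegral_const_mul' _ _ ENNReal.coe_ne_top, ← lintegral_add_left' ,
      ← lintegral_const_mul' _ _ ENNReal.coe_ne_top]
    · refine setLIntegral_mono_ae' hE (Filter.Eventually.of_forall fun x hx => ?_)
      calc (f x : ℝ≥0∞) * U x T ≤ f x * (Θ * (U x y + U y T)) := by
            gcongr; exact hU.reg (hEy hx).1.le (hEy hx).2 hyT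
        _ = _ := by ring
    · exact (hf.coe_restrict hE0).mul
        (hU.aemeasurable_left hy hE (hE0.trans Ioi_subset_Ici_self)).coe_nnreal_ennreal
  have h2 := lintegral_mul_kernel_le hU hp hv hf hE hE0 hy
  have h3 := lintegral_le_sigmaInt hp hv hf hE hE0
  set X := ∫⁻ x in E, (f x : ℝ≥0∞) ^ p * v x
  have h4 : ∫⁻ x in E, (f x : ℝ≥0∞) * U x y ≤ X ^ (1 / p) * kerInt p U v y ^ (1 / conjExp p) :=
    h2.trans (mul_le_mul_right (ENNReal.rpow_le_rpow
      ((lintegral_mono_set hEy).trans_eq (setLIntegral_congr Ioo_ae_eq_Ioc.symm))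
      (by positivity)) _)
  have h5 : ∫⁻ x in E, (f x : ℝ≥0∞) ≤ X ^ (1 / p) * sigmaInt p v y ^ (1 / conjExp p) :=
    h3.trans (mul_le_mul_right (ENNReal.rpow_le_rpow
      ((lintegral_mono_set hEy).trans_eq (setLIntegral_congr Ioo_ae_eq_Ioc.symm))
      (by positivity)) _)
  calc _ ≤ (Θ * (X ^ (1 / p) * kerInt p U v y ^ (1 / conjExp p) +
        U y T * (X ^ (1 / p) * sigmaInt p v y ^ (1 / conjExp p))) : ℝ≥0∞) ^ q := by
        refine ENNReal.rpow_le_rpow (h1.trans ?_) hq0.le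
        gcongr
    _ ≤ (Θ : ℝ≥0∞) ^ q * ((X ^ (1 / p) * kerInt p U v y ^ (1 / conjExp p)) ^ q +
        (U y T * (X ^ (1 / p) * sigmaInt p v y ^ (1 / conjExp p))) ^ q) := by
        rw [ENNReal.mul_rpow_of_nonneg _ _ hq0.le]
        gcongr
        exact ENNReal.rpow_add_le_add_rpow _ _ hq0.le hq1.le
    _ = _ := by
        simp only [ENNReal.mul_rpow_of_nonneg _ _ hq0.le, ← ENNReal.rpow_mul, one_div_mul_eq_div]
        ring

end
end

noncomputable section

theorem measure_le_of_forall_measure_Iio_le {ν : Measure ℝ} [NullSingletonClass ν] {E : Set ℝ}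
    (hE : BddAbove E) {c : ℝ≥0∞} (h : ∀ z ∈ E, ν (Iio z) ≤ c) : ν E ≤ c := by
  rcases E.eq_empty_or_nonempty with rfl | hne
  · simp
  obtain ⟨u, hu, hlim, hmem⟩ := exists_seq_tendsto_sSup hne hE
  have h1 : E ⊆ Iic (sSup E) := fun z hz => le_csSup hE hz
  have h2 : Iio (sSup E) ⊆ ⋃ n, Iio (u n) := fun z hz => by
    obtain ⟨n, hn⟩ := (hlim.eventually (lt_mem_nhds hz)).exists
    exact mem_iUnion.2 ⟨n, hn⟩
  calc ν E ≤ ν (Iic (sSup E)) := measure_mono h1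
    _ = ν (Iio (sSup E)) := (measure_congr Iio_ae_eq_Iic).symm
    _ ≤ ν (⋃ n, Iio (u n)) := measure_mono h2
    _ = ⨆ n, ν (Iio (u n)) := Monotone.measure_iUnion fun a b hab => Iio_subset_Iio (hu hab)
    _ ≤ c := iSup_le fun n => h _ (hmem n)

theorem lintegral_Ioo_rpow_neg {A s : ℝ} (hA : 0 ≤ A) (hs : s < 1) :
    ∫⁻ y in Ioo 0 A, ENNReal.ofReal (y ^ (-s)) = ENNReal.ofReal (A ^ (1 - s) / (1 - s)) := by
  rw [restrict_Ioo_eq_restrict_Ioc, ← ofReal_integral_eq_lintegral_ofReal,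
    ← intervalIntegral.integral_of_le hA, integral_rpow (Or.inl (by linarith))]
  · rw [Real.zero_rpow (by linarith), neg_add_eq_sub, sub_zero]
  · exact (intervalIntegrable_iff_integrableOn_Ioc_of_le hA).1
      (intervalIntegral.intervalIntegrable_rpow' (by linarith))
  · exact (ae_restrict_iff' measurableSet_Ioc).2 (Filter.Eventually.of_forall fun y hy =>
      Real.rpow_nonneg hy.1.le _)

variable {Θ : ℝ≥0} {U : ℝ → ℝ → ℝ≥0} {v : ℝ → ℝ≥0} {p q : ℝ}

theorem lintegral_kernel_rpow_le_kerSup (hU : IsMonotoneKernel Θ U) (hq0 : 0 < q) (hq1 : q < 1)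
    (hp : 1 < p) (hv : IsBddBelowWeight v) {a T : ℝ} (ha : 0 ≤ a) (haT : a ≤ T) :
    ∫⁻ z in Ioo a T, (U z T : ℝ≥0∞) ^ conjExp p * (v z : ℝ≥0∞) ^ (1 - conjExp p) ≤
      ENNReal.ofReal (p / q) * ((U a T : ℝ≥0∞) ^ (conjExp p * (q / p)) *
        kerSup p q U v T ^ (conjExp p / rExp p q)) := by
  have hp' := conjExp_pos hp
  have hr := rExp_pos hq0 hq1 hp
  have hqr : q / rExp p q = 1 - q / p := by linarith [div_add_div_rExp hq0 hq1 hp]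
  have hsub : Ioo a T ⊆ Ioi 0 := fun z hz => ha.trans_lt hz.1
  have mv : AEMeasurable (fun z => (v z : ℝ≥0∞) ^ (1 - conjExp p)) (volume.restrict (Ioo a T)) :=
    (hv.measurable.coe_restrict hsub).pow_const _
  have mU := hU.aemeasurable_left (ha.trans haT) measurableSet_Ioo
    (hsub.trans Ioi_subset_Ici_self)
  set ν := (volume.restrict (Ioo a T)).withDensity fun z => (v z : ℝ≥0∞) ^ (1 - conjExp p) with hν
  have hac : ν ≪ volume.restrict (Ioo a T) := withDensity_absolutelyContinuous _ _
  set A : ℝ := (U a T : ℝ) ^ conjExp p with hA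
  have hcoe (z : ℝ) : (U z T : ℝ≥0∞) ^ conjExp p = ENNReal.ofReal ((U z T : ℝ) ^ conjExp p) := by
    rw [← ENNReal.ofReal_rpow_of_nonneg (U z T).coe_nonneg hp'.le, ENNReal.ofReal_coe_nnreal]
  have h1 : ∫⁻ z in Ioo a T, (U z T : ℝ≥0∞) ^ conjExp p * (v z : ℝ≥0∞) ^ (1 - conjExp p) =
      ∫⁻ y in Ioi 0, ν {z | y < (U z T : ℝ) ^ conjExp p} := by
    rw [← lintegral_eq_lintegral_meas_lt ν (Filter.Eventually.of_forall fun z => by positivity)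
      ((mU.mono_ac hac).coe_nnreal_real.pow_const _)]
    simp_rw [← hcoe]
    rw [hν, lintegral_withDensity_eq_lintegral_mul₀ mv (mU.coe_nnreal_ennreal.pow_const _)]
    exact lintegral_congr fun z => mul_comm _ _
  have hνc : ν (Ioo a T)ᶜ = 0 := hac (by simp)
  have h2 (y : ℝ) (hy : 0 < y) : ν {z | y < (U z T : ℝ) ^ conjExp p} ≤
      kerSup p q U v T ^ (conjExp p / rExp p q) * ENNReal.ofReal (y ^ (-(q / rExp p q))) := by
    have h3 : ν {z | y < (U z T : ℝ) ^ conjExp p} ≤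
        ν ({z | y < (U z T : ℝ) ^ conjExp p} ∩ Ioo a T) :=
      (measure_le_inter_add_sdiff _ _ (Ioo a T)).trans (by
        rw [measure_mono_null (sdiff_subset_compl _ _) hνc, add_zero])
    refine h3.trans (measure_le_of_forall_measure_Iio_le (bddAbove_Ioo.mono inter_subset_right) ?_)
    rintro z ⟨hz1, hz2⟩
    have h4 : ν (Iio z) ≤ sigmaInt p v z := by
      rw [hν, withDensity_apply _ measurableSet_Iio, Measure.restrict_restrict measurableSet_Iio]
      exact lintegral_mono_set fun x hx => ⟨ha.trans_lt hx.2.1, hx.1⟩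
    refine h4.trans ?_
    have h5 : ENNReal.ofReal y ^ (q / conjExp p) * sigmaInt p v z ^ (rExp p q / conjExp p) ≤
        kerSup p q U v T := by
      refine le_trans ?_ (le_kerSup (ha.trans_lt hz2.1) hz2.2.le)
      gcongr ?_ * _
      have : ENNReal.ofReal y ≤ (U z T : ℝ≥0∞) ^ conjExp p := by
        rw [hcoe]; exact ENNReal.ofReal_le_ofReal (le_of_lt hz1)
      refine (ENNReal.rpow_le_rpow this (by positivity)).trans ?_
      rw [← ENNReal.rpow_mul, mul_div_cancel₀ _ hp'.ne']
    have h6 := ENNReal.rpow_le_rpow h5 (show 0 ≤ conjExp p / rExp p q by positivity)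
    rw [ENNReal.mul_rpow_of_nonneg _ _ (by positivity), ← ENNReal.rpow_mul, ← ENNReal.rpow_mul,
      div_mul_div_cancel₀ hp'.ne', div_mul_div_cancel₀ hp'.ne', div_self hr.ne',
      ENNReal.rpow_one] at h6
    rw [← ENNReal.ofReal_rpow_of_pos hy, ENNReal.rpow_neg, ← div_eq_mul_inv,
      ENNReal.le_div_iff_mul_le, mul_comm]
    · exact h6
    · left; simp [ENNReal.rpow_eq_zero_iff, hy]
    · left; exact ENNReal.rpow_ne_top_of_nonneg (by positivity) ENNReal.ofReal_ne_top
  have h3 (y : ℝ) (hy : A ≤ y) : ν {z | y < (U z T : ℝ) ^ conjExp p} = 0 := by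
    refine measure_mono_null ?_ hνc
    intro z hz hz2
    have : U z T ≤ U a T := by exact_mod_cast hU.anti ha hz2.1.le (ha.trans haT)
    exact absurd (hz.trans_le ((Real.rpow_le_rpow (U z T).coe_nonneg this hp'.le).trans hy)) (lt_irrefl _)
  rw [h1]
  calc ∫⁻ y in Ioi 0, ν {z | y < (U z T : ℝ) ^ conjExp p}
      ≤ ∫⁻ y in Ioi 0, (Ioo 0 A).indicator (fun y => kerSup p q U v T ^ (conjExp p / rExp p q) *
          ENNReal.ofReal (y ^ (-(q / rExp p q)))) y := by
        refine setLIntegral_mono_ae' measurableSet_Ioi (Filter.Eventually.of_forall fun y hy => ?_)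
        by_cases hyA : y < A
        · rw [indicator_of_mem (show y ∈ Ioo 0 A from ⟨hy, hyA⟩)]
          exact h2 y hy
        · rw [h3 y (not_lt.1 hyA)]; exact zero_le
    _ = kerSup p q U v T ^ (conjExp p / rExp p q) * ENNReal.ofReal (A ^ (q / p) * (p / q)) := by
        rw [lintegral_indicator measurableSet_Ioo, Measure.restrict_restrict measurableSet_Ioo,
          inter_eq_left.2 Ioo_subset_Ioi_self, lintegral_const_mul'', lintegral_Ioo_rpow_neg]
        · rw [show 1 - q / rExp p q = q / p by linarith]
          congr 2; field_simp
        · positivity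
        · have : 0 < q / p := by positivity
          linarith
        · fun_prop
    _ = _ := by
        rw [ENNReal.ofReal_mul (by positivity), hA, ← Real.rpow_mul (U a T).coe_nonneg,
          ← ENNReal.ofReal_rpow_of_nonneg (U a T).coe_nonneg (by positivity), ENNReal.ofReal_coe_nnreal]
        ring

theorem lintegral_mul_kernel_rpow_le_kerSup (hU : IsMonotoneKernel Θ U) (hq0 : 0 < q) (hq1 : q < 1)
    (hp : 1 < p) (hv : IsBddBelowWeight v) {f : ℝ → ℝ≥0} (hf : NonnegMeasurable f) {E : Set ℝ}
    (hE : MeasurableSet E) {a T : ℝ} (hEa : E ⊆ Ioo a T) (ha : 0 ≤ a) (haT : a ≤ T) :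
    (∫⁻ x in E, (f x : ℝ≥0∞) * U x T) ^ q ≤ ENNReal.ofReal (p / q) ^ (q / conjExp p) *
      ((∫⁻ x in E, (f x : ℝ≥0∞) ^ p * v x) ^ (q / p) *
        ((U a T : ℝ≥0∞) ^ (q * (q / p)) * kerSup p q U v T ^ (q / rExp p q))) := by
  have hp' := conjExp_pos hp
  have hr := rExp_pos hq0 hq1 hp
  have h1 := lintegral_mul_kernel_le hU hp hv hf hE (hEa.trans fun z hz => ha.trans_lt hz.1)
    (ha.trans haT)
  have h2 := (lintegral_mono_set hEa).trans
    (lintegral_kernel_rpow_le_kerSup hU hq0 hq1 hp hv ha haT)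
  refine (ENNReal.rpow_le_rpow (h1.trans (mul_le_mul_right
    (ENNReal.rpow_le_rpow h2 (by positivity)) _)) hq0.le).trans (le_of_eq ?_)
  have hq' : 0 ≤ q / conjExp p := by positivity
  rw [ENNReal.mul_rpow_of_nonneg _ _ hq0.le, ← ENNReal.rpow_mul, ← ENNReal.rpow_mul,
    one_div_mul_eq_div, one_div_mul_eq_div, ENNReal.mul_rpow_of_nonneg _ _ hq',
    ENNReal.mul_rpow_of_nonneg _ _ hq', ← ENNReal.rpow_mul, ← ENNReal.rpow_mul,
    show conjExp p * (q / p) * (q / conjExp p) = q * (q / p) by field_simp,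
    show conjExp p / rExp p q * (q / conjExp p) = q / rExp p q by field_simp]
  ring

end

noncomputable section

/-- An increasing bounded sequence of points together with masses that halve at each step. -/
structure IsDyadicGrid (t : ℕ → ℝ) (m : ℕ → ℝ≥0∞) : Prop where
  zero : t 0 = 0
  strictMono : StrictMono t
  bddAbove : ∃ R, ∀ k, t k ≤ R
  mass : ∀ k, m k = m 0 * 2⁻¹ ^ k
  mass_ne_top : m 0 ≠ ∞

/-- The discrete analogue of `∫ₜ^∞ w(x) U^q(t, x) dx` at the point `t (l + 1)`. -/
def gridTail (q : ℝ) (U : ℝ → ℝ → ℝ≥0) (t : ℕ → ℝ) (m : ℕ → ℝ≥0∞) (l : ℕ) : ℝ≥0∞ :=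
  ∑' k, if l ≤ k then m k * (U (t (l + 1)) (t (k + 1)) : ℝ≥0∞) ^ q else 0

theorem tsum_ite_mem_finset (s : Finset ℕ) (g : ℕ → ℝ≥0∞) :
    ∑' k, (if k ∈ s then g k else 0) = ∑ k ∈ s, g k := by
  rw [tsum_eq_sum (s := s) (fun i hi => by simp [hi])]
  exact Finset.sum_congr rfl fun i hi => by simp [hi]

theorem ENNReal.le_two_mul_of_le_add_half {x a : ℝ≥0∞} (hx : x ≠ ∞) (h : x ≤ a + x / 2) :
    x ≤ 2 * a := by
  have h1 : x / 2 ≤ a := by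
    have h2 : x / 2 + x / 2 ≤ a + x / 2 := by rwa [ENNReal.add_halves]
    exact (ENNReal.add_le_add_iff_right (ENNReal.div_lt_top hx two_ne_zero).ne).1 h2
  calc x = x / 2 + x / 2 := (ENNReal.add_halves x).symm
    _ ≤ a + a := add_le_add h1 h1
    _ = 2 * a := (two_mul a).symm

namespace IsDyadicGrid

variable {t : ℕ → ℝ} {m : ℕ → ℝ≥0∞}

theorem nonneg (hG : IsDyadicGrid t m) (k : ℕ) : 0 ≤ t k :=
  hG.zero ▸ hG.strictMono.monotone (Nat.zero_le k)

theorem pos (hG : IsDyadicGrid t m) (k : ℕ) : 0 < t (k + 1) :=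
  hG.zero ▸ hG.strictMono (Nat.succ_pos k)

theorem le (hG : IsDyadicGrid t m) {k l : ℕ} (h : k ≤ l) : t k ≤ t l := hG.strictMono.monotone h

theorem ne_top (hG : IsDyadicGrid t m) (k : ℕ) : m k ≠ ∞ := by
  rw [hG.mass]
  exact ENNReal.mul_ne_top hG.mass_ne_top (ENNReal.pow_ne_top (by simp))

theorem two_mul_succ (hG : IsDyadicGrid t m) (k : ℕ) : 2 * m (k + 1) = m k := by
  rw [hG.mass k, hG.mass (k + 1), pow_succ, mul_left_comm, mul_left_comm 2,
    ENNReal.mul_inv_cancel two_ne_zero (by simp), mul_one]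

theorem tsum_succ_add (hG : IsDyadicGrid t m) (e : ℕ) : ∑' i, m (e + 1 + i) = m e := by
  have h (i : ℕ) : m (e + 1 + i) = m (e + 1) * 2⁻¹ ^ i := by
    rw [hG.mass, hG.mass (e + 1), mul_assoc, pow_add]
  simp_rw [h]
  rw [ENNReal.tsum_mul_left, ENNReal.tsum_geometric, ENNReal.one_sub_inv_two, inv_inv, mul_comm]
  exact hG.two_mul_succ e

theorem tsum_ite_lt (hG : IsDyadicGrid t m) (e : ℕ) : ∑' k, (if e < k then m k else 0) = m e := by
  rw [← hG.tsum_succ_add e]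
  have hinj : Function.Injective (fun i : ℕ => e + 1 + i) := add_right_injective _
  rw [← hinj.tsum_eq (f := fun k => if e < k then m k else 0)]
  · exact tsum_congr fun i => by simp [show e < e + 1 + i by omega]
  · intro k hk
    have hk' : e < k := by by_contra h; simp [h] at hk
    exact ⟨k - (e + 1), by simp only []; omega⟩

theorem tsum_ite_le (hG : IsDyadicGrid t m) (e : ℕ) :
    ∑' k, (if e ≤ k then m k else 0) = 2 * m e := by
  have h (k : ℕ) : (if e ≤ k then m k else 0) =
      (if k ∈ ({e} : Finset ℕ) then m k else 0) + (if e < k then m k else 0) := by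
    rcases lt_trichotomy e k with h | h | h
    · simp [h, h.le, h.ne']
    · simp [h]
    · simp [h.not_ge, h.not_gt, h.ne]
  simp_rw [h]
  rw [ENNReal.tsum_add, tsum_ite_mem_finset, hG.tsum_ite_lt, two_mul, Finset.sum_singleton]

end IsDyadicGrid

variable {Θ : ℝ≥0} {U : ℝ → ℝ → ℝ≥0} {v : ℝ → ℝ≥0} {p q : ℝ} {t : ℕ → ℝ} {m : ℕ → ℝ≥0∞}

theorem gridTail_antitone (hU : IsMonotoneKernel Θ U) (hq0 : 0 < q) (hG : IsDyadicGrid t m) :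
    Antitone (gridTail q U t m) := by
  intro l l' h
  refine ENNReal.tsum_le_tsum fun k => ?_
  split_ifs with h1 h2
  · gcongr _ * ?_
    exact hU.anti_rpow (hG.nonneg _) (hG.le (by omega)) (hG.nonneg _) hq0.le
  · omega
  · exact zero_le
  · exact le_rfl

theorem sum_le_gridTail {l : ℕ} (s : Finset ℕ) (h : ∀ k ∈ s, l ≤ k) :
    ∑ k ∈ s, m k * (U (t (l + 1)) (t (k + 1)) : ℝ≥0∞) ^ q ≤ gridTail q U t m l := by
  refine le_trans (le_of_eq ?_) (ENNReal.sum_le_tsum s)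
  exact Finset.sum_congr rfl fun k hk => by rw [if_pos (h k hk)]

theorem exists_gridTail_le_mass (hU : IsMonotoneKernel Θ U) (hq0 : 0 < q)
    (hG : IsDyadicGrid t m) : ∃ c : ℝ≥0∞, c ≠ ∞ ∧ ∀ l, gridTail q U t m l ≤ c * m l := by
  obtain ⟨R, hR⟩ := hG.bddAbove
  refine ⟨2 * (U 0 R : ℝ≥0∞) ^ q,
    ENNReal.mul_ne_top (by simp) (ENNReal.rpow_ne_top_of_nonneg hq0.le (by simp)), fun l => ?_⟩
  rw [mul_right_comm, ← hG.tsum_ite_le, ← ENNReal.tsum_mul_right]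
  refine ENNReal.tsum_le_tsum fun k => ?_
  split_ifs
  · gcongr _ * ?_
    exact (hU.anti_rpow le_rfl (hG.nonneg _) (hG.nonneg _) hq0.le).trans
      (hU.mono_rpow le_rfl (hG.nonneg _) (hR _) hq0.le)
  · simp

theorem gridTail_ne_top (hU : IsMonotoneKernel Θ U) (hq0 : 0 < q)
    (hG : IsDyadicGrid t m) (l : ℕ) : gridTail q U t m l ≠ ∞ := by
  obtain ⟨c, hc, h⟩ := exists_gridTail_le_mass hU hq0 hG
  exact ((h l).trans_lt (ENNReal.mul_lt_top hc.lt_top (hG.ne_top l).lt_top)).ne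

theorem exists_gridTail_le_mul (hU : IsMonotoneKernel Θ U) (hq0 : 0 < q)
    (hG : IsDyadicGrid t m) {ε : ℝ≥0∞} (hε : ε ≠ 0) (j : ℕ) :
    ∃ k, j < k ∧ gridTail q U t m k ≤ ε * gridTail q U t m j := by
  rcases eq_or_ne (gridTail q U t m j) 0 with h0 | h0
  · exact ⟨j + 1, by omega, (gridTail_antitone hU hq0 hG (Nat.le_succ j)).trans (by simp [h0])⟩
  obtain ⟨c, hc, h⟩ := exists_gridTail_le_mass hU hq0 hG
  have hlim : Filter.Tendsto (fun k => c * m k) Filter.atTop (nhds 0) := by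
    have h1 := ENNReal.Tendsto.const_mul (a := c * m 0)
      (ENNReal.tendsto_pow_atTop_nhds_zero_of_lt_one (r := 2⁻¹) (by simp))
      (Or.inr (ENNReal.mul_ne_top hc hG.mass_ne_top))
    rw [mul_zero] at h1
    refine h1.congr fun k => ?_
    rw [hG.mass k, mul_assoc]
  have hpos : 0 < ε * gridTail q U t m j := pos_iff_ne_zero.2 (mul_ne_zero hε h0)
  obtain ⟨k, hk1, hk2⟩ :=
    ((hlim.eventually (gt_mem_nhds hpos)).and (Filter.eventually_gt_atTop j)).exists
  exact ⟨k, hk2, (h k).trans hk1.le⟩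

/-- The ratio by which `gridTail` drops between consecutive blocks. -/
def dropRatio (q : ℝ) (Θ : ℝ≥0) : ℝ≥0∞ := (2 * (Θ : ℝ≥0∞) ^ q)⁻¹

theorem dropRatio_ne_zero (hq0 : 0 < q) : dropRatio q Θ ≠ 0 :=
  ENNReal.inv_ne_zero.2 (ENNReal.mul_ne_top (by simp)
    (ENNReal.rpow_ne_top_of_nonneg hq0.le (by simp)))

theorem IsMonotoneKernel.dropRatio_le_one (hU : IsMonotoneKernel Θ U) (hq0 : 0 < q) :
    dropRatio q Θ ≤ 1 := by
  rw [dropRatio, ENNReal.inv_le_one]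
  calc (1 : ℝ≥0∞) = 1 * 1 := (one_mul 1).symm
    _ ≤ _ := mul_le_mul' (by norm_num) (hU.one_le_rpow hq0.le)

theorem IsMonotoneKernel.rpow_ne_zero (hU : IsMonotoneKernel Θ U) (hq0 : 0 < q) :
    (Θ : ℝ≥0∞) ^ q ≠ 0 :=
  (lt_of_lt_of_le one_pos (hU.one_le_rpow hq0.le)).ne'

theorem le_of_dropRatio_mul_le (hU : IsMonotoneKernel Θ U) (hq0 : 0 < q) {a b : ℝ≥0∞}
    (h : dropRatio q Θ * a ≤ b) : a ≤ 2 * (Θ : ℝ≥0∞) ^ q * b := by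
  have hΘ := hU.rpow_ne_zero hq0
  have hΘ' : (Θ : ℝ≥0∞) ^ q ≠ ∞ := ENNReal.rpow_ne_top_of_nonneg hq0.le (by simp)
  rw [dropRatio, mul_comm, ← div_eq_mul_inv] at h
  rw [mul_comm]
  exact (ENNReal.div_le_iff_le_mul (Or.inl (mul_ne_zero two_ne_zero hΘ))
    (Or.inl (ENNReal.mul_ne_top (by simp) hΘ'))).1 h

theorem gridTail_le_sum_Icc (hU : IsMonotoneKernel Θ U) (hq0 : 0 < q) (hq1 : q < 1)
    (hG : IsDyadicGrid t m) {l e : ℕ} (hle : l ≤ e)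
    (h : gridTail q U t m e ≤ dropRatio q Θ * gridTail q U t m l) :
    gridTail q U t m l ≤ 4 * (Θ : ℝ≥0∞) ^ q *
      ∑ k ∈ Finset.Icc l e, m k * (U (t (l + 1)) (t (k + 1)) : ℝ≥0∞) ^ q := by
  have hΘ := hU.rpow_ne_zero hq0
  have hΘ' : (Θ : ℝ≥0∞) ^ q ≠ ∞ := ENNReal.rpow_ne_top_of_nonneg hq0.le (by simp)
  set u : ℕ → ℕ → ℝ≥0∞ := fun l k => (U (t (l + 1)) (t (k + 1)) : ℝ≥0∞) ^ q with hu
  have h1 (k : ℕ) : (if l ≤ k then m k * u l k else 0) ≤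
      (if k ∈ Finset.Icc l e then m k * u l k else 0) + (Θ : ℝ≥0∞) ^ q *
        (u l e * (if e < k then m k else 0) + (if e ≤ k then m k * u e k else 0)) := by
    by_cases hk : e < k
    · rw [if_pos (by omega), if_pos hk, if_pos hk.le]
      refine le_trans ?_ le_add_self
      calc m k * u l k ≤ m k * ((Θ : ℝ≥0∞) ^ q * (u l e + u e k)) := by
            gcongr
            exact hU.reg_rpow (hG.nonneg _) (hG.le (by omega)) (hG.le (by omega)) hq0 hq1
        _ = _ := by ring
    · refine le_trans ?_ le_self_add
      split_ifs with h2 h3 h3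
      · exact le_rfl
      · simp only [Finset.mem_Icc] at h3; omega
      · exact zero_le
      · exact le_rfl
  have h2 := ENNReal.tsum_le_tsum h1
  rw [ENNReal.tsum_add, tsum_ite_mem_finset, ENNReal.tsum_mul_left, ENNReal.tsum_add,
    ENNReal.tsum_mul_left, hG.tsum_ite_lt] at h2
  have h3 : u l e * m e ≤ ∑ k ∈ Finset.Icc l e, m k * u l k := by
    rw [mul_comm]
    exact Finset.single_le_sum (f := fun k => m k * u l k) (fun _ _ => zero_le)
      (Finset.right_mem_Icc.2 hle)
  set A := ∑ k ∈ Finset.Icc l e, m k * u l k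
  have h4 : gridTail q U t m l ≤ (1 + (Θ : ℝ≥0∞) ^ q) * A + gridTail q U t m l / 2 := by
    refine h2.trans ?_
    calc A + (Θ : ℝ≥0∞) ^ q * (u l e * m e + gridTail q U t m e)
        ≤ A + (Θ : ℝ≥0∞) ^ q * (A + dropRatio q Θ * gridTail q U t m l) := by gcongr
      _ = (1 + (Θ : ℝ≥0∞) ^ q) * A +
          ((Θ : ℝ≥0∞) ^ q * ((Θ : ℝ≥0∞) ^ q)⁻¹) * (gridTail q U t m l * 2⁻¹) := by
        rw [dropRatio, ENNReal.mul_inv (by simp) (by simp)]; ring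
      _ = _ := by rw [ENNReal.mul_inv_cancel hΘ hΘ', one_mul, div_eq_mul_inv]
  refine (ENNReal.le_two_mul_of_le_add_half (gridTail_ne_top hU hq0 hG l) h4).trans ?_
  calc 2 * ((1 + (Θ : ℝ≥0∞) ^ q) * A) ≤ 2 * (((Θ : ℝ≥0∞) ^ q + (Θ : ℝ≥0∞) ^ q) * A) := by
        gcongr; exact hU.one_le_rpow hq0.le
    _ = 4 * (Θ : ℝ≥0∞) ^ q * A := by ring

/-- The `k`-th term of the discrete form of `A₁*`. -/
def gridOne (p q : ℝ) (U : ℝ → ℝ → ℝ≥0) (v : ℝ → ℝ≥0) (t : ℕ → ℝ) (m : ℕ → ℝ≥0∞) (k : ℕ) :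
    ℝ≥0∞ :=
  m k ^ (rExp p q / q) * kerInt p U v (t (k + 1)) ^ (rExp p q / conjExp p)

/-- The `k`-th term of the discrete form of `A₂*`. -/
def gridTwo (p q : ℝ) (U : ℝ → ℝ → ℝ≥0) (v : ℝ → ℝ≥0) (t : ℕ → ℝ) (m : ℕ → ℝ≥0∞) (k : ℕ) :
    ℝ≥0∞ :=
  m k * gridTail q U t m k ^ (rExp p q / p) * kerSup p q U v (t (k + 1))

theorem ENNReal.rpow_rExp_div (hq0 : 0 < q) (hq1 : q < 1) (hp : 1 < p) (x : ℝ≥0∞) :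
    x ^ (rExp p q / q) = x ^ (rExp p q / p) * x := by
  have hr := rExp_pos hq0 hq1 hp
  rw [rExp_div_right hq0 hq1 hp, ENNReal.rpow_add_of_nonneg _ _ (by positivity) zero_le_one,
    ENNReal.rpow_one]

theorem gridTail_rpow_mul_sigmaInt_le (hU : IsMonotoneKernel Θ U) (hq0 : 0 < q) (hq1 : q < 1)
    (hp : 1 < p) (hG : IsDyadicGrid t m) {l e : ℕ} (hle : l < e)
    (h : gridTail q U t m e ≤ dropRatio q Θ * gridTail q U t m l) :
    gridTail q U t m l ^ (rExp p q / q) * sigmaInt p v (t (l + 1)) ^ (rExp p q / conjExp p) ≤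
      (8 * (Θ : ℝ≥0∞) ^ q * (2 * (Θ : ℝ≥0∞) ^ q) ^ (rExp p q / p) +
        (8 * (Θ : ℝ≥0∞) ^ q) ^ (rExp p q / q)) *
      ∑ k ∈ Finset.Icc l e, (gridOne p q U v t m k + gridTwo p q U v t m k) := by
  classical
  have hr := rExp_pos hq0 hq1 hp
  have hp' := conjExp_pos hp
  have hp0 : 0 < p := by linarith
  have hex : ∃ k, l < k ∧ gridTail q U t m k ≤ dropRatio q Θ * gridTail q U t m l := ⟨e, hle, h⟩
  obtain ⟨e', ⟨hle', he'⟩, hmin⟩ : ∃ e', (l < e' ∧ gridTail q U t m e' ≤ dropRatio q Θ *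
      gridTail q U t m l) ∧ ∀ k < e', ¬ (l < k ∧ gridTail q U t m k ≤ dropRatio q Θ *
      gridTail q U t m l) := ⟨Nat.find hex, Nat.find_spec hex, fun k hk => Nat.find_min hex hk⟩
  have hee : e' ≤ e := by
    by_contra hcon
    exact hmin e (by omega) ⟨hle, h⟩
  have h1 := gridTail_le_sum_Icc hU hq0 hq1 hG hle'.le he'
  set Φ := gridTail q U t m with hΦ
  set N := sigmaInt p v (t (l + 1)) ^ (rExp p q / conjExp p) with hN
  have hk (k : ℕ) (h1 : l ≤ k) (h2 : k < e') :
      Φ l ^ (rExp p q / p) ≤ (2 * (Θ : ℝ≥0∞) ^ q) ^ (rExp p q / p) * Φ k ^ (rExp p q / p) := by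
    rw [← ENNReal.mul_rpow_of_nonneg _ _ (by positivity)]
    refine ENNReal.rpow_le_rpow (le_of_dropRatio_mul_le hU hq0 ?_) (by positivity)
    rcases h1.eq_or_lt with rfl | h1
    · exact mul_le_of_le_one_left zero_le (hU.dropRatio_le_one hq0)
    · by_contra hcon
      exact hmin k h2 ⟨h1, (not_le.1 hcon).le⟩
  rw [← Finset.Ico_insert_right hle'.le, Finset.sum_insert (by simp)] at h1
  set b := m e' * (U (t (l + 1)) (t (e' + 1)) : ℝ≥0∞) ^ q with hb
  set a := ∑ k ∈ Finset.Ico l e', m k * (U (t (l + 1)) (t (k + 1)) : ℝ≥0∞) ^ q with ha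
  rcases le_total b a with hab | hab
  · have h2 : Φ l ≤ 8 * (Θ : ℝ≥0∞) ^ q * a := by
      refine h1.trans ?_
      calc 4 * (Θ : ℝ≥0∞) ^ q * (b + a) ≤ 4 * (Θ : ℝ≥0∞) ^ q * (a + a) := by gcongr
        _ = _ := by ring
    calc Φ l ^ (rExp p q / q) * N = Φ l ^ (rExp p q / p) * Φ l * N := by
          rw [ENNReal.rpow_rExp_div hq0 hq1 hp]
      _ ≤ Φ l ^ (rExp p q / p) * (8 * (Θ : ℝ≥0∞) ^ q * a) * N := by gcongr
      _ = 8 * (Θ : ℝ≥0∞) ^ q * ∑ k ∈ Finset.Ico l e', Φ l ^ (rExp p q / p) *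
            (m k * ((U (t (l + 1)) (t (k + 1)) : ℝ≥0∞) ^ q * N)) := by
          rw [← Finset.mul_sum, ha, mul_assoc, mul_assoc, Finset.sum_mul, mul_left_comm]
          congr 2
          exact Finset.sum_congr rfl fun k _ => by ring
      _ ≤ 8 * (Θ : ℝ≥0∞) ^ q * ∑ k ∈ Finset.Ico l e', (2 * (Θ : ℝ≥0∞) ^ q) ^ (rExp p q / p) *
            (gridOne p q U v t m k + gridTwo p q U v t m k) := by
          refine mul_le_mul' le_rfl (Finset.sum_le_sum fun k hk' => ?_)
          rw [Finset.mem_Ico] at hk'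
          calc _ ≤ ((2 * (Θ : ℝ≥0∞) ^ q) ^ (rExp p q / p) * Φ k ^ (rExp p q / p)) *
                (m k * kerSup p q U v (t (k + 1))) := by
                gcongr
                · exact hk k hk'.1 hk'.2
                · exact le_kerSup (hG.pos l) (hG.le (by omega))
            _ = (2 * (Θ : ℝ≥0∞) ^ q) ^ (rExp p q / p) * gridTwo p q U v t m k := by
                rw [gridTwo]; ring
            _ ≤ _ := by gcongr; exact le_add_self
      _ ≤ (8 * (Θ : ℝ≥0∞) ^ q * (2 * (Θ : ℝ≥0∞) ^ q) ^ (rExp p q / p)) *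
            ∑ k ∈ Finset.Icc l e, (gridOne p q U v t m k + gridTwo p q U v t m k) := by
          rw [← Finset.mul_sum, ← mul_assoc]
          gcongr
          intro k hk'
          simp only [Finset.mem_Ico, Finset.mem_Icc] at hk' ⊢
          omega
      _ ≤ _ := by gcongr; exact le_self_add
  · have h2 : Φ l ≤ 8 * (Θ : ℝ≥0∞) ^ q * b := by
      refine h1.trans ?_
      calc 4 * (Θ : ℝ≥0∞) ^ q * (b + a) ≤ 4 * (Θ : ℝ≥0∞) ^ q * (b + b) := by gcongr
        _ = _ := by ring
    calc Φ l ^ (rExp p q / q) * N ≤ (8 * (Θ : ℝ≥0∞) ^ q * b) ^ (rExp p q / q) * N := by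
          gcongr
      _ = (8 * (Θ : ℝ≥0∞) ^ q) ^ (rExp p q / q) * (m e' ^ (rExp p q / q) *
            ((U (t (l + 1)) (t (e' + 1)) : ℝ≥0∞) ^ rExp p q * N)) := by
          rw [ENNReal.mul_rpow_of_nonneg _ b (by positivity), hb,
            ENNReal.mul_rpow_of_nonneg (m e') _ (by positivity), ← ENNReal.rpow_mul _ q,
            mul_div_cancel₀ _ hq0.ne']
          ring
      _ ≤ (8 * (Θ : ℝ≥0∞) ^ q) ^ (rExp p q / q) * gridOne p q U v t m e' := by
          rw [gridOne]
          gcongr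
          exact rpow_rExp_mul_sigmaInt_le_kerInt hU hq0 hq1 hp (hG.nonneg _) (hG.le (by omega))
      _ ≤ (8 * (Θ : ℝ≥0∞) ^ q) ^ (rExp p q / q) *
            ∑ k ∈ Finset.Icc l e, (gridOne p q U v t m k + gridTwo p q U v t m k) := by
          gcongr
          refine le_trans le_self_add (Finset.single_le_sum (f := fun k =>
            gridOne p q U v t m k + gridTwo p q U v t m k) (fun _ _ => zero_le) ?_)
          simp only [Finset.mem_Icc]; omega
      _ ≤ _ := by gcongr; exact le_add_self

end

noncomputable section

variable {Θ : ℝ≥0} {U : ℝ → ℝ → ℝ≥0} {v : ℝ → ℝ≥0} {p q : ℝ} {t : ℕ → ℝ} {m : ℕ → ℝ≥0∞}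

/-- The constant in the estimate of the operator on one block. -/
def blockConst (p q : ℝ) (Θ : ℝ≥0) : ℝ≥0∞ :=
  (Θ : ℝ≥0∞) ^ q + ENNReal.ofReal (p / q) ^ (q / conjExp p)

theorem blockConst_ne_top (hq0 : 0 < q) (hp : 1 < p) : blockConst p q Θ ≠ ∞ := by
  have := conjExp_pos hp
  exact ENNReal.add_ne_top.2 ⟨ENNReal.rpow_ne_top_of_nonneg hq0.le (by simp),
    ENNReal.rpow_ne_top_of_nonneg (by positivity) (by simp)⟩

/-- The quantity that controls the operator on the block `(t j, t (l + 1)]`. -/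
def blockTerm (p q : ℝ) (U : ℝ → ℝ → ℝ≥0) (v : ℝ → ℝ≥0) (t : ℕ → ℝ) (m : ℕ → ℝ≥0∞) (j l : ℕ) :
    ℝ≥0∞ :=
  gridOne p q U v t m j + gridOne p q U v t m l +
    gridTail q U t m j ^ (rExp p q / q) * sigmaInt p v (t (l + 1)) ^ (rExp p q / conjExp p) +
    gridTail q U t m j ^ (rExp p q / p) * ∑ k ∈ Finset.Icc j l, m k * kerSup p q U v (t (k + 1))

theorem rpow_block_le (hU : IsMonotoneKernel Θ U) (hq0 : 0 < q) (hq1 : q < 1) (hp : 1 < p)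
    (hv : IsBddBelowWeight v) (hG : IsDyadicGrid t m) {f : ℝ → ℝ≥0} (hf : NonnegMeasurable f)
    (j l k : ℕ) :
    (∫⁻ x in Ioc (t j) (t (l + 1)) ∩ Iio (t (k + 1)), (f x : ℝ≥0∞) * U x (t (k + 1))) ^ q ≤
      blockConst p q Θ * (∫⁻ x in Ioc (t j) (t (l + 1)), (f x : ℝ≥0∞) ^ p * v x) ^ (q / p) *
      ((if l < k then 1 else 0) * kerInt p U v (t (l + 1)) ^ (q / conjExp p) +
      (if l ≤ k then (U (t (l + 1)) (t (k + 1)) : ℝ≥0∞) ^ q else 0) *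
        sigmaInt p v (t (l + 1)) ^ (q / conjExp p) +
      (if j ≤ k then 1 else 0) * kerInt p U v (t (j + 1)) ^ (q / conjExp p) +
      (if j ≤ k then (U (t (j + 1)) (t (k + 1)) : ℝ≥0∞) ^ q else 0) *
        sigmaInt p v (t (j + 1)) ^ (q / conjExp p) +
      (if k ∈ Finset.Icc j l then (U (t (j + 1)) (t (k + 1)) : ℝ≥0∞) ^ (q * (q / p)) *
        kerSup p q U v (t (k + 1)) ^ (q / rExp p q) else 0)) := by
  have hp0 : 0 < p := by linarith
  have hr := rExp_pos hq0 hq1 hp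
  set E := Ioc (t j) (t (l + 1)) with hE
  set T := t (k + 1) with hT
  set X := ∫⁻ x in E, (f x : ℝ≥0∞) ^ p * v x with hX
  have hsub (s : Set ℝ) (h : s ⊆ E) : (∫⁻ x in s, (f x : ℝ≥0∞) ^ p * v x) ^ (q / p) ≤ X ^ (q / p) :=
    ENNReal.rpow_le_rpow (lintegral_mono_set h) (by positivity)
  have hc1 : (Θ : ℝ≥0∞) ^ q ≤ blockConst p q Θ := le_self_add
  have hc2 : ENNReal.ofReal (p / q) ^ (q / conjExp p) ≤ blockConst p q Θ := le_add_self
  set C := blockConst p q Θ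
  rcases lt_or_ge k j with hkj | hjk
  · have : E ∩ Iio T = ∅ := by
      ext x
      simp only [hE, hT, mem_inter_iff, mem_Ioc, mem_Iio, mem_empty_iff_false, iff_false]
      rintro ⟨⟨h1, -⟩, h2⟩
      exact absurd (h1.trans (h2.trans_le (hG.le hkj))) (lt_irrefl _)
    rw [this]
    simp [hq0]
  rcases lt_or_ge l k with hlk | hkl
  · have h := lintegral_mul_kernel_rpow_le_of_le hU hq0 hq1 hp hv hf
      (E := E ∩ Iio T) (measurableSet_Ioc.inter measurableSet_Iio) (y := t (l + 1)) (T := T)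
      (fun x hx => ⟨(hG.nonneg j).trans_lt hx.1.1, hx.1.2⟩) (hG.nonneg _) (hG.le (by omega))
    refine h.trans ?_
    rw [← mul_assoc, if_pos hlk, if_pos hlk.le, one_mul]
    refine mul_le_mul' (mul_le_mul' hc1 (hsub _ inter_subset_left)) ?_
    rw [add_assoc, add_assoc]
    exact le_self_add
  · set E1 := E ∩ Iio T ∩ Iic (t (j + 1))
    set E2 := E ∩ Iio T ∩ Ioi (t (j + 1))
    have h1 := lintegral_mul_kernel_rpow_le_of_le hU hq0 hq1 hp hv hf
      (E := E1) ((measurableSet_Ioc.inter measurableSet_Iio).inter measurableSet_Iic)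
      (y := t (j + 1)) (T := T)
      (fun x hx => ⟨(hG.nonneg j).trans_lt hx.1.1.1, hx.2⟩) (hG.nonneg _) (hG.le (by omega))
    have h2 := lintegral_mul_kernel_rpow_le_kerSup hU hq0 hq1 hp hv hf
      (E := E2) ((measurableSet_Ioc.inter measurableSet_Iio).inter measurableSet_Ioi)
      (a := t (j + 1)) (T := T)
      (fun x hx => ⟨hx.2, hx.1.2⟩) (hG.nonneg _) (hG.le (by omega))
    have h3 : E ∩ Iio T ⊆ E1 ∪ E2 := fun x hx => by
      rcases le_or_gt x (t (j + 1)) with h | h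
      · exact Or.inl ⟨hx, h⟩
      · exact Or.inr ⟨hx, h⟩
    refine (ENNReal.rpow_le_rpow ((lintegral_mono_set h3).trans (lintegral_union_le _ _ _))
      hq0.le).trans ((ENNReal.rpow_add_le_add_rpow _ _ hq0.le hq1.le).trans
      ((add_le_add h1 h2).trans ?_))
    rw [← mul_assoc, ← mul_assoc, if_pos hjk, if_pos hjk, if_pos (Finset.mem_Icc.2 ⟨hjk, hkl⟩),
      one_mul]
    refine (add_le_add
      (mul_le_mul' (mul_le_mul' hc1 (hsub _ (inter_subset_left.trans inter_subset_left))) le_rfl)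
      (mul_le_mul' (mul_le_mul' hc2 (hsub _ (inter_subset_left.trans inter_subset_left)))
        le_rfl)).trans ?_
    rw [← mul_add]
    gcongr _ * ?_
    gcongr ?_ + _
    rw [add_assoc _ (kerInt p U v (t (j + 1)) ^ (q / conjExp p))]
    exact le_add_self

theorem tsum_block_le (hU : IsMonotoneKernel Θ U) (hq0 : 0 < q) (hq1 : q < 1) (hp : 1 < p)
    (hv : IsBddBelowWeight v) (hG : IsDyadicGrid t m) {f : ℝ → ℝ≥0} (hf : NonnegMeasurable f)
    {j l : ℕ} (hjl : j ≤ l) :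
    ∑' k, m k * (∫⁻ x in Ioc (t j) (t (l + 1)) ∩ Iio (t (k + 1)),
        (f x : ℝ≥0∞) * U x (t (k + 1))) ^ q ≤
      6 * blockConst p q Θ * ((∫⁻ x in Ioc (t j) (t (l + 1)), (f x : ℝ≥0∞) ^ p * v x) ^ (q / p) *
        blockTerm p q U v t m j l ^ (q / rExp p q)) := by
  have hp0 : 0 < p := by linarith
  have hp' := conjExp_pos hp
  have hr := rExp_pos hq0 hq1 hp
  set X := ∫⁻ x in Ioc (t j) (t (l + 1)), (f x : ℝ≥0∞) ^ p * v x with hX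
  set B := blockTerm p q U v t m j l with hB
  have hs : 0 ≤ q / rExp p q := by positivity
  have hV (k : ℕ) : m k * kerInt p U v (t (k + 1)) ^ (q / conjExp p) =
      gridOne p q U v t m k ^ (q / rExp p q) := by
    rw [gridOne, ENNReal.mul_rpow_of_nonneg _ _ hs, ← ENNReal.rpow_mul, ← ENNReal.rpow_mul,
      show rExp p q / q * (q / rExp p q) = 1 by field_simp,
      show rExp p q / conjExp p * (q / rExp p q) = q / conjExp p by field_simp, ENNReal.rpow_one]
  have hN : gridTail q U t m j * sigmaInt p v (t (l + 1)) ^ (q / conjExp p) =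
      (gridTail q U t m j ^ (rExp p q / q) *
        sigmaInt p v (t (l + 1)) ^ (rExp p q / conjExp p)) ^ (q / rExp p q) := by
    rw [ENNReal.mul_rpow_of_nonneg _ _ hs, ← ENNReal.rpow_mul, ← ENNReal.rpow_mul,
      show rExp p q / q * (q / rExp p q) = 1 by field_simp,
      show rExp p q / conjExp p * (q / rExp p q) = q / conjExp p by field_simp, ENNReal.rpow_one]
  have b1 : gridOne p q U v t m l ^ (q / rExp p q) ≤ B ^ (q / rExp p q) :=
    ENNReal.rpow_le_rpow (le_add_right (le_add_right le_add_self)) hs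
  have b2 : gridOne p q U v t m j ^ (q / rExp p q) ≤ B ^ (q / rExp p q) :=
    ENNReal.rpow_le_rpow (le_add_right (le_add_right le_self_add)) hs
  have b3 : gridTail q U t m j * sigmaInt p v (t (l + 1)) ^ (q / conjExp p) ≤
      B ^ (q / rExp p q) := by
    rw [hN]
    exact ENNReal.rpow_le_rpow (le_add_right le_add_self) hs
  have b4 : ∑ k ∈ Finset.Icc j l, m k * ((U (t (j + 1)) (t (k + 1)) : ℝ≥0∞) ^ (q * (q / p)) *
      kerSup p q U v (t (k + 1)) ^ (q / rExp p q)) ≤ B ^ (q / rExp p q) := by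
    have h1 : ∀ k, m k * ((U (t (j + 1)) (t (k + 1)) : ℝ≥0∞) ^ (q * (q / p)) *
        kerSup p q U v (t (k + 1)) ^ (q / rExp p q)) =
        (m k * (U (t (j + 1)) (t (k + 1)) : ℝ≥0∞) ^ q) ^ (q / p) *
          (m k * kerSup p q U v (t (k + 1))) ^ (q / rExp p q) := fun k => by
      rw [ENNReal.mul_rpow_of_nonneg _ _ hs, ENNReal.mul_rpow_of_nonneg _ _ (by positivity),
        ← ENNReal.rpow_mul]
      conv_lhs => rw [← ENNReal.rpow_one (m k), ← div_add_div_rExp hq0 hq1 hp,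
        ENNReal.rpow_add_of_nonneg _ _ (by positivity) hs]
      ring
    simp_rw [h1]
    refine (ENNReal.sum_rpow_mul_rpow_le _ _ _ (by positivity) hs
      (div_add_div_rExp hq0 hq1 hp)).trans ?_
    calc _ ≤ gridTail q U t m j ^ (q / p) *
          (∑ k ∈ Finset.Icc j l, m k * kerSup p q U v (t (k + 1))) ^ (q / rExp p q) := by
          gcongr
          exact sum_le_gridTail _ fun k hk => (Finset.mem_Icc.1 hk).1
      _ = (gridTail q U t m j ^ (rExp p q / p) *
          ∑ k ∈ Finset.Icc j l, m k * kerSup p q U v (t (k + 1))) ^ (q / rExp p q) := by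
          rw [ENNReal.mul_rpow_of_nonneg _ _ hs, ← ENNReal.rpow_mul,
            show rExp p q / p * (q / rExp p q) = q / p by field_simp]
      _ ≤ _ := ENNReal.rpow_le_rpow le_add_self hs
  have hterm (k : ℕ) : m k * (∫⁻ x in Ioc (t j) (t (l + 1)) ∩ Iio (t (k + 1)),
      (f x : ℝ≥0∞) * U x (t (k + 1))) ^ q ≤ blockConst p q Θ * X ^ (q / p) *
      ((if l < k then m k else 0) * kerInt p U v (t (l + 1)) ^ (q / conjExp p) +
      (if l ≤ k then m k * (U (t (l + 1)) (t (k + 1)) : ℝ≥0∞) ^ q else 0) *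
        sigmaInt p v (t (l + 1)) ^ (q / conjExp p) +
      (if j ≤ k then m k else 0) * kerInt p U v (t (j + 1)) ^ (q / conjExp p) +
      (if j ≤ k then m k * (U (t (j + 1)) (t (k + 1)) : ℝ≥0∞) ^ q else 0) *
        sigmaInt p v (t (j + 1)) ^ (q / conjExp p) +
      (if k ∈ Finset.Icc j l then m k * ((U (t (j + 1)) (t (k + 1)) : ℝ≥0∞) ^ (q * (q / p)) *
        kerSup p q U v (t (k + 1)) ^ (q / rExp p q)) else 0)) := by
    refine (mul_le_mul' le_rfl (rpow_block_le hU hq0 hq1 hp hv hG hf j l k)).trans (le_of_eq ?_)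
    simp only [mul_add, ← mul_assoc, mul_ite, ite_mul, mul_zero, zero_mul, mul_one]
    congr 1
    · congr 1
      · congr 1
        · congr 1
          · split_ifs <;> ring
          · split_ifs <;> ring
        · split_ifs <;> ring
      · split_ifs <;> ring
    · split_ifs <;> ring
  refine (ENNReal.tsum_le_tsum hterm).trans ?_
  rw [ENNReal.tsum_mul_left, ENNReal.tsum_add, ENNReal.tsum_add, ENNReal.tsum_add,
    ENNReal.tsum_add, ENNReal.tsum_mul_right, ENNReal.tsum_mul_right, ENNReal.tsum_mul_right,
    ENNReal.tsum_mul_right, tsum_ite_mem_finset, hG.tsum_ite_lt, hG.tsum_ite_le, hV, mul_assoc 2, hV]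
  calc _ ≤ blockConst p q Θ * X ^ (q / p) * (B ^ (q / rExp p q) + B ^ (q / rExp p q) +
        2 * B ^ (q / rExp p q) + B ^ (q / rExp p q) + B ^ (q / rExp p q)) := by
        gcongr _ * (?_ + ?_ + 2 * ?_ + ?_ + ?_)
        · refine le_trans ?_ b3
          gcongr
          exact gridTail_antitone hU hq0 hG hjl
        · refine le_trans ?_ b3
          exact mul_le_mul' le_rfl (ENNReal.rpow_le_rpow
            (sigmaInt_mono (hG.le (by omega))) (by positivity))
    _ = _ := by ring

end

noncomputable section

variable {Θ : ℝ≥0} {U : ℝ → ℝ → ℝ≥0} {v : ℝ → ℝ≥0} {p q : ℝ} {t : ℕ → ℝ} {m : ℕ → ℝ≥0∞}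

/-- The constant in `tsum_blocks_gridTail_le`. -/
def tailConst (p q : ℝ) (Θ : ℝ≥0) : ℝ≥0∞ :=
  3 * ((2 * (Θ : ℝ≥0∞) ^ q) ^ (rExp p q / q) *
    (8 * (Θ : ℝ≥0∞) ^ q * (2 * (Θ : ℝ≥0∞) ^ q) ^ (rExp p q / p) +
      (8 * (Θ : ℝ≥0∞) ^ q) ^ (rExp p q / q)))

theorem ENNReal.mul_rpow_ne_top {q s : ℝ} (hq : 0 ≤ q) (hs : 0 ≤ s) (Θ : ℝ≥0) {c : ℝ≥0∞}
    (hc : c ≠ ∞) : (c * (Θ : ℝ≥0∞) ^ q) ^ s ≠ ∞ :=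
  ENNReal.rpow_ne_top_of_nonneg hs
    (ENNReal.mul_ne_top hc (ENNReal.rpow_ne_top_of_nonneg hq (by simp)))

theorem tailConst_ne_top (hq0 : 0 < q) (hq1 : q < 1) (hp : 1 < p) : tailConst p q Θ ≠ ∞ := by
  have hr := rExp_pos hq0 hq1 hp
  have hp0 : 0 < p := by linarith
  have h8 : (8 : ℝ≥0∞) * (Θ : ℝ≥0∞) ^ q ≠ ∞ :=
    ENNReal.mul_ne_top (by simp) (ENNReal.rpow_ne_top_of_nonneg hq0.le (by simp))
  refine ENNReal.mul_ne_top (by simp) (ENNReal.mul_ne_top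
    (ENNReal.mul_rpow_ne_top hq0.le (by positivity) _ (by simp)) (ENNReal.add_ne_top.2
    ⟨ENNReal.mul_ne_top h8 (ENNReal.mul_rpow_ne_top hq0.le (by positivity) _ (by simp)),
      ENNReal.mul_rpow_ne_top hq0.le (by positivity) _ (by simp)⟩))

/-- The blocks of indices on which `gridTail` is essentially constant. -/
structure IsBlockSequence (q : ℝ) (Θ : ℝ≥0) (U : ℝ → ℝ → ℝ≥0) (t : ℕ → ℝ) (m : ℕ → ℝ≥0∞)
    (j : ℕ → ℕ) : Prop where
  strictMono : StrictMono j
  zero : j 0 = 0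
  drop : ∀ n, gridTail q U t m (j (n + 1)) ≤ dropRatio q Θ * gridTail q U t m (j n)
  le_mul : ∀ n k, j n ≤ k → k < j (n + 1) →
    gridTail q U t m (j n) ≤ 2 * (Θ : ℝ≥0∞) ^ q * gridTail q U t m k

theorem exists_isBlockSequence (hU : IsMonotoneKernel Θ U) (hq0 : 0 < q) (hG : IsDyadicGrid t m) :
    ∃ j, IsBlockSequence q Θ U t m j := by
  obtain ⟨j, h1, h2, h3, h4⟩ := exists_block_sequence (hU.dropRatio_le_one hq0)
    (exists_gridTail_le_mul hU hq0 hG (dropRatio_ne_zero hq0))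
  exact ⟨j, h1, h2, h3, fun n k hk hk' => le_of_dropRatio_mul_le hU hq0 (h4 n k hk hk')⟩

namespace IsBlockSequence

variable {j : ℕ → ℕ}

theorem lt_succ (hj : IsBlockSequence q Θ U t m j) (n : ℕ) : j n < j (n + 1) :=
  hj.strictMono n.lt_succ_self

theorem Icc_eq (hj : IsBlockSequence q Θ U t m j) (n : ℕ) :
    Finset.Icc (j n) (j (n + 1) - 1) = Finset.Ico (j n) (j (n + 1)) := by
  have := hj.lt_succ n
  ext k
  simp only [Finset.mem_Icc, Finset.mem_Ico]
  omega

theorem last_injective (hj : IsBlockSequence q Θ U t m j) :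
    Function.Injective fun n => j (n + 1) - 1 := by
  intro a b hab
  have h1 := hj.lt_succ a
  have h2 := hj.lt_succ b
  have h3 : j (a + 1) = j (b + 1) := by simp only at hab; omega
  have := hj.strictMono.injective h3
  omega

theorem tsum_Icc_last_le (hj : IsBlockSequence q Θ U t m j) (g : ℕ → ℝ≥0∞) :
    ∑' n, ∑ k ∈ Finset.Icc (j (n + 1) - 1) (j (n + 2)), g k ≤ 3 * ∑' k, g k := by
  refine le_trans (ENNReal.tsum_le_tsum fun n => ?_) (tsum_sum_Icc_le hj.strictMono g)
  refine Finset.sum_le_sum_of_subset (Finset.Icc_subset_Icc_left ?_)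
  have := hj.lt_succ n
  omega

theorem drop_last (hj : IsBlockSequence q Θ U t m j) (hU : IsMonotoneKernel Θ U) (hq0 : 0 < q)
    (hG : IsDyadicGrid t m) (n : ℕ) :
    gridTail q U t m (j (n + 2)) ≤ dropRatio q Θ * gridTail q U t m (j (n + 1) - 1) :=
  (hj.drop (n + 1)).trans (mul_le_mul' le_rfl (gridTail_antitone hU hq0 hG (by omega)))

end IsBlockSequence

theorem tsum_blocks_gridTail_le {j : ℕ → ℕ} (hj : IsBlockSequence q Θ U t m j)
    (hU : IsMonotoneKernel Θ U) (hq0 : 0 < q) (hq1 : q < 1) (hp : 1 < p) (hG : IsDyadicGrid t m) :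
    ∑' n, gridTail q U t m (j n) ^ (rExp p q / q) *
        sigmaInt p v (t (j (n + 1) - 1 + 1)) ^ (rExp p q / conjExp p) ≤
      tailConst p q Θ * ∑' k, (gridOne p q U v t m k + gridTwo p q U v t m k) := by
  have hr := rExp_pos hq0 hq1 hp
  have h (n : ℕ) : gridTail q U t m (j n) ^ (rExp p q / q) *
      sigmaInt p v (t (j (n + 1) - 1 + 1)) ^ (rExp p q / conjExp p) ≤
      (2 * (Θ : ℝ≥0∞) ^ q) ^ (rExp p q / q) *
        (8 * (Θ : ℝ≥0∞) ^ q * (2 * (Θ : ℝ≥0∞) ^ q) ^ (rExp p q / p) +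
          (8 * (Θ : ℝ≥0∞) ^ q) ^ (rExp p q / q)) *
        ∑ k ∈ Finset.Icc (j (n + 1) - 1) (j (n + 2)),
          (gridOne p q U v t m k + gridTwo p q U v t m k) := by
    have hn := hj.lt_succ n
    have hn' : j (n + 1) < j (n + 2) := hj.lt_succ (n + 1)
    rw [mul_assoc]
    refine le_trans ?_ (mul_le_mul' le_rfl (gridTail_rpow_mul_sigmaInt_le hU hq0 hq1 hp hG
      (show j (n + 1) - 1 < j (n + 2) by omega) (hj.drop_last hU hq0 hG n)))
    rw [← mul_assoc, ← ENNReal.mul_rpow_of_nonneg _ _ (by positivity)]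
    gcongr
    exact hj.le_mul n _ (by omega) (by omega)
  refine (ENNReal.tsum_le_tsum h).trans ?_
  rw [ENNReal.tsum_mul_left]
  refine (mul_le_mul' le_rfl (hj.tsum_Icc_last_le _)).trans (le_of_eq ?_)
  rw [tailConst]
  ring

theorem tsum_blockTerm_le {j : ℕ → ℕ} (hj : IsBlockSequence q Θ U t m j)
    (hU : IsMonotoneKernel Θ U) (hq0 : 0 < q) (hq1 : q < 1) (hp : 1 < p) (hG : IsDyadicGrid t m) :
    ∑' n, blockTerm p q U v t m (j n) (j (n + 1) - 1) ≤
      (2 + tailConst p q Θ + (2 * (Θ : ℝ≥0∞) ^ q) ^ (rExp p q / p)) *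
        ∑' k, (gridOne p q U v t m k + gridTwo p q U v t m k) := by
  have hr := rExp_pos hq0 hq1 hp
  have hp0 : 0 < p := by linarith
  set A := ∑' k, (gridOne p q U v t m k + gridTwo p q U v t m k) with hA
  have hA1 : ∑' k, gridOne p q U v t m k ≤ A := ENNReal.tsum_le_tsum fun k => le_self_add
  have hA2 : ∑' k, gridTwo p q U v t m k ≤ A := ENNReal.tsum_le_tsum fun k => le_add_self
  have h1 : ∑' n, gridOne p q U v t m (j n) ≤ A :=
    (ENNReal.tsum_comp_le_tsum_of_injective hj.strictMono.injective _).trans hA1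
  have h2 : ∑' n, gridOne p q U v t m (j (n + 1) - 1) ≤ A :=
    (ENNReal.tsum_comp_le_tsum_of_injective hj.last_injective _).trans hA1
  have h3 := tsum_blocks_gridTail_le (v := v) hj hU hq0 hq1 hp hG
  have h4 : ∑' n, gridTail q U t m (j n) ^ (rExp p q / p) *
      ∑ k ∈ Finset.Icc (j n) (j (n + 1) - 1), m k * kerSup p q U v (t (k + 1)) ≤
      (2 * (Θ : ℝ≥0∞) ^ q) ^ (rExp p q / p) * A := by
    refine le_trans ?_ (mul_le_mul' le_rfl ((tsum_sum_Ico_le hj.strictMono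
      (gridTwo p q U v t m)).trans hA2))
    rw [← ENNReal.tsum_mul_left]
    refine ENNReal.tsum_le_tsum fun n => ?_
    rw [hj.Icc_eq, Finset.mul_sum, Finset.mul_sum]
    refine Finset.sum_le_sum fun k hk => ?_
    rw [Finset.mem_Ico] at hk
    have h5 := ENNReal.rpow_le_rpow (hj.le_mul n k hk.1 hk.2)
      (show 0 ≤ rExp p q / p by positivity)
    rw [ENNReal.mul_rpow_of_nonneg _ _ (by positivity)] at h5
    calc _ ≤ ((2 * (Θ : ℝ≥0∞) ^ q) ^ (rExp p q / p) * gridTail q U t m k ^ (rExp p q / p)) *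
          (m k * kerSup p q U v (t (k + 1))) := by gcongr
      _ = _ := by rw [gridTwo]; ring
  simp only [blockTerm]
  rw [ENNReal.tsum_add, ENNReal.tsum_add, ENNReal.tsum_add]
  refine (add_le_add (add_le_add (add_le_add h1 h2) h3) h4).trans (le_of_eq ?_)
  ring

/-- The constant in `tsum_hardyOp_rpow_le`. -/
def sufficiencyConst (p q : ℝ) (Θ : ℝ≥0) : ℝ≥0∞ :=
  6 * blockConst p q Θ *
    (2 + tailConst p q Θ + (2 * (Θ : ℝ≥0∞) ^ q) ^ (rExp p q / p)) ^ (q / rExp p q)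

theorem sufficiencyConst_ne_top (hq0 : 0 < q) (hq1 : q < 1) (hp : 1 < p) :
    sufficiencyConst p q Θ ≠ ∞ := by
  have hr := rExp_pos hq0 hq1 hp
  have hp0 : 0 < p := by linarith
  refine ENNReal.mul_ne_top (ENNReal.mul_ne_top (by simp) (blockConst_ne_top hq0 hp))
    (ENNReal.rpow_ne_top_of_nonneg (by positivity) (ENNReal.add_ne_top.2
    ⟨ENNReal.add_ne_top.2 ⟨by simp, tailConst_ne_top hq0 hq1 hp⟩,
      ENNReal.mul_rpow_ne_top hq0.le (by positivity) _ (by simp)⟩))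

theorem tsum_hardyOp_rpow_le (hU : IsMonotoneKernel Θ U) (hq0 : 0 < q) (hq1 : q < 1) (hp : 1 < p)
    (hv : IsBddBelowWeight v) (hG : IsDyadicGrid t m) {f : ℝ → ℝ≥0} (hf : NonnegMeasurable f) :
    ∑' k, m k * hardyOp U f (t (k + 1)) ^ q ≤ sufficiencyConst p q Θ *
      ((∑' k, (gridOne p q U v t m k + gridTwo p q U v t m k)) ^ (q / rExp p q) *
        (∫⁻ x in Ioi 0, (f x : ℝ≥0∞) ^ p * v x) ^ (q / p)) := by
  classical
  have hr := rExp_pos hq0 hq1 hp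
  have hp0 : 0 < p := by linarith
  obtain ⟨j, hj⟩ := exists_isBlockSequence hU hq0 hG
  set E : ℕ → Set ℝ := fun n => Ioc (t (j n)) (t (j (n + 1) - 1 + 1)) with hE
  have hE' (n : ℕ) : E n = Ioc (t (j n)) (t (j (n + 1))) := by
    have := hj.lt_succ n
    simp only [hE]
    rw [Nat.sub_add_cancel (by omega)]
  have hcover (k : ℕ) : hardyOp U f (t (k + 1)) ^ q ≤
      ∑' n, (∫⁻ x in E n ∩ Iio (t (k + 1)), (f x : ℝ≥0∞) * U x (t (k + 1))) ^ q := by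
    refine le_trans (ENNReal.rpow_le_rpow ?_ hq0.le) (ENNReal.rpow_tsum_le _ hq0 hq1.le)
    refine le_trans (lintegral_mono_set ?_) (lintegral_iUnion_le _ _)
    intro x hx
    have hex : ∃ n, x ≤ t (j n) :=
      ⟨k + 1, hx.2.le.trans (hG.le hj.strictMono.le_apply)⟩
    obtain ⟨n, hn, hmin⟩ : ∃ n, x ≤ t (j n) ∧ ∀ i < n, ¬ x ≤ t (j i) :=
      ⟨Nat.find hex, Nat.find_spec hex, fun i hi => Nat.find_min hex hi⟩
    have hn0 : n ≠ 0 := by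
      rintro rfl
      rw [hj.zero, hG.zero] at hn
      exact absurd hx.1 (not_lt.2 hn)
    obtain ⟨n, rfl⟩ := Nat.exists_eq_succ_of_ne_zero hn0
    refine mem_iUnion.2 ⟨n, ?_, hx.2⟩
    rw [hE']
    exact ⟨not_le.1 (hmin n (Nat.lt_succ_self n)), hn⟩
  have hdisj : ∑' n, ∫⁻ x in E n, (f x : ℝ≥0∞) ^ p * v x ≤
      ∫⁻ x in Ioi 0, (f x : ℝ≥0∞) ^ p * v x := by
    rw [← lintegral_iUnion (fun n => measurableSet_Ioc)]
    · refine lintegral_mono_set (iUnion_subset fun n x hx => ?_)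
      exact (hG.nonneg _).trans_lt hx.1
    · have hmono : Monotone fun n => t (j n) := fun a b h => hG.le (hj.strictMono.monotone h)
      have := hmono.pairwise_disjoint_on_Ioc_succ
      intro a b hab
      have h : Disjoint (E a) (E b) := by
        rw [hE', hE']
        exact this hab
      exact h
  calc ∑' k, m k * hardyOp U f (t (k + 1)) ^ q
      ≤ ∑' k, ∑' n, m k *
          (∫⁻ x in E n ∩ Iio (t (k + 1)), (f x : ℝ≥0∞) * U x (t (k + 1))) ^ q :=
        ENNReal.tsum_le_tsum fun k => by
          rw [ENNReal.tsum_mul_left]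
          exact mul_le_mul' le_rfl (hcover k)
    _ = ∑' n, ∑' k, m k *
          (∫⁻ x in E n ∩ Iio (t (k + 1)), (f x : ℝ≥0∞) * U x (t (k + 1))) ^ q :=
        ENNReal.tsum_comm
    _ ≤ ∑' n, 6 * blockConst p q Θ * ((∫⁻ x in E n, (f x : ℝ≥0∞) ^ p * v x) ^ (q / p) *
          blockTerm p q U v t m (j n) (j (n + 1) - 1) ^ (q / rExp p q)) :=
        ENNReal.tsum_le_tsum fun n => tsum_block_le hU hq0 hq1 hp hv hG hf (by
          have := hj.lt_succ n
          omega)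
    _ ≤ 6 * blockConst p q Θ * ((∫⁻ x in Ioi 0, (f x : ℝ≥0∞) ^ p * v x) ^ (q / p) *
          ((2 + tailConst p q Θ + (2 * (Θ : ℝ≥0∞) ^ q) ^ (rExp p q / p)) *
        ∑' k, (gridOne p q U v t m k + gridTwo p q U v t m k)) ^ (q / rExp p q)) := by
        rw [ENNReal.tsum_mul_left]
        refine mul_le_mul' le_rfl ((ENNReal.tsum_rpow_mul_rpow_le _ _ (by positivity)
          (by positivity) (div_add_div_rExp hq0 hq1 hp)).trans ?_)
        gcongr
        exact tsum_blockTerm_le hj hU hq0 hq1 hp hG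
    _ = _ := by
        rw [ENNReal.mul_rpow_of_nonneg _ _ (by positivity), sufficiencyConst]
        ring

end

noncomputable section

variable {Θ : ℝ≥0} {U : ℝ → ℝ → ℝ≥0} {v : ℝ → ℝ≥0} {p q : ℝ} {t : ℕ → ℝ} {m : ℕ → ℝ≥0∞}

theorem ENNReal.le_rpow_of_le_mul_rpow (hq0 : 0 < q) (hq1 : q < 1) (hp : 1 < p) {S D : ℝ≥0∞}
    (hS : S ≠ ∞) (h : S ≤ D * S ^ (q / p)) : S ≤ D ^ (rExp p q / q) := by
  have hr := rExp_pos hq0 hq1 hp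
  have hp0 : 0 < p := by linarith
  rcases eq_or_ne S 0 with rfl | h0
  · exact zero_le
  have hqr : rExp p q / q = (q / rExp p q)⁻¹ := by rw [inv_div]
  rw [hqr, ENNReal.le_rpow_inv_iff (by positivity)]
  have h1 : S ^ (q / rExp p q) * S ^ (q / p) = S := by
    rw [← ENNReal.rpow_add _ _ h0 hS, add_comm, div_add_div_rExp hq0 hq1 hp, ENNReal.rpow_one]
  have h2 : S ^ (q / p) ≠ 0 := by simp [ENNReal.rpow_eq_zero_iff, h0, hS]
  have h3 : S ^ (q / p) ≠ ∞ := ENNReal.rpow_ne_top_of_nonneg (by positivity) hS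
  rw [← ENNReal.mul_le_mul_iff_left h2 h3, h1]
  exact h

/-- The discretized Hardy-type inequality with constant `D`. -/
def GridInequality (p q : ℝ) (U : ℝ → ℝ → ℝ≥0) (v : ℝ → ℝ≥0) (t : ℕ → ℝ) (m : ℕ → ℝ≥0∞)
    (D : ℝ≥0∞) : Prop :=
  ∀ f : ℝ → ℝ≥0, NonnegMeasurable f → ∑' k, m k * hardyOp U f (t (k + 1)) ^ q ≤
    D * (∫⁻ x in Ioi 0, (f x : ℝ≥0∞) ^ p * v x) ^ (q / p)

theorem hardyOp_mono {f g : ℝ → ℝ≥0} (h : ∀ x, f x ≤ g x) (T : ℝ) :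
    hardyOp U f T ≤ hardyOp U g T :=
  lintegral_mono fun x => mul_le_mul' (ENNReal.coe_le_coe.2 (h x)) le_rfl

theorem tsum_le_of_gridInequality (hq0 : 0 < q) (hq1 : q < 1) (hp : 1 < p)
    (hv : NonnegMeasurable v) {D κ : ℝ≥0∞} (hD : GridInequality p q U v t m D)
    {g : ℕ → ℝ → ℝ≥0} {E : ℕ → ℝ≥0∞} {I : ℕ → Finset ℕ} (hg : ∀ n, NonnegMeasurable (g n))
    (hE : ∀ n, E n ≠ ∞) (h1 : ∀ n, ∫⁻ x in Ioi 0, (g n x : ℝ≥0∞) ^ p * v x ≤ E n)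
    (h2 : ∀ n, E n ≤ κ * ∑ k ∈ I n, m k * hardyOp U (g n) (t (k + 1)) ^ q)
    (hI : ∀ h : ℕ → ℝ≥0∞, ∑' n, ∑ k ∈ I n, h k ≤ 3 * ∑' k, h k) :
    ∑' n, E n ≤ (3 * κ * D) ^ (rExp p q / q) := by
  have hp0 : 0 < p := by linarith
  rw [ENNReal.tsum_eq_iSup_nat]
  refine iSup_le fun L => ENNReal.le_rpow_of_le_mul_rpow hq0 hq1 hp
    (ENNReal.sum_ne_top.2 fun n _ => hE n) ?_
  set f : ℝ → ℝ≥0 := fun x => (∑ n ∈ Finset.range L, g n x ^ p) ^ (1 / p) with hf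
  have mf : NonnegMeasurable f :=
    (Finset.aemeasurable_fun_sum _ fun n _ => (hg n).pow_const p).pow_const _
  have hgf (n : ℕ) (hn : n ∈ Finset.range L) (x : ℝ) : g n x ≤ f x := by
    rw [hf, one_div, NNReal.le_rpow_inv_iff hp0]
    exact Finset.single_le_sum (f := fun n => g n x ^ p) (fun _ _ => zero_le) hn
  have hfp : ∫⁻ x in Ioi 0, (f x : ℝ≥0∞) ^ p * v x ≤ ∑ n ∈ Finset.range L, E n := by
    refine le_trans (le_of_eq ?_) (Finset.sum_le_sum fun n _ => h1 n)
    rw [← lintegral_finsetSum']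
    · refine lintegral_congr fun x => ?_
      rw [← Finset.sum_mul]
      congr 1
      rw [hf, ← ENNReal.coe_rpow_of_nonneg _ hp0.le, ← NNReal.rpow_mul,
        one_div_mul_cancel hp0.ne', NNReal.rpow_one]
      push_cast
      exact Finset.sum_congr rfl fun n _ => ENNReal.coe_rpow_of_nonneg _ hp0.le
    · exact fun n _ => ((hg n).coe_nnreal_ennreal.pow_const _).mul hv.coe_nnreal_ennreal
  calc ∑ n ∈ Finset.range L, E n
      ≤ ∑ n ∈ Finset.range L, κ * ∑ k ∈ I n, m k * hardyOp U f (t (k + 1)) ^ q := by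
        refine Finset.sum_le_sum fun n hn => (h2 n).trans ?_
        gcongr with k
        exact hardyOp_mono (hgf n hn) _
    _ ≤ κ * (3 * ∑' k, m k * hardyOp U f (t (k + 1)) ^ q) := by
        rw [← Finset.mul_sum]
        exact mul_le_mul' le_rfl ((ENNReal.sum_le_tsum _).trans (hI _))
    _ ≤ κ * (3 * (D * (∑ n ∈ Finset.range L, E n) ^ (q / p))) := by
        gcongr
        exact (hD f mf).trans (by gcongr)
    _ = _ := by ring

theorem exists_optimal_scaling (hq0 : 0 < q) (hq1 : q < 1) (hp : 1 < p) {P Q : ℝ≥0∞} (hP : P ≠ ∞)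
    (hQ : Q ≠ ∞) (hPQ : P = 0 → Q = 0) : ∃ c : ℝ≥0,
      (c : ℝ≥0∞) ^ p * P = Q ^ (rExp p q / q) / P ^ (rExp p q / p) ∧
      (c : ℝ≥0∞) ^ q * Q = Q ^ (rExp p q / q) / P ^ (rExp p q / p) := by
  have hr := rExp_pos hq0 hq1 hp
  have hp0 : 0 < p := by linarith
  have hpq : 0 < p - q := by linarith
  rcases eq_or_ne P 0 with rfl | h0
  · refine ⟨0, ?_⟩
    have : 0 < rExp p q / q := by positivity
    simp [hPQ rfl, this]
  refine ⟨((Q / P) ^ (1 / (p - q))).toNNReal, ?_⟩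
  have hc : (Q / P) ^ (1 / (p - q)) ≠ ∞ :=
    ENNReal.rpow_ne_top_of_nonneg (by positivity) (ENNReal.div_ne_top hQ h0)
  have e1 : 1 / (p - q) * p = rExp p q / q := by unfold rExp; field_simp
  have e2 : 1 / (p - q) * q = rExp p q / p := by unfold rExp; field_simp
  rw [ENNReal.coe_toNNReal hc, ← ENNReal.rpow_mul, ← ENNReal.rpow_mul, e1, e2,
    ENNReal.div_rpow_of_nonneg _ _ (by positivity), ENNReal.div_rpow_of_nonneg _ _ (by positivity)]
  constructor
  · rw [ENNReal.rpow_rExp_div hq0 hq1 hp P]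
    simp only [div_eq_mul_inv]
    rw [ENNReal.mul_inv (Or.inr hP) (Or.inr h0), mul_assoc, mul_assoc,
      ENNReal.inv_mul_cancel h0 hP, mul_one]
  · rw [ENNReal.rpow_rExp_div hq0 hq1 hp Q]
    simp only [div_eq_mul_inv]
    ring

theorem hardyOp_const_mul (c : ℝ≥0) (f : ℝ → ℝ≥0) (T : ℝ) :
    hardyOp U (fun x => c * f x) T = c * hardyOp U f T := by
  rw [hardyOp, hardyOp, ← lintegral_const_mul' _ _ ENNReal.coe_ne_top]
  exact lintegral_congr fun x => by push_cast; ring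

theorem tsum_div_le_of_gridInequality (hq0 : 0 < q) (hq1 : q < 1) (hp : 1 < p)
    (hv : NonnegMeasurable v) {D κ : ℝ≥0∞} (hD : GridInequality p q U v t m D)
    {f : ℕ → ℝ → ℝ≥0} {P Q : ℕ → ℝ≥0∞} {I : ℕ → Finset ℕ} (hf : ∀ n, NonnegMeasurable (f n))
    (hP : ∀ n, P n ≠ ∞) (hQ : ∀ n, Q n ≠ ∞) (hPQ : ∀ n, P n = 0 → Q n = 0)
    (h1 : ∀ n, ∫⁻ x in Ioi 0, (f n x : ℝ≥0∞) ^ p * v x ≤ P n)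
    (h2 : ∀ n, Q n ≤ κ * ∑ k ∈ I n, m k * hardyOp U (f n) (t (k + 1)) ^ q)
    (hI : ∀ h : ℕ → ℝ≥0∞, ∑' n, ∑ k ∈ I n, h k ≤ 3 * ∑' k, h k) :
    ∑' n, Q n ^ (rExp p q / q) / P n ^ (rExp p q / p) ≤ (3 * κ * D) ^ (rExp p q / q) := by
  have hp0 : 0 < p := by linarith
  choose c hc1 hc2 using fun n => exists_optimal_scaling hq0 hq1 hp (hP n) (hQ n) (hPQ n)
  have hcp (n : ℕ) : (c n : ℝ≥0∞) ^ p ≠ ∞ := ENNReal.rpow_ne_top_of_nonneg hp0.le (by simp)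
  refine tsum_le_of_gridInequality hq0 hq1 hp hv hD (g := fun n x => c n * f n x) (I := I)
    (fun n => (hf n).const_mul _) (fun n => ?_) (fun n => ?_) (fun n => ?_) hI
  · rw [← hc1]
    exact ENNReal.mul_ne_top (hcp n) (hP n)
  · rw [← hc1]
    refine le_trans (le_of_eq ?_) (mul_le_mul' le_rfl (h1 n))
    rw [← lintegral_const_mul' _ _ (hcp n)]
    refine lintegral_congr fun x => ?_
    rw [ENNReal.coe_mul, ENNReal.mul_rpow_of_nonneg _ _ hp0.le, mul_assoc]
  · rw [← hc2]
    refine (mul_le_mul' le_rfl (h2 n)).trans (le_of_eq ?_)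
    rw [mul_left_comm, Finset.mul_sum]
    congr 1
    refine Finset.sum_congr rfl fun k _ => ?_
    rw [hardyOp_const_mul, ENNReal.mul_rpow_of_nonneg _ _ hq0.le]
    ring

theorem IsBddBelowWeight.coe_rpow {v : ℝ → ℝ≥0} (hv : IsBddBelowWeight v) (s : ℝ) (x : ℝ) :
    ((v x ^ s : ℝ≥0) : ℝ≥0∞) = (v x : ℝ≥0∞) ^ s :=
  ENNReal.coe_rpow_of_ne_zero (hv.ne_zero x) s

theorem IsBddBelowWeight.rpow_conjExp_mul (hv : IsBddBelowWeight v) (hp : 1 < p) (x : ℝ) :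
    ((v x : ℝ≥0∞) ^ (1 - conjExp p)) ^ p * v x = (v x : ℝ≥0∞) ^ (1 - conjExp p) := by
  have h0 : (v x : ℝ≥0∞) ≠ 0 := by exact_mod_cast hv.ne_zero x
  have : p - 1 ≠ 0 := by linarith
  conv_lhs => rw [← ENNReal.rpow_mul]; arg 2; rw [← ENNReal.rpow_one (v x : ℝ≥0∞)]
  rw [← ENNReal.rpow_add _ _ h0 ENNReal.coe_ne_top]
  congr 1
  unfold conjExp; field_simp; ring

/-- The extremal function for the operator evaluated at the point `T`. -/
def extremalFun (p : ℝ) (U : ℝ → ℝ → ℝ≥0) (v : ℝ → ℝ≥0) (T : ℝ) : ℝ → ℝ≥0 :=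
  (Ioo 0 T).indicator fun x => U x T ^ (conjExp p - 1) * v x ^ (1 - conjExp p)

theorem extremalFun_measurable (hU : IsMonotoneKernel Θ U) (hv : IsBddBelowWeight v) {T : ℝ}
    (hT : 0 ≤ T) : NonnegMeasurable (extremalFun p U v T) :=
  (((hU.aemeasurable_left hT measurableSet_Ioi Ioi_subset_Ici_self).pow_const _).mul
    (hv.measurable.pow_const _)).indicator measurableSet_Ioo

theorem lintegral_indicator_Ioi {T : ℝ} {F : ℝ → ℝ≥0∞} {G : ℝ → ℝ≥0∞}
    (h1 : ∀ x ∈ Ioo 0 T, F x = G x) (h2 : ∀ x ∉ Ioo 0 T, F x = 0) :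
    ∫⁻ x in Ioi 0, F x = ∫⁻ x in Ioo 0 T, G x := by
  have : F = (Ioo 0 T).indicator G := by
    ext x
    by_cases hx : x ∈ Ioo 0 T
    · rw [indicator_of_mem hx, h1 x hx]
    · rw [indicator_of_notMem hx, h2 x hx]
  rw [this, lintegral_indicator measurableSet_Ioo, Measure.restrict_restrict measurableSet_Ioo,
    inter_eq_left.2 Ioo_subset_Ioi_self]

theorem lintegral_extremalFun (hv : IsBddBelowWeight v) (hp : 1 < p) (T : ℝ) :
    ∫⁻ x in Ioi 0, (extremalFun p U v T x : ℝ≥0∞) ^ p * v x = kerInt p U v T := by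
  have hp0 : 0 < p := by linarith
  refine lintegral_indicator_Ioi (fun x hx => ?_) (fun x hx => ?_)
  · rw [extremalFun, indicator_of_mem hx, ENNReal.coe_mul, ENNReal.mul_rpow_of_nonneg _ _ hp0.le,
      mul_assoc, hv.coe_rpow, hv.rpow_conjExp_mul hp,
      ENNReal.coe_rpow_of_nonneg _ (by linarith [one_sub_conjExp_neg hp]), ← ENNReal.rpow_mul]
    congr 2
    have : p - 1 ≠ 0 := by linarith
    unfold conjExp; field_simp; ring
  · rw [extremalFun, indicator_of_notMem hx]
    simp [hp0]

theorem hardyOp_extremalFun (hv : IsBddBelowWeight v) (hp : 1 < p) (T : ℝ) :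
    hardyOp U (extremalFun p U v T) T = kerInt p U v T := by
  refine setLIntegral_congr_fun measurableSet_Ioo fun x hx => ?_
  have h := one_sub_conjExp_neg hp
  rw [extremalFun, indicator_of_mem hx, ENNReal.coe_mul, hv.coe_rpow,
    ENNReal.coe_rpow_of_nonneg _ (by linarith), mul_right_comm]
  congr 1
  conv_lhs => arg 2; rw [← ENNReal.rpow_one (U x T : ℝ≥0∞)]
  rw [← ENNReal.rpow_add_of_nonneg _ _ (by linarith) zero_le_one, sub_add_cancel]

/-- The function `v^{1-p'}` cut off at `z`. -/
def cutoffFun (p : ℝ) (v : ℝ → ℝ≥0) (z : ℝ) : ℝ → ℝ≥0 :=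
  (Ioo 0 z).indicator fun x => v x ^ (1 - conjExp p)

theorem cutoffFun_measurable (hv : IsBddBelowWeight v) (z : ℝ) :
    NonnegMeasurable (cutoffFun p v z) :=
  (hv.measurable.pow_const _).indicator measurableSet_Ioo

theorem lintegral_cutoffFun (hv : IsBddBelowWeight v) (hp : 1 < p) (z : ℝ) :
    ∫⁻ x in Ioi 0, (cutoffFun p v z x : ℝ≥0∞) ^ p * v x = sigmaInt p v z := by
  have hp0 : 0 < p := by linarith
  refine lintegral_indicator_Ioi (fun x hx => ?_) (fun x hx => ?_)
  · rw [cutoffFun, indicator_of_mem hx, hv.coe_rpow, hv.rpow_conjExp_mul hp]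
  · rw [cutoffFun, indicator_of_notMem hx]
    simp [hp0]

theorem mul_sigmaInt_le_hardyOp_cutoffFun (hU : IsMonotoneKernel Θ U) (hv : IsBddBelowWeight v)
    {z T : ℝ} (hz : 0 ≤ z) (hzT : z ≤ T) :
    (U z T : ℝ≥0∞) * sigmaInt p v z ≤ hardyOp U (cutoffFun p v z) T := by
  rw [sigmaInt, ← lintegral_const_mul' _ _ ENNReal.coe_ne_top]
  refine le_trans (setLIntegral_mono_ae' measurableSet_Ioo
    (Filter.Eventually.of_forall fun x hx => ?_)) (lintegral_mono_set (Ioo_subset_Ioo_right hzT))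
  rw [cutoffFun, indicator_of_mem hx, hv.coe_rpow, mul_comm]
  exact mul_le_mul' le_rfl (hU.anti hx.1.le hx.2.le (hz.trans hzT))

end

noncomputable section

variable {Θ : ℝ≥0} {U : ℝ → ℝ → ℝ≥0} {v : ℝ → ℝ≥0} {p q : ℝ} {t : ℕ → ℝ} {m : ℕ → ℝ≥0∞}

theorem ENNReal.mul_rpow_div_rpow (hq0 : 0 < q) (hq1 : q < 1) (hp : 1 < p) {c x : ℝ≥0∞}
    (hx : x ≠ ∞) : (c * x ^ q) ^ (rExp p q / q) / x ^ (rExp p q / p) =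
      c ^ (rExp p q / q) * x ^ (rExp p q / conjExp p) := by
  have hr := rExp_pos hq0 hq1 hp
  have hp' := conjExp_pos hp
  rw [ENNReal.mul_rpow_of_nonneg _ _ (by positivity), ← ENNReal.rpow_mul,
    mul_div_cancel₀ _ hq0.ne', mul_div_assoc]
  congr 1
  rcases eq_or_ne x 0 with rfl | h0
  · have : 0 < rExp p q / conjExp p := by positivity
    simp [this, hr]
  · rw [← ENNReal.rpow_sub _ _ h0 hx]
    congr 1
    linarith [rExp_div_conjExp_add (q := q) hp]

theorem tsum_gridOne_le (hU : IsMonotoneKernel Θ U) (hq0 : 0 < q) (hq1 : q < 1) (hp : 1 < p)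
    (hv : IsBddBelowWeight v) (hG : IsDyadicGrid t m) {D : ℝ≥0∞}
    (hD : GridInequality p q U v t m D) :
    ∑' k, gridOne p q U v t m k ≤ (3 * 1 * D) ^ (rExp p q / q) := by
  have hV (k : ℕ) : kerInt p U v (t (k + 1)) ≠ ∞ := kerInt_ne_top hU hp hv (hG.nonneg _)
  refine le_trans (ENNReal.tsum_le_tsum fun k => ?_)
    (tsum_div_le_of_gridInequality hq0 hq1 hp hv.measurable hD
      (f := fun k => extremalFun p U v (t (k + 1))) (P := fun k => kerInt p U v (t (k + 1)))
      (Q := fun k => m k * kerInt p U v (t (k + 1)) ^ q) (I := fun k => {k})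
      (fun k => extremalFun_measurable hU hv (hG.nonneg _)) hV
      (fun k => ENNReal.mul_ne_top (hG.ne_top k) (ENNReal.rpow_ne_top_of_nonneg hq0.le (hV k)))
      (fun k hk => by simp [hk, hq0]) (fun k => (lintegral_extremalFun hv hp _).le)
      (fun k => ?_) (fun h => ?_))
  · rw [ENNReal.mul_rpow_div_rpow hq0 hq1 hp (hV k), gridOne]
  · rw [one_mul, Finset.sum_singleton, hardyOp_extremalFun hv hp]
  · simp only [Finset.sum_singleton]
    exact le_mul_of_one_le_left zero_le (by norm_num)

theorem tsum_cutoff_le (hU : IsMonotoneKernel Θ U) (hq0 : 0 < q) (hq1 : q < 1) (hp : 1 < p)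
    (hv : IsBddBelowWeight v) {D κ : ℝ≥0∞} (hD : GridInequality p q U v t m D) {z : ℕ → ℝ}
    {c : ℕ → ℝ≥0∞} {I : ℕ → Finset ℕ} (hz : ∀ n, 0 < z n) (hc : ∀ n, c n ≠ ∞)
    (hzI : ∀ n, ∀ k ∈ I n, z n ≤ t (k + 1))
    (h : ∀ n, c n ≤ κ * ∑ k ∈ I n, m k * (U (z n) (t (k + 1)) : ℝ≥0∞) ^ q)
    (hI : ∀ h : ℕ → ℝ≥0∞, ∑' n, ∑ k ∈ I n, h k ≤ 3 * ∑' k, h k) :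
    ∑' n, c n ^ (rExp p q / q) * sigmaInt p v (z n) ^ (rExp p q / conjExp p) ≤
      (3 * κ * D) ^ (rExp p q / q) := by
  have hs (n : ℕ) : sigmaInt p v (z n) ≠ ∞ := sigmaInt_ne_top hp hv _
  refine le_trans (ENNReal.tsum_le_tsum fun n => ?_)
    (tsum_div_le_of_gridInequality hq0 hq1 hp hv.measurable hD
      (f := fun n => cutoffFun p v (z n)) (P := fun n => sigmaInt p v (z n))
      (Q := fun n => c n * sigmaInt p v (z n) ^ q) (I := I) (κ := κ)
      (fun n => cutoffFun_measurable hv _) hs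
      (fun n => ENNReal.mul_ne_top (hc n) (ENNReal.rpow_ne_top_of_nonneg hq0.le (hs n)))
      (fun n hn => absurd hn (sigmaInt_pos hv (hz n)).ne')
      (fun n => (lintegral_cutoffFun hv hp _).le) (fun n => ?_) hI)
  · rw [ENNReal.mul_rpow_div_rpow hq0 hq1 hp (hs n)]
  · refine (mul_le_mul' (h n) le_rfl).trans ?_
    rw [mul_assoc, Finset.sum_mul]
    refine mul_le_mul' le_rfl (Finset.sum_le_sum fun k hk => ?_)
    rw [mul_assoc, ← ENNReal.mul_rpow_of_nonneg _ _ hq0.le]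
    gcongr
    exact mul_sigmaInt_le_hardyOp_cutoffFun hU hv (hz n).le (hzI n k hk)

theorem tsum_gridTail_last_le {j : ℕ → ℕ} (hj : IsBlockSequence q Θ U t m j)
    (hU : IsMonotoneKernel Θ U) (hq0 : 0 < q) (hq1 : q < 1) (hp : 1 < p)
    (hv : IsBddBelowWeight v) (hG : IsDyadicGrid t m) {D : ℝ≥0∞}
    (hD : GridInequality p q U v t m D) :
    ∑' n, gridTail q U t m (j n) ^ (rExp p q / q) *
        sigmaInt p v (t (j (n + 1) - 1 + 1)) ^ (rExp p q / conjExp p) ≤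
      (2 * (Θ : ℝ≥0∞) ^ q) ^ (rExp p q / q) *
        (3 * (4 * (Θ : ℝ≥0∞) ^ q) * D) ^ (rExp p q / q) := by
  have hr := rExp_pos hq0 hq1 hp
  refine le_trans (ENNReal.tsum_le_tsum fun n => ?_) (ENNReal.tsum_mul_left.trans_le
    (mul_le_mul' le_rfl (tsum_cutoff_le hU hq0 hq1 hp hv hD
      (κ := 4 * (Θ : ℝ≥0∞) ^ q) (z := fun n => t (j (n + 1) - 1 + 1))
      (c := fun n => gridTail q U t m (j (n + 1) - 1))
      (I := fun n => Finset.Icc (j (n + 1) - 1) (j (n + 2)))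
      (fun n => hG.pos _) (fun n => gridTail_ne_top hU hq0 hG _)
      (fun n k hk => hG.le (by rw [Finset.mem_Icc] at hk; omega)) (fun n => ?_)
      hj.tsum_Icc_last_le)))
  · have hn := hj.lt_succ n
    rw [← mul_assoc, ← ENNReal.mul_rpow_of_nonneg _ _ (by positivity)]
    gcongr
    exact hj.le_mul n _ (by omega) (by omega)
  · have hn : j (n + 1) < j (n + 2) := hj.lt_succ (n + 1)
    exact gridTail_le_sum_Icc hU hq0 hq1 hG (by omega) (hj.drop_last hU hq0 hG n)

theorem tsum_kerSup_first_le {j : ℕ → ℕ} (hj : IsBlockSequence q Θ U t m j)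
    (hU : IsMonotoneKernel Θ U) (hq0 : 0 < q) (hq1 : q < 1) (hp : 1 < p)
    (hv : IsBddBelowWeight v) (hG : IsDyadicGrid t m) {D : ℝ≥0∞}
    (hD : GridInequality p q U v t m D) :
    ∑' n, gridTail q U t m (j n) ^ (rExp p q / p) *
        (m (j n) * kerSup p q U v (t (j n + 1))) ≤
      2 * (3 * (4 * (Θ : ℝ≥0∞) ^ q) * D) ^ (rExp p q / q) := by
  have hr := rExp_pos hq0 hq1 hp
  have hp0 : 0 < p := by linarith
  have hex (n : ℕ) : ∃ z, 0 < z ∧ z ≤ t (j n + 1) ∧ kerSup p q U v (t (j n + 1)) ≤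
      2 * ((U z (t (j n + 1)) : ℝ≥0∞) ^ q * sigmaInt p v z ^ (rExp p q / conjExp p)) := by
    set S := kerSup p q U v (t (j n + 1)) with hS
    rcases eq_or_ne S 0 with h0 | h0
    · exact ⟨_, hG.pos _, le_rfl, by simp [h0]⟩
    have hlt : S / 2 < S :=
      ENNReal.half_lt_self h0 (kerSup_ne_top hU hq0 hq1 hp hv (hG.nonneg _))
    conv_rhs at hlt => rw [hS, kerSup]
    obtain ⟨z, hz⟩ := lt_iSup_iff.1 hlt
    obtain ⟨hz1, hz2⟩ := lt_iSup_iff.1 hz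
    refine ⟨z, hz1.1, hz1.2, ?_⟩
    rw [mul_comm]
    exact (ENNReal.div_le_iff_le_mul (Or.inl two_ne_zero) (Or.inl (by simp))).1 hz2.le
  choose z hz0 hzt hzS using hex
  set c : ℕ → ℝ≥0∞ := fun n => gridTail q U t m (j n) ^ (q / p) *
    (m (j n) * (U (z n) (t (j n + 1)) : ℝ≥0∞) ^ q) ^ (q / rExp p q) with hc
  have hc' (n : ℕ) : c n ^ (rExp p q / q) = gridTail q U t m (j n) ^ (rExp p q / p) *
      (m (j n) * (U (z n) (t (j n + 1)) : ℝ≥0∞) ^ q) := by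
    simp only [hc]
    rw [ENNReal.mul_rpow_of_nonneg _ _ (by positivity), ← ENNReal.rpow_mul, ← ENNReal.rpow_mul,
      show q / p * (rExp p q / q) = rExp p q / p by field_simp,
      show q / rExp p q * (rExp p q / q) = 1 by field_simp, ENNReal.rpow_one]
  refine le_trans (ENNReal.tsum_le_tsum fun n => ?_) (ENNReal.tsum_mul_left.trans_le
    (mul_le_mul' le_rfl (tsum_cutoff_le hU hq0 hq1 hp hv hD
      (κ := 4 * (Θ : ℝ≥0∞) ^ q) (z := z) (c := c)
      (I := fun n => Finset.Icc (j n) (j (n + 2))) hz0 (fun n => ?_)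
      (fun n k hk => (hzt n).trans (hG.le (by rw [Finset.mem_Icc] at hk; omega))) (fun n => ?_)
      (tsum_sum_Icc_le hj.strictMono))))
  · rw [hc']
    refine (mul_le_mul' le_rfl (mul_le_mul' le_rfl (hzS n))).trans (le_of_eq ?_)
    ring
  · exact ENNReal.mul_ne_top
      (ENNReal.rpow_ne_top_of_nonneg (by positivity) (gridTail_ne_top hU hq0 hG _))
      (ENNReal.rpow_ne_top_of_nonneg (by positivity) (ENNReal.mul_ne_top (hG.ne_top _)
        (ENNReal.rpow_ne_top_of_nonneg hq0.le (by simp))))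
  · have hn := hj.lt_succ n
    have hn' : j (n + 1) < j (n + 2) := hj.lt_succ (n + 1)
    set A := 4 * (Θ : ℝ≥0∞) ^ q * ∑ k ∈ Finset.Icc (j n) (j (n + 2)),
      m k * (U (z n) (t (k + 1)) : ℝ≥0∞) ^ q with hA
    have h1 : gridTail q U t m (j n) ≤ A := by
      refine (gridTail_le_sum_Icc hU hq0 hq1 hG (show j n ≤ j (n + 2) by omega)
        ((gridTail_antitone hU hq0 hG hn'.le).trans (hj.drop n))).trans ?_
      rw [hA]
      gcongr
      exact ENNReal.coe_le_coe.1 (hU.anti (hz0 n).le (hzt n) (hG.nonneg _))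
    have h2 : m (j n) * (U (z n) (t (j n + 1)) : ℝ≥0∞) ^ q ≤ A := by
      rw [hA, ← one_mul (m (j n) * _)]
      refine mul_le_mul' ?_ (Finset.single_le_sum
        (f := fun k => m k * (U (z n) (t (k + 1)) : ℝ≥0∞) ^ q) (fun _ _ => zero_le)
        (Finset.left_mem_Icc.2 (by omega)))
      exact one_le_mul (by norm_num) (hU.one_le_rpow hq0.le)
    calc c n ≤ A ^ (q / p) * A ^ (q / rExp p q) := by
          simp only [hc]
          gcongr
      _ = A := by
          rw [← ENNReal.rpow_add_of_nonneg _ _ (by positivity) (by positivity),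
            div_add_div_rExp hq0 hq1 hp, ENNReal.rpow_one]

theorem add_sum_Ico_tsub_eq {a : ℕ → ℝ≥0∞} (ha : Monotone a) {j l : ℕ} (h : j ≤ l) :
    a j + ∑ i ∈ Finset.Ico j l, (a (i + 1) - a i) = a l := by
  induction l, h using Nat.le_induction with
  | base => simp
  | succ l hl ih =>
    rw [Finset.sum_Ico_succ_top hl, ← add_assoc, ih, add_tsub_cancel_of_le (ha l.le_succ)]

/-- The supremum over a block is controlled by its value at the beginning of the block and by a
discrete Stieltjes sum. -/
theorem kerSup_le_of_le (hU : IsMonotoneKernel Θ U) (hq0 : 0 < q) (hq1 : q < 1) (hp : 1 < p)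
    (hG : IsDyadicGrid t m) {a : ℕ → ℝ≥0∞}
    (ha : ∀ i, a i = sigmaInt p v (t (i + 1)) ^ (rExp p q / conjExp p)) {j k : ℕ} (hjk : j ≤ k) :
    kerSup p q U v (t (k + 1)) ≤ (Θ : ℝ≥0∞) ^ q * kerSup p q U v (t (j + 1)) +
      (Θ : ℝ≥0∞) ^ q * ((U (t (j + 1)) (t (k + 1)) : ℝ≥0∞) ^ q * a j) +
      ((U (t (j + 1)) (t (k + 1)) : ℝ≥0∞) ^ q * a j + ∑ i ∈ Finset.Ico j k,
        (U (t (i + 1)) (t (k + 1)) : ℝ≥0∞) ^ q * (a (i + 1) - a i)) := by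
  classical
  have hr := rExp_pos hq0 hq1 hp
  have hp' := conjExp_pos hp
  have hs : 0 ≤ rExp p q / conjExp p := by positivity
  have hamono : Monotone a := fun i i' h => by
    rw [ha, ha]
    exact ENNReal.rpow_le_rpow (sigmaInt_mono (hG.le (by omega))) hs
  refine iSup₂_le fun z hz => ?_
  rcases le_or_gt z (t (j + 1)) with hzj | hzj
  · refine le_trans ?_ le_self_add
    rw [← mul_add]
    refine (mul_le_mul' (hU.reg_rpow hz.1.le hzj (hG.le (by omega)) hq0 hq1) le_rfl).trans ?_
    rw [mul_assoc, add_mul]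
    gcongr _ * (?_ + _ * ?_)
    · exact le_kerSup hz.1 hzj
    · rw [ha]
      exact ENNReal.rpow_le_rpow (sigmaInt_mono hzj) hs
  · refine le_trans ?_ le_add_self
    have hex : ∃ i, z ≤ t (i + 1) := ⟨k, hz.2⟩
    obtain ⟨n, hn, hmin⟩ : ∃ n, z ≤ t (n + 1) ∧ ∀ i < n, ¬ z ≤ t (i + 1) :=
      ⟨Nat.find hex, Nat.find_spec hex, fun i hi => Nat.find_min hex hi⟩
    have hjn : j < n := by
      by_contra h
      exact absurd (hzj.trans_le (hn.trans (hG.le (by omega : n + 1 ≤ j + 1)))) (lt_irrefl _)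
    have hnk : n ≤ k := by
      by_contra h
      exact hmin k (by omega) hz.2
    obtain ⟨i, rfl⟩ : ∃ i, n = i + 1 := ⟨n - 1, by omega⟩
    have hzi : t (i + 1) < z := not_le.1 (hmin i (by omega))
    calc (U z (t (k + 1)) : ℝ≥0∞) ^ q * sigmaInt p v z ^ (rExp p q / conjExp p)
        ≤ (U (t (i + 1)) (t (k + 1)) : ℝ≥0∞) ^ q * a (i + 1) := by
          refine mul_le_mul' (hU.anti_rpow (hG.nonneg _) hzi.le (hG.nonneg _) hq0.le) ?_
          rw [ha]
          exact ENNReal.rpow_le_rpow (sigmaInt_mono hn) hs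
      _ = (U (t (i + 1)) (t (k + 1)) : ℝ≥0∞) ^ q * a j + ∑ i' ∈ Finset.Ico j (i + 1),
            (U (t (i + 1)) (t (k + 1)) : ℝ≥0∞) ^ q * (a (i' + 1) - a i') := by
          rw [← Finset.mul_sum, ← mul_add, add_sum_Ico_tsub_eq hamono (by omega)]
      _ ≤ (U (t (j + 1)) (t (k + 1)) : ℝ≥0∞) ^ q * a j + ∑ i' ∈ Finset.Ico j (i + 1),
            (U (t (i' + 1)) (t (k + 1)) : ℝ≥0∞) ^ q * (a (i' + 1) - a i') := by
          refine add_le_add (mul_le_mul' ?_ le_rfl)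
            (Finset.sum_le_sum fun i' hi' => mul_le_mul' ?_ le_rfl)
          · exact hU.anti_rpow (hG.nonneg _) (hG.le (by omega)) (hG.nonneg _) hq0.le
          · rw [Finset.mem_Ico] at hi'
            exact hU.anti_rpow (hG.nonneg _) (hG.le (by omega)) (hG.nonneg _) hq0.le
      _ ≤ _ := by
          gcongr

theorem sum_kerSup_block_le (hU : IsMonotoneKernel Θ U) (hq0 : 0 < q) (hq1 : q < 1) (hp : 1 < p)
    (hG : IsDyadicGrid t m) {j l : ℕ} (hjl : j ≤ l) :
    ∑ k ∈ Finset.Icc j l, m k * kerSup p q U v (t (k + 1)) ≤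
      2 * (Θ : ℝ≥0∞) ^ q * (m j * kerSup p q U v (t (j + 1))) +
      ((Θ : ℝ≥0∞) ^ q + 1) *
        (gridTail q U t m j * sigmaInt p v (t (l + 1)) ^ (rExp p q / conjExp p)) := by
  have hr := rExp_pos hq0 hq1 hp
  have hp' := conjExp_pos hp
  have hs : 0 ≤ rExp p q / conjExp p := by positivity
  set a : ℕ → ℝ≥0∞ := fun i => sigmaInt p v (t (i + 1)) ^ (rExp p q / conjExp p) with ha
  have hamono : Monotone a := fun i i' h =>
    ENNReal.rpow_le_rpow (sigmaInt_mono (hG.le (by omega))) hs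
  set u : ℕ → ℕ → ℝ≥0∞ := fun i k => (U (t (i + 1)) (t (k + 1)) : ℝ≥0∞) ^ q with hu
  set S : ℕ → ℝ≥0∞ := fun k => kerSup p q U v (t (k + 1)) with hS
  have h1 : ∑ k ∈ Finset.Icc j l, m k ≤ 2 * m j := by
    rw [← hG.tsum_ite_le]
    refine le_trans (le_of_eq ?_) (ENNReal.sum_le_tsum (Finset.Icc j l))
    exact Finset.sum_congr rfl fun k hk => by rw [if_pos (Finset.mem_Icc.1 hk).1]
  have h2 : ∑ k ∈ Finset.Icc j l, m k * u j k ≤ gridTail q U t m j :=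
    sum_le_gridTail _ fun k hk => (Finset.mem_Icc.1 hk).1
  have h3 : ∑ k ∈ Finset.Icc j l, m k * ∑ i ∈ Finset.Ico j k, u i k * (a (i + 1) - a i) ≤
      gridTail q U t m j * ∑ i ∈ Finset.Ico j l, (a (i + 1) - a i) := by
    simp_rw [Finset.mul_sum]
    rw [Finset.sum_comm' (t' := Finset.Ico j l) (s' := fun i => Finset.Ioc i l)]
    · refine Finset.sum_le_sum fun i hi => ?_
      rw [Finset.mem_Ico] at hi
      simp_rw [← mul_assoc]
      rw [← Finset.sum_mul]
      refine mul_le_mul' ?_ le_rfl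
      exact (sum_le_gridTail _ fun k hk => (Finset.mem_Ioc.1 hk).1.le).trans
        (gridTail_antitone hU hq0 hG hi.1)
    · intro k i
      simp only [Finset.mem_Icc, Finset.mem_Ico, Finset.mem_Ioc]
      omega
  calc ∑ k ∈ Finset.Icc j l, m k * S k
      ≤ ∑ k ∈ Finset.Icc j l, m k * ((Θ : ℝ≥0∞) ^ q * S j + (Θ : ℝ≥0∞) ^ q * (u j k * a j) +
          (u j k * a j + ∑ i ∈ Finset.Ico j k, u i k * (a (i + 1) - a i))) :=
        Finset.sum_le_sum fun k hk => mul_le_mul' le_rfl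
          (kerSup_le_of_le hU hq0 hq1 hp hG (fun i => rfl) (Finset.mem_Icc.1 hk).1)
    _ = (∑ k ∈ Finset.Icc j l, m k) * ((Θ : ℝ≥0∞) ^ q * S j) +
          ((Θ : ℝ≥0∞) ^ q + 1) * ((∑ k ∈ Finset.Icc j l, m k * u j k) * a j) +
          ∑ k ∈ Finset.Icc j l, m k * ∑ i ∈ Finset.Ico j k, u i k * (a (i + 1) - a i) := by
        rw [Finset.sum_mul, Finset.sum_mul, Finset.mul_sum, ← Finset.sum_add_distrib,
          ← Finset.sum_add_distrib]
        exact Finset.sum_congr rfl fun k _ => by ring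
    _ ≤ 2 * m j * ((Θ : ℝ≥0∞) ^ q * S j) +
          ((Θ : ℝ≥0∞) ^ q + 1) * (gridTail q U t m j * a j) +
          ((Θ : ℝ≥0∞) ^ q + 1) *
            (gridTail q U t m j * ∑ i ∈ Finset.Ico j l, (a (i + 1) - a i)) := by
        refine add_le_add (add_le_add (mul_le_mul' h1 le_rfl)
          (mul_le_mul' le_rfl (mul_le_mul' h2 le_rfl))) (h3.trans ?_)
        exact le_mul_of_one_le_left zero_le le_add_self
    _ = _ := by
        rw [add_assoc, ← mul_add, ← mul_add, add_sum_Ico_tsub_eq hamono hjl]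
        ring

/-- The constant in `tsum_grid_le_of_gridInequality`. -/
def necessityConst (p q : ℝ) (Θ : ℝ≥0) : ℝ≥0∞ :=
  3 ^ (rExp p q / q) + (2 * (Θ : ℝ≥0∞) ^ q * 2 +
    ((Θ : ℝ≥0∞) ^ q + 1) * (2 * (Θ : ℝ≥0∞) ^ q) ^ (rExp p q / q)) *
    (12 * (Θ : ℝ≥0∞) ^ q) ^ (rExp p q / q)

theorem necessityConst_ne_top (hq0 : 0 < q) (hq1 : q < 1) (hp : 1 < p) :
    necessityConst p q Θ ≠ ∞ := by
  have hr := rExp_pos hq0 hq1 hp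
  have hΘ : (Θ : ℝ≥0∞) ^ q ≠ ∞ := ENNReal.rpow_ne_top_of_nonneg hq0.le (by simp)
  refine ENNReal.add_ne_top.2 ⟨ENNReal.rpow_ne_top_of_nonneg (by positivity) (by simp),
    ENNReal.mul_ne_top (ENNReal.add_ne_top.2 ⟨ENNReal.mul_ne_top
      (ENNReal.mul_ne_top (by simp) hΘ) (by simp), ENNReal.mul_ne_top
      (ENNReal.add_ne_top.2 ⟨hΘ, by simp⟩)
      (ENNReal.mul_rpow_ne_top hq0.le (by positivity) _ (by simp))⟩)
      (ENNReal.mul_rpow_ne_top hq0.le (by positivity) _ (by simp))⟩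

theorem tsum_grid_le_of_gridInequality (hU : IsMonotoneKernel Θ U) (hq0 : 0 < q) (hq1 : q < 1)
    (hp : 1 < p) (hv : IsBddBelowWeight v) (hG : IsDyadicGrid t m) {D : ℝ≥0∞}
    (hD : GridInequality p q U v t m D) :
    ∑' k, (gridOne p q U v t m k + gridTwo p q U v t m k) ≤
      necessityConst p q Θ * D ^ (rExp p q / q) := by
  have hr := rExp_pos hq0 hq1 hp
  have hp0 : 0 < p := by linarith
  obtain ⟨j, hj⟩ := exists_isBlockSequence hU hq0 hG
  have h1 := tsum_gridOne_le hU hq0 hq1 hp hv hG hD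
  have h2 := tsum_gridTail_last_le hj hU hq0 hq1 hp hv hG hD
  have h3 := tsum_kerSup_first_le hj hU hq0 hq1 hp hv hG hD
  have h4 : ∑' k, gridTwo p q U v t m k ≤ 2 * (Θ : ℝ≥0∞) ^ q *
      ∑' n, gridTail q U t m (j n) ^ (rExp p q / p) *
        (m (j n) * kerSup p q U v (t (j n + 1))) + ((Θ : ℝ≥0∞) ^ q + 1) *
      ∑' n, gridTail q U t m (j n) ^ (rExp p q / q) *
        sigmaInt p v (t (j (n + 1) - 1 + 1)) ^ (rExp p q / conjExp p) := by
    have h5 := tsum_sum_Ico_eq hj.strictMono (gridTwo p q U v t m)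
    rw [hj.zero] at h5
    simp only [zero_add] at h5
    rw [← h5, ← ENNReal.tsum_mul_left, ← ENNReal.tsum_mul_left, ← ENNReal.tsum_add]
    refine ENNReal.tsum_le_tsum fun n => ?_
    have hn := hj.lt_succ n
    calc ∑ k ∈ Finset.Ico (j n) (j (n + 1)), gridTwo p q U v t m k
        ≤ gridTail q U t m (j n) ^ (rExp p q / p) *
          ∑ k ∈ Finset.Icc (j n) (j (n + 1) - 1), m k * kerSup p q U v (t (k + 1)) := by
          rw [hj.Icc_eq, Finset.mul_sum]
          refine Finset.sum_le_sum fun k hk => ?_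
          rw [gridTwo, mul_right_comm, mul_comm]
          refine mul_le_mul' (ENNReal.rpow_le_rpow
            (gridTail_antitone hU hq0 hG (Finset.mem_Ico.1 hk).1) (by positivity)) le_rfl
      _ ≤ _ := mul_le_mul' le_rfl (sum_kerSup_block_le hU hq0 hq1 hp hG (by omega))
      _ = _ := by
          rw [ENNReal.rpow_rExp_div hq0 hq1 hp]
          ring
  rw [ENNReal.tsum_add]
  refine (add_le_add h1 (h4.trans (add_le_add (mul_le_mul' le_rfl h3)
    (mul_le_mul' le_rfl h2)))).trans (le_of_eq ?_)
  rw [show (3 : ℝ≥0∞) * (4 * (Θ : ℝ≥0∞) ^ q) * D = 12 * (Θ : ℝ≥0∞) ^ q * D by ring,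
    ENNReal.mul_rpow_of_nonneg (12 * (Θ : ℝ≥0∞) ^ q) D (by positivity), mul_one,
    ENNReal.mul_rpow_of_nonneg 3 D (by positivity), necessityConst]
  ring

end

noncomputable section

/-- A dyadic grid whose cells split the mass of the weight `w` in halves. -/
structure IsAdaptedGrid (w : ℝ → ℝ≥0) (t : ℕ → ℝ) (m : ℕ → ℝ≥0∞) : Prop
    extends IsDyadicGrid t m where
  cell : ∀ k, ∫⁻ x in Ioc (t k) (t (k + 1)), (w x : ℝ≥0∞) = m k
  tail : ∀ k, ∫⁻ x in Ioi (t (k + 1)), (w x : ℝ≥0∞) = m k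

theorem exists_isAdaptedGrid {w : ℝ → ℝ≥0} (hw : NonnegMeasurable w) {R : ℝ} (hR : 0 < R)
    (hw0 : ∫⁻ x in Ioi 0, (w x : ℝ≥0∞) ≠ 0) (hw1 : ∫⁻ x in Ioi 0, (w x : ℝ≥0∞) ≠ ∞)
    (hwR : ∫⁻ x in Ioi R, (w x : ℝ≥0∞) = 0) : ∃ t m, IsAdaptedGrid w t m := by
  set W0 := (∫⁻ x in Ioi 0, (w x : ℝ≥0∞)).toReal with hW0
  have hW0pos : 0 < W0 := ENNReal.toReal_pos hw0 hw1
  set w' : ℝ → ℝ := (Ioi 0).indicator fun x => (w x : ℝ) with hw'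
  have hint : Integrable w' := by
    rw [hw', integrable_indicator_iff measurableSet_Ioi]
    refine ⟨hw.coe_nnreal_real.aestronglyMeasurable, ?_⟩
    rw [hasFiniteIntegral_iff_enorm]
    simpa [lt_top_iff_ne_top] using hw1
  have hw'0 : ∀ x, 0 ≤ w' x := fun x => indicator_nonneg (fun x _ => (w x).coe_nonneg) x
  set H : ℝ → ℝ := fun x => ∫ y in (0 : ℝ)..x, w' y with hH
  have hHc : Continuous H := intervalIntegral.continuous_primitive
    (fun a b => hint.intervalIntegrable) 0
  have hHm : Monotone H := fun a b hab => by
    have := intervalIntegral.integral_add_adjacent_intervals (μ := volume) (f := w')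
      (a := 0) (b := a) (c := b) hint.intervalIntegrable hint.intervalIntegrable
    simp only [hH]
    rw [← this]
    have := intervalIntegral.integral_nonneg (μ := volume) hab (fun x _ => hw'0 x)
    linarith
  have hHL (x : ℝ) (hx : 0 ≤ x) : ∫⁻ y in Ioc 0 x, (w y : ℝ≥0∞) = ENNReal.ofReal (H x) := by
    simp only [hH]
    rw [intervalIntegral.integral_of_le hx, ofReal_integral_eq_lintegral_ofReal hint.integrableOn
      (Filter.Eventually.of_forall hw'0)]
    refine setLIntegral_congr_fun measurableSet_Ioc fun y hy => ?_
    simp only [hw', indicator_of_mem (show y ∈ Ioi 0 from hy.1), ENNReal.ofReal_coe_nnreal]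
  have hsplit (a b : ℝ) (ha : 0 ≤ a) (hab : a ≤ b) : ∫⁻ y in Ioc a b, (w y : ℝ≥0∞) =
      ENNReal.ofReal (H b - H a) := by
    have h1 : ∫⁻ y in Ioc 0 b, (w y : ℝ≥0∞) =
        (∫⁻ y in Ioc 0 a, (w y : ℝ≥0∞)) + ∫⁻ y in Ioc a b, (w y : ℝ≥0∞) := by
      rw [← lintegral_union measurableSet_Ioc, Ioc_union_Ioc_eq_Ioc ha hab]
      rw [Set.disjoint_left]
      exact fun x h1 h2 => absurd (h1.2.trans_lt h2.1) (lt_irrefl _)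
    rw [hHL _ (ha.trans hab), hHL _ ha] at h1
    have h0 : 0 ≤ H a := by
      have := hHm ha
      simpa [hH] using this
    rw [ENNReal.ofReal_sub _ h0, h1, ENNReal.add_sub_cancel_left ENNReal.ofReal_ne_top]
  have hsplit' (a : ℝ) (ha : 0 ≤ a) : ENNReal.ofReal W0 = ENNReal.ofReal (H a) +
      ∫⁻ y in Ioi a, (w y : ℝ≥0∞) := by
    rw [← hHL a ha, hW0, ENNReal.ofReal_toReal hw1, ← lintegral_union measurableSet_Ioi,
      Ioc_union_Ioi_eq_Ioi ha]
    rw [Set.disjoint_left]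
    exact fun x h1 h2 => absurd (h1.2.trans_lt h2) (lt_irrefl _)
  have hHR : H R = W0 := by
    have h1 := hsplit' R hR.le
    rw [hwR, add_zero] at h1
    have h0 : 0 ≤ H R := by
      have := hHm hR.le
      simpa [hH] using this
    exact ((ENNReal.ofReal_eq_ofReal_iff hW0pos.le h0).1 h1).symm
  have hH0 : H 0 = 0 := by simp [hH]
  have hex (k : ℕ) : ∃ x ∈ Icc 0 R, (k = 0 → x = 0) ∧ H x = W0 * (1 - 2⁻¹ ^ k) := by
    rcases eq_or_ne k 0 with rfl | hk
    · exact ⟨0, ⟨le_rfl, hR.le⟩, fun _ => rfl, by simp [hH0]⟩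
    have h1 : (2⁻¹ : ℝ) ^ k ≤ 1 := pow_le_one₀ (by norm_num) (by norm_num)
    have h2 : (0 : ℝ) ≤ 2⁻¹ ^ k := by positivity
    obtain ⟨x, hx, hxH⟩ := intermediate_value_Icc hR.le hHc.continuousOn
      (show W0 * (1 - 2⁻¹ ^ k) ∈ Icc (H 0) (H R) by
        rw [hH0, hHR]
        constructor
        · exact mul_nonneg hW0pos.le (by linarith)
        · nlinarith)
    exact ⟨x, hx, fun h => absurd h hk, hxH⟩
  choose t htR ht0 htH using hex
  have hpow (k : ℕ) : (2⁻¹ : ℝ) ^ (k + 1) = 2⁻¹ ^ k / 2 := by rw [pow_succ]; ring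
  have hlt : StrictMono t := strictMono_nat_of_lt_succ fun k => by
    by_contra h
    have h1 := hHm (not_lt.1 h)
    rw [htH, htH, hpow] at h1
    have h2 : (0 : ℝ) < 2⁻¹ ^ k := by positivity
    nlinarith
  refine ⟨t, fun k => ENNReal.ofReal (W0 * 2⁻¹ ^ (k + 1)), ⟨ht0 0 rfl, hlt, ⟨R, fun k => (htR k).2⟩,
    fun k => ?_, ENNReal.ofReal_ne_top⟩, fun k => ?_, fun k => ?_⟩
  · have : (2⁻¹ : ℝ≥0∞) = ENNReal.ofReal 2⁻¹ := by
      rw [ENNReal.ofReal_inv_of_pos two_pos, ENNReal.ofReal_ofNat]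
    rw [this, ← ENNReal.ofReal_pow (by norm_num), ← ENNReal.ofReal_mul (by positivity)]
    congr 1
    ring
  · rw [hsplit _ _ (htR k).1 (hlt k.lt_succ_self).le, htH, htH, hpow]
    congr 1
    ring
  · have h := hsplit' (t (k + 1)) (htR _).1
    have h1 : (2⁻¹ : ℝ) ^ (k + 1) ≤ 1 := pow_le_one₀ (by norm_num) (by norm_num)
    have h2 : ENNReal.ofReal W0 = ENNReal.ofReal (H (t (k + 1))) +
        ENNReal.ofReal (W0 * 2⁻¹ ^ (k + 1)) := by
      rw [← ENNReal.ofReal_add, htH]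
      · congr 1
        ring
      · rw [htH]
        exact mul_nonneg hW0pos.le (by linarith)
      · positivity
    rw [h2] at h
    exact ((ENNReal.add_right_inj ENNReal.ofReal_ne_top).1 h).symm

/-- `∫ₜ^∞ w(x) U^q(t, x) dx`. -/
def tailInt (q : ℝ) (U : ℝ → ℝ → ℝ≥0) (w : ℝ → ℝ≥0) (t : ℝ) : ℝ≥0∞ :=
  ∫⁻ x in Ioi t, (w x : ℝ≥0∞) * (U t x : ℝ≥0∞) ^ q

variable {Θ : ℝ≥0} {U : ℝ → ℝ → ℝ≥0} {v w : ℝ → ℝ≥0} {p q : ℝ} {t : ℕ → ℝ} {m : ℕ → ℝ≥0∞}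

theorem gridTail_eq_tsum (l : ℕ) : gridTail q U t m l =
    ∑' i, m (l + i) * (U (t (l + 1)) (t (l + i + 1)) : ℝ≥0∞) ^ q := by
  have hinj : Function.Injective (fun i : ℕ => l + i) := add_right_injective l
  rw [gridTail, ← hinj.tsum_eq]
  · exact tsum_congr fun i => by rw [if_pos (Nat.le_add_right l i)]
  · intro k hk
    have hk' : l ≤ k := by
      by_contra h
      simp [h] at hk
    exact ⟨k - l, Nat.add_sub_of_le hk'⟩

theorem tailInt_antitoneOn (hU : IsMonotoneKernel Θ U) (hq0 : 0 < q) :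
    AntitoneOn (tailInt q U w) (Ici 0) := by
  intro x hx x' hx' h
  refine le_trans (setLIntegral_mono_ae' measurableSet_Ioi
    (Filter.Eventually.of_forall fun y hy => ?_)) (lintegral_mono_set (Ioi_subset_Ioi h))
  exact mul_le_mul' le_rfl (hU.anti_rpow hx h ((mem_Ici.1 hx').trans (le_of_lt hy)) hq0.le)

theorem hardyOp_monotone (hU : IsMonotoneKernel Θ U) (f : ℝ → ℝ≥0) : Monotone (hardyOp U f) := by
  intro T T' h
  refine le_trans (setLIntegral_mono_ae' measurableSet_Ioo
    (Filter.Eventually.of_forall fun x hx => ?_)) (lintegral_mono_set (Ioo_subset_Ioo_right h))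
  exact mul_le_mul' le_rfl (hU.mono hx.1.le (hx.1.trans hx.2).le h)

namespace IsAdaptedGrid

theorem setLIntegral_Ioi (hA : IsAdaptedGrid w t m) (hw : NonnegMeasurable w) (k : ℕ)
    (F : ℝ → ℝ≥0∞) : ∫⁻ x in Ioi (t k), F x * w x =
      ∑' i, ∫⁻ x in Ioc (t (k + i)) (t (k + i + 1)), F x * w x := by
  have hmono : Monotone fun i => t (k + i) := fun a b h => hA.le (by omega)
  have hunion := lintegral_iUnion (μ := volume) (s := fun i => Ioc (t (k + i)) (t (k + i + 1)))
    (fun i => measurableSet_Ioc) hmono.pairwise_disjoint_on_Ioc_succ (fun x => F x * w x)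
  rw [← hunion]
  refine le_antisymm ?_ (lintegral_mono_set (iUnion_subset fun i x hx =>
    (hA.le (Nat.le_add_right k i)).trans_lt hx.1))
  set Z : Set ℝ := ⋂ i, Ioi (t (i + 1)) with hZ
  have hZ0 : Z ⊆ Ioi 0 := fun x hx => (hA.pos 0).trans (mem_iInter.1 hx 0)
  have hZw : ∫⁻ x in Z, (w x : ℝ≥0∞) = 0 := by
    have hlim : Filter.Tendsto (fun k => m 0 * 2⁻¹ ^ k) Filter.atTop (nhds 0) := by
      have h1 := ENNReal.Tendsto.const_mul (a := m 0)
        (ENNReal.tendsto_pow_atTop_nhds_zero_of_lt_one (r := 2⁻¹) (by simp))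
        (Or.inr hA.mass_ne_top)
      rwa [mul_zero] at h1
    refine le_antisymm (ge_of_tendsto' hlim fun i => ?_) zero_le
    rw [← hA.mass, ← hA.tail]
    exact lintegral_mono_set (iInter_subset _ i)
  have hZF : ∫⁻ x in Z, F x * w x = 0 := by
    rw [lintegral_eq_zero_iff' (hw.coe_restrict hZ0)] at hZw
    rw [lintegral_congr_ae (g := fun _ => 0)]
    · simp
    · filter_upwards [hZw] with x hx
      simp only [Pi.zero_apply] at hx
      rw [hx, mul_zero]
  have hcov : Ioi (t k) ⊆ (⋃ i, Ioc (t (k + i)) (t (k + i + 1))) ∪ Z := by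
    intro x hx
    by_cases hxZ : x ∈ Z
    · exact Or.inr hxZ
    left
    have hex : ∃ i, x ≤ t (k + i) := by
      simp only [hZ, mem_iInter, mem_Ioi, not_forall, not_lt] at hxZ
      obtain ⟨i, hi⟩ := hxZ
      exact ⟨i + 1, hi.trans (hA.le (by omega))⟩
    classical
    obtain ⟨n, hn, hmin⟩ : ∃ n, x ≤ t (k + n) ∧ ∀ i < n, ¬ x ≤ t (k + i) :=
      ⟨Nat.find hex, Nat.find_spec hex, fun i hi => Nat.find_min hex hi⟩
    rcases Nat.eq_zero_or_pos n with rfl | h0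
    · exact absurd hx (not_lt.2 hn)
    obtain ⟨i, rfl⟩ : ∃ i, n = i + 1 := ⟨n - 1, by omega⟩
    exact mem_iUnion.2 ⟨i, not_le.1 (hmin i (by omega)), hn⟩
  refine (lintegral_mono_set hcov).trans ((lintegral_union_le _ _ _).trans ?_)
  rw [hZF, add_zero]

theorem cell_le (hA : IsAdaptedGrid w t m) (hw : NonnegMeasurable w) {k : ℕ} {F : ℝ → ℝ≥0∞}
    {c : ℝ≥0∞} (h : ∀ x ∈ Ioc (t k) (t (k + 1)), F x ≤ c) :
    ∫⁻ x in Ioc (t k) (t (k + 1)), F x * w x ≤ c * m k := by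
  rw [← hA.cell, ← lintegral_const_mul'' _ (hw.coe_restrict
    fun x hx => (hA.nonneg k).trans_lt hx.1)]
  exact setLIntegral_mono_ae' measurableSet_Ioc (Filter.Eventually.of_forall fun x hx =>
    mul_le_mul' (h x hx) le_rfl)

theorem le_cell (hA : IsAdaptedGrid w t m) (hw : NonnegMeasurable w) {k : ℕ} {F : ℝ → ℝ≥0∞}
    {c : ℝ≥0∞} (h : ∀ x ∈ Ioc (t k) (t (k + 1)), c ≤ F x) :
    c * m k ≤ ∫⁻ x in Ioc (t k) (t (k + 1)), F x * w x := by
  rw [← hA.cell, ← lintegral_const_mul'' _ (hw.coe_restrict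
    fun x hx => (hA.nonneg k).trans_lt hx.1)]
  exact setLIntegral_mono_ae' measurableSet_Ioc (Filter.Eventually.of_forall fun x hx =>
    mul_le_mul' (h x hx) le_rfl)

theorem lintegral_le_tsum (hA : IsAdaptedGrid w t m) (hw : NonnegMeasurable w) {F : ℝ → ℝ≥0∞}
    {c : ℕ → ℝ≥0∞} (h : ∀ k, ∀ x ∈ Ioc (t k) (t (k + 1)), F x ≤ c k) :
    ∫⁻ x in Ioi 0, F x * w x ≤ ∑' k, c k * m k := by
  have := hA.setLIntegral_Ioi hw 0 F
  rw [hA.zero] at this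
  rw [this]
  simp only [zero_add]
  exact ENNReal.tsum_le_tsum fun k => hA.cell_le hw (h k)

theorem tsum_le_lintegral (hA : IsAdaptedGrid w t m) (hw : NonnegMeasurable w) {F : ℝ → ℝ≥0∞}
    {c : ℕ → ℝ≥0∞} (h : ∀ k, ∀ x ∈ Ioc (t (k + 1)) (t (k + 2)), c k ≤ F x) :
    ∑' k, c k * m (k + 1) ≤ ∫⁻ x in Ioi 0, F x * w x := by
  refine le_trans ?_ (lintegral_mono_set (Ioi_subset_Ioi (hA.nonneg 1)))
  rw [hA.setLIntegral_Ioi hw 1 F]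
  refine ENNReal.tsum_le_tsum fun k => ?_
  rw [add_comm 1 k]
  exact hA.le_cell hw (h k)

theorem setLIntegral_Ioi_le (hA : IsAdaptedGrid w t m) {k : ℕ} {x : ℝ} (hx : t k ≤ x) :
    ∫⁻ y in Ioi x, (w y : ℝ≥0∞) ≤ 2 * m k := by
  refine (lintegral_mono_set (Ioi_subset_Ioi hx)).trans ?_
  rw [← Ioc_union_Ioi_eq_Ioi (hA.le k.le_succ)]
  refine (lintegral_union_le _ _ _).trans ?_
  rw [hA.cell, hA.tail, two_mul]

theorem hardy_le (hA : IsAdaptedGrid w t m) (hw : NonnegMeasurable w) (hU : IsMonotoneKernel Θ U)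
    (hq0 : 0 < q) (f : ℝ → ℝ≥0) : ∫⁻ x in Ioi 0, hardyOp U f x ^ q * w x ≤
      ∑' k, m k * hardyOp U f (t (k + 1)) ^ q := by
  refine (hA.lintegral_le_tsum hw (c := fun k => hardyOp U f (t (k + 1)) ^ q)
    fun k x hx => ENNReal.rpow_le_rpow (hardyOp_monotone hU f hx.2) hq0.le).trans (le_of_eq ?_)
  exact tsum_congr fun k => mul_comm _ _

theorem le_hardy (hA : IsAdaptedGrid w t m) (hw : NonnegMeasurable w) (hU : IsMonotoneKernel Θ U)
    (hq0 : 0 < q) (f : ℝ → ℝ≥0) : ∑' k, m k * hardyOp U f (t (k + 1)) ^ q ≤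
      2 * ∫⁻ x in Ioi 0, hardyOp U f x ^ q * w x := by
  refine le_trans (le_of_eq ?_) (mul_le_mul' le_rfl (hA.tsum_le_lintegral hw
    (F := fun x => hardyOp U f x ^ q) (c := fun k => hardyOp U f (t (k + 1)) ^ q)
    fun k x hx => ENNReal.rpow_le_rpow (hardyOp_monotone hU f hx.1.le) hq0.le))
  rw [← ENNReal.tsum_mul_left]
  exact tsum_congr fun k => by rw [← hA.two_mul_succ k]; ring

theorem tailInt_le_gridTail (hA : IsAdaptedGrid w t m) (hw : NonnegMeasurable w)
    (hU : IsMonotoneKernel Θ U) (hq0 : 0 < q) (k : ℕ) :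
    tailInt q U w (t (k + 1)) ≤ gridTail q U t m k := by
  unfold tailInt
  simp_rw [mul_comm (w _ : ℝ≥0∞)]
  rw [hA.setLIntegral_Ioi hw, gridTail_eq_tsum]
  refine le_trans (ENNReal.tsum_le_tsum fun i => ?_) (ENNReal.tsum_comp_le_tsum_of_injective
    (add_right_injective 1)
    fun i => m (k + i) * (U (t (k + 1)) (t (k + i + 1)) : ℝ≥0∞) ^ q)
  refine (hA.cell_le hw (c := (U (t (k + 1)) (t (k + 1 + i + 1)) : ℝ≥0∞) ^ q)
    fun x hx => ?_).trans (le_of_eq ?_)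
  · exact hU.mono_rpow (hA.nonneg _) ((hA.nonneg _).trans hx.1.le) hx.2 hq0.le
  · rw [mul_comm, ← add_assoc]

theorem gridTail_le_tailInt (hA : IsAdaptedGrid w t m) (hw : NonnegMeasurable w)
    (hU : IsMonotoneKernel Θ U) (hq0 : 0 < q) (k : ℕ) :
    gridTail q U t m k ≤ 2 * tailInt q U w (t (k + 1)) := by
  unfold tailInt
  simp_rw [mul_comm (w _ : ℝ≥0∞)]
  rw [hA.setLIntegral_Ioi hw, gridTail_eq_tsum, ← ENNReal.tsum_mul_left]
  refine ENNReal.tsum_le_tsum fun i => ?_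
  have h := hA.le_cell hw (k := k + 1 + i)
    (F := fun x => (U (t (k + 1)) x : ℝ≥0∞) ^ q)
    (c := (U (t (k + 1)) (t (k + i + 1)) : ℝ≥0∞) ^ q)
    fun x hx => hU.mono_rpow (hA.nonneg _) (hA.nonneg _)
      ((hA.le (by omega)).trans hx.1.le) hq0.le
  refine le_trans (le_of_eq ?_) (mul_le_mul' le_rfl h)
  rw [← hA.two_mul_succ (k + i), show k + 1 + i = k + i + 1 by omega]
  ring

theorem tailInt_le (hA : IsAdaptedGrid w t m) (hw : NonnegMeasurable w)
    (hU : IsMonotoneKernel Θ U) (hq0 : 0 < q) (hq1 : q < 1) {k : ℕ} {x : ℝ} (hx : t k ≤ x)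
    (hx' : x ≤ t (k + 1)) : tailInt q U w x ≤ 2 * (Θ : ℝ≥0∞) ^ q *
      (m k * (U x (t (k + 1)) : ℝ≥0∞) ^ q + gridTail q U t m k) := by
  have hx0 : 0 ≤ x := (hA.nonneg k).trans hx
  have hT0 := hA.nonneg (k + 1)
  set u := (U x (t (k + 1)) : ℝ≥0∞) ^ q with hu
  have mw (s : Set ℝ) (hs : s ⊆ Ioi x) : AEMeasurable (fun y => (w y : ℝ≥0∞)) (volume.restrict s) :=
    hw.coe_restrict (hs.trans (Ioi_subset_Ioi hx0))
  have h1 : ∫⁻ y in Ioc x (t (k + 1)), (w y : ℝ≥0∞) * (U x y : ℝ≥0∞) ^ q ≤ m k * u := by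
    rw [← hA.cell, ← lintegral_mul_const'' _ (hw.coe_restrict
      fun y hy => (hA.nonneg k).trans_lt hy.1)]
    refine le_trans (setLIntegral_mono_ae' measurableSet_Ioc
      (Filter.Eventually.of_forall fun y hy => ?_)) (lintegral_mono_set (Ioc_subset_Ioc_left hx))
    exact mul_le_mul' le_rfl (hU.mono_rpow hx0 (hx0.trans hy.1.le) hy.2 hq0.le)
  have h2 : ∫⁻ y in Ioi (t (k + 1)), (w y : ℝ≥0∞) * (U x y : ℝ≥0∞) ^ q ≤
      (Θ : ℝ≥0∞) ^ q * (m k * u + tailInt q U w (t (k + 1))) := by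
    have hs : Ioi (t (k + 1)) ⊆ Ioi x := Ioi_subset_Ioi hx'
    rw [← hA.tail, ← lintegral_mul_const'' _ (mw _ hs), tailInt,
      ← lintegral_add_left' ((mw _ hs).mul_const _),
      ← lintegral_const_mul' _ _ (ENNReal.rpow_ne_top_of_nonneg hq0.le (by simp))]
    refine setLIntegral_mono_ae' measurableSet_Ioi (Filter.Eventually.of_forall fun y hy => ?_)
    calc (w y : ℝ≥0∞) * (U x y : ℝ≥0∞) ^ q
        ≤ w y * ((Θ : ℝ≥0∞) ^ q * (u + (U (t (k + 1)) y : ℝ≥0∞) ^ q)) :=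
          mul_le_mul' le_rfl (hU.reg_rpow hx0 hx' (le_of_lt hy) hq0 hq1)
      _ = _ := by ring
  have h3 := hA.tailInt_le_gridTail hw hU hq0 k
  have h4 : tailInt q U w x ≤ m k * u + (Θ : ℝ≥0∞) ^ q * (m k * u + gridTail q U t m k) := by
    rw [tailInt, ← Ioc_union_Ioi_eq_Ioi hx']
    refine (lintegral_union_le _ _ _).trans (add_le_add h1 (h2.trans ?_))
    gcongr
  refine h4.trans ?_
  have h5 : m k * u ≤ (Θ : ℝ≥0∞) ^ q * (m k * u + gridTail q U t m k) := by
    calc m k * u = 1 * (m k * u) := (one_mul _).symm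
      _ ≤ _ := mul_le_mul' (hU.one_le_rpow hq0.le) le_self_add
  calc _ ≤ (Θ : ℝ≥0∞) ^ q * (m k * u + gridTail q U t m k) +
        (Θ : ℝ≥0∞) ^ q * (m k * u + gridTail q U t m k) := by gcongr
    _ = _ := by ring

theorem tailInt_rpow_mul_kerSup_le (hA : IsAdaptedGrid w t m) (hw : NonnegMeasurable w)
    (hU : IsMonotoneKernel Θ U) (hq0 : 0 < q) (hq1 : q < 1) (hp : 1 < p) {k : ℕ} {x : ℝ}
    (hx : t k ≤ x) (hx' : x ≤ t (k + 1)) :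
    tailInt q U w x ^ (rExp p q / p) * kerSup p q U v x ≤
      (2 * (Θ : ℝ≥0∞) ^ q) ^ (rExp p q / p) * 2 ^ (rExp p q / p) *
      (m k ^ (rExp p q / p) * kerInt p U v (t (k + 1)) ^ (rExp p q / conjExp p) +
        gridTail q U t m k ^ (rExp p q / p) * kerSup p q U v x) := by
  have hr := rExp_pos hq0 hq1 hp
  have hp0 : 0 < p := by linarith
  have hs : 0 ≤ rExp p q / p := by positivity
  have hx0 : 0 ≤ x := (hA.nonneg k).trans hx
  have hT0 := hA.nonneg (k + 1)
  have h1 : tailInt q U w x ^ (rExp p q / p) ≤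
      (2 * (Θ : ℝ≥0∞) ^ q) ^ (rExp p q / p) * 2 ^ (rExp p q / p) *
      (m k ^ (rExp p q / p) * (U x (t (k + 1)) : ℝ≥0∞) ^ (q * (rExp p q / p)) +
        gridTail q U t m k ^ (rExp p q / p)) := by
    refine (ENNReal.rpow_le_rpow (hA.tailInt_le hw hU hq0 hq1 hx hx') hs).trans ?_
    rw [ENNReal.mul_rpow_of_nonneg _ _ hs, mul_assoc]
    refine mul_le_mul' le_rfl ((ENNReal.rpow_add_le_two_rpow_mul hs _ _).trans (le_of_eq ?_))
    rw [ENNReal.mul_rpow_of_nonneg _ _ hs, ← ENNReal.rpow_mul]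
  refine (mul_le_mul' h1 le_rfl).trans ?_
  rw [mul_assoc _ _ (kerSup p q U v x), add_mul]
  refine mul_le_mul' le_rfl (add_le_add ?_ le_rfl)
  rw [mul_assoc]
  refine mul_le_mul' le_rfl ?_
  rw [kerSup, ENNReal.mul_iSup]
  refine iSup_le fun z => ?_
  rw [ENNReal.mul_iSup]
  refine iSup_le fun hz => ?_
  refine le_trans ?_ (rpow_rExp_mul_sigmaInt_le_kerInt hU hq0 hq1 hp hz.1.le (hz.2.trans hx'))
  rw [← mul_assoc]
  refine mul_le_mul' ?_ le_rfl
  calc _ ≤ (U z (t (k + 1)) : ℝ≥0∞) ^ (q * (rExp p q / p)) * (U z (t (k + 1)) : ℝ≥0∞) ^ q :=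
        mul_le_mul' (hU.anti_rpow hz.1.le hz.2 hT0 (by positivity))
          (hU.mono_rpow hz.1.le hx0 hx' hq0.le)
    _ = _ := by
        rw [← ENNReal.rpow_add_of_nonneg _ _ (by positivity) hq0.le, mul_rExp_div_left hq0 hq1 hp]

theorem condAOne_le (hA : IsAdaptedGrid w t m) (hw : NonnegMeasurable w)
    (hU : IsMonotoneKernel Θ U) (hq0 : 0 < q) (hq1 : q < 1) (hp : 1 < p) :
    condAOne p q U v w ≤ 2 ^ (rExp p q / p) * ∑' k, gridOne p q U v t m k := by
  have hr := rExp_pos hq0 hq1 hp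
  have hp0 : 0 < p := by linarith
  have hp' := conjExp_pos hp
  have hs : 0 ≤ rExp p q / p := by positivity
  unfold condAOne
  simp_rw [mul_right_comm _ (w _ : ℝ≥0∞)]
  refine (hA.lintegral_le_tsum hw (c := fun k => (2 * m k) ^ (rExp p q / p) *
    kerInt p U v (t (k + 1)) ^ (rExp p q / conjExp p)) fun k x hx => ?_).trans (le_of_eq ?_)
  · exact mul_le_mul' (ENNReal.rpow_le_rpow (hA.setLIntegral_Ioi_le hx.1.le) hs)
      (ENNReal.rpow_le_rpow (kerInt_mono hU hp hx.2) (by positivity))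
  · rw [← ENNReal.tsum_mul_left]
    refine tsum_congr fun k => ?_
    rw [gridOne, ENNReal.rpow_rExp_div hq0 hq1 hp, ENNReal.mul_rpow_of_nonneg _ _ hs]
    ring

theorem tsum_gridOne_le_condAOne (hA : IsAdaptedGrid w t m) (hw : NonnegMeasurable w)
    (hU : IsMonotoneKernel Θ U) (hq0 : 0 < q) (hq1 : q < 1) (hp : 1 < p) :
    ∑' k, gridOne p q U v t m k ≤ 2 ^ (rExp p q / q) * condAOne p q U v w := by
  have hr := rExp_pos hq0 hq1 hp
  have hp0 : 0 < p := by linarith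
  have hp' := conjExp_pos hp
  have hs : 0 ≤ rExp p q / p := by positivity
  unfold condAOne
  simp_rw [mul_right_comm _ (w _ : ℝ≥0∞)]
  refine le_trans (le_of_eq ?_) (mul_le_mul' le_rfl (hA.tsum_le_lintegral hw
    (c := fun k => m (k + 1) ^ (rExp p q / p) *
    kerInt p U v (t (k + 1)) ^ (rExp p q / conjExp p)) fun k x hx => ?_))
  · rw [← ENNReal.tsum_mul_left]
    refine tsum_congr fun k => ?_
    rw [gridOne, ← hA.two_mul_succ k, ENNReal.mul_rpow_of_nonneg _ _ (by positivity),
      ENNReal.rpow_rExp_div hq0 hq1 hp (m (k + 1))]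
    ring
  · refine mul_le_mul' (ENNReal.rpow_le_rpow ?_ hs)
      (ENNReal.rpow_le_rpow (kerInt_mono hU hp hx.1.le) (by positivity))
    rw [← hA.tail]
    exact lintegral_mono_set (Ioi_subset_Ioi hx.2)

theorem condATwo_eq (p q : ℝ) (U : ℝ → ℝ → ℝ≥0) (v w : ℝ → ℝ≥0) : condATwo p q U v w =
    ∫⁻ x in Ioi 0, tailInt q U w x ^ (rExp p q / p) * kerSup p q U v x * w x :=
  lintegral_congr fun _ => mul_right_comm _ _ _

theorem condATwo_le (hA : IsAdaptedGrid w t m) (hw : NonnegMeasurable w)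
    (hU : IsMonotoneKernel Θ U) (hq0 : 0 < q) (hq1 : q < 1) (hp : 1 < p) :
    condATwo p q U v w ≤ (2 * (Θ : ℝ≥0∞) ^ q) ^ (rExp p q / p) * 2 ^ (rExp p q / p) *
      ∑' k, (gridOne p q U v t m k + gridTwo p q U v t m k) := by
  rw [condATwo_eq]
  refine (hA.lintegral_le_tsum hw (c := fun k => (2 * (Θ : ℝ≥0∞) ^ q) ^ (rExp p q / p) *
      2 ^ (rExp p q / p) *
      (m k ^ (rExp p q / p) * kerInt p U v (t (k + 1)) ^ (rExp p q / conjExp p) +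
        gridTail q U t m k ^ (rExp p q / p) * kerSup p q U v (t (k + 1)))) fun k x hx => ?_).trans
    (le_of_eq ?_)
  · refine (hA.tailInt_rpow_mul_kerSup_le hw hU hq0 hq1 hp hx.1.le hx.2).trans ?_
    gcongr
    exact kerSup_mono hU hq0 hx.2
  · rw [← ENNReal.tsum_mul_left]
    refine tsum_congr fun k => ?_
    rw [gridOne, gridTwo, ENNReal.rpow_rExp_div hq0 hq1 hp]
    ring

/-- The constant in `tsum_gridTwo_le`. -/
def _root_.gridTwoConst (p q : ℝ) (Θ : ℝ≥0) : ℝ≥0∞ :=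
  2 * 2 ^ (rExp p q / p) * ((2 * (Θ : ℝ≥0∞) ^ q) ^ (rExp p q / p) * 2 ^ (rExp p q / p)) *
    2 ^ (rExp p q / p)

theorem tsum_gridTwo_le (hA : IsAdaptedGrid w t m) (hw : NonnegMeasurable w)
    (hU : IsMonotoneKernel Θ U) (hq0 : 0 < q) (hq1 : q < 1) (hp : 1 < p) :
    ∑' k, gridTwo p q U v t m k ≤
      gridTwoConst p q Θ * (∑' k, gridOne p q U v t m k + condATwo p q U v w) := by
  have hr := rExp_pos hq0 hq1 hp
  have hp0 : 0 < p := by linarith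
  have hs : 0 ≤ rExp p q / p := by positivity
  have htwo : (1 : ℝ≥0∞) ≤ 2 ^ (rExp p q / p) := by
    simpa using ENNReal.rpow_le_rpow (show (1 : ℝ≥0∞) ≤ 2 by norm_num) hs
  have h1 (k : ℕ) : gridTwo p q U v t m k ≤ gridTwoConst p q Θ * (gridOne p q U v t m (k + 1) +
      tailInt q U w (t (k + 2)) ^ (rExp p q / p) * kerSup p q U v (t (k + 1)) * m (k + 1)) := by
    have h2 := hA.tailInt_rpow_mul_kerSup_le (v := v) hw hU hq0 hq1 hp (k := k + 1) le_rfl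
      (hA.le (by omega))
    have h3 := ENNReal.rpow_le_rpow (hA.gridTail_le_tailInt hw hU hq0 k) hs
    have h4 := ENNReal.rpow_le_rpow (hA.gridTail_le_tailInt hw hU hq0 (k + 1)) hs
    rw [ENNReal.mul_rpow_of_nonneg _ _ hs] at h3 h4
    set c := (2 * (Θ : ℝ≥0∞) ^ q) ^ (rExp p q / p) * 2 ^ (rExp p q / p) with hc
    set d := (2 : ℝ≥0∞) ^ (rExp p q / p) with hd
    calc gridTwo p q U v t m k = 2 * m (k + 1) * gridTail q U t m k ^ (rExp p q / p) *
          kerSup p q U v (t (k + 1)) := by rw [gridTwo, hA.two_mul_succ]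
      _ ≤ 2 * m (k + 1) * (d * tailInt q U w (t (k + 1)) ^ (rExp p q / p)) *
          kerSup p q U v (t (k + 1)) := by gcongr
      _ = 2 * d * m (k + 1) * (tailInt q U w (t (k + 1)) ^ (rExp p q / p) *
          kerSup p q U v (t (k + 1))) := by ring
      _ ≤ 2 * d * m (k + 1) * (c * (m (k + 1) ^ (rExp p q / p) *
            kerInt p U v (t (k + 1 + 1)) ^ (rExp p q / conjExp p) +
          gridTail q U t m (k + 1) ^ (rExp p q / p) * kerSup p q U v (t (k + 1)))) := by gcongr
      _ ≤ 2 * d * m (k + 1) * (c * (d * (m (k + 1) ^ (rExp p q / p) *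
            kerInt p U v (t (k + 1 + 1)) ^ (rExp p q / conjExp p)) +
          d * tailInt q U w (t (k + 1 + 1)) ^ (rExp p q / p) * kerSup p q U v (t (k + 1)))) := by
          exact mul_le_mul' le_rfl (mul_le_mul' le_rfl (add_le_add
            (le_mul_of_one_le_left zero_le htwo) (mul_le_mul' h4 le_rfl)))
      _ = _ := by
          rw [gridTwoConst, gridOne, ENNReal.rpow_rExp_div hq0 hq1 hp]
          ring
  refine (ENNReal.tsum_le_tsum h1).trans ?_
  rw [ENNReal.tsum_mul_left, ENNReal.tsum_add]
  refine mul_le_mul' le_rfl (add_le_add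
    (ENNReal.tsum_comp_le_tsum_of_injective (add_left_injective 1) _) ?_)
  rw [condATwo_eq]
  refine hA.tsum_le_lintegral hw (c := fun k => tailInt q U w (t (k + 2)) ^ (rExp p q / p) *
    kerSup p q U v (t (k + 1))) fun k x hx => ?_
  have hx0 : 0 ≤ x := (hA.nonneg _).trans hx.1.le
  exact mul_le_mul' (ENNReal.rpow_le_rpow (tailInt_antitoneOn hU hq0 hx0 (hA.nonneg _) hx.2) hs)
    (kerSup_mono hU hq0 hx.1.le)

end IsAdaptedGrid

end

noncomputable section

variable {Θ : ℝ≥0} {U : ℝ → ℝ → ℝ≥0} {v w : ℝ → ℝ≥0} {p q : ℝ}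

/-- Measurable functions on `(0, ∞)` with positive finite mass and bounded support. -/
structure IsBddSupportWeight (w : ℝ → ℝ≥0) : Prop where
  measurable : NonnegMeasurable w
  ne_zero : ∫⁻ x in Ioi 0, (w x : ℝ≥0∞) ≠ 0
  ne_top : ∫⁻ x in Ioi 0, (w x : ℝ≥0∞) ≠ ∞
  exists_tail : ∃ R : ℝ, 0 < R ∧ ∫⁻ x in Ioi R, (w x : ℝ≥0∞) = 0

/-- The constant comparing the discrete with the continuous conditions. -/
def gridCondConst (p q : ℝ) (Θ : ℝ≥0) : ℝ≥0∞ :=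
  (1 + gridTwoConst p q Θ) * 2 ^ (rExp p q / q)

theorem gridCondConst_ne_top (hq0 : 0 < q) (hq1 : q < 1) (hp : 1 < p) :
    gridCondConst p q Θ ≠ ∞ := by
  have hr := rExp_pos hq0 hq1 hp
  have hp0 : 0 < p := by linarith
  have h2 (s : ℝ) (hs : 0 ≤ s) : (2 : ℝ≥0∞) ^ s ≠ ∞ := ENNReal.rpow_ne_top_of_nonneg hs (by simp)
  have h2p := h2 (rExp p q / p) (by positivity)
  refine ENNReal.mul_ne_top (ENNReal.add_ne_top.2 ⟨by simp, ?_⟩) (h2 _ (by positivity))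
  exact ENNReal.mul_ne_top (ENNReal.mul_ne_top (ENNReal.mul_ne_top (by simp) h2p)
    (ENNReal.mul_ne_top (ENNReal.mul_rpow_ne_top hq0.le (by positivity) _ (by simp)) h2p)) h2p

theorem IsAdaptedGrid.tsum_grid_le {t : ℕ → ℝ} {m : ℕ → ℝ≥0∞} (hA : IsAdaptedGrid w t m)
    (hw : NonnegMeasurable w) (hU : IsMonotoneKernel Θ U) (hq0 : 0 < q) (hq1 : q < 1)
    (hp : 1 < p) : ∑' k, (gridOne p q U v t m k + gridTwo p q U v t m k) ≤
      gridCondConst p q Θ * (condAOne p q U v w + condATwo p q U v w) := by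
  have hr := rExp_pos hq0 hq1 hp
  have htwo : (1 : ℝ≥0∞) ≤ 2 ^ (rExp p q / q) := by
    simpa using ENNReal.rpow_le_rpow (show (1 : ℝ≥0∞) ≤ 2 by norm_num)
      (show 0 ≤ rExp p q / q by positivity)
  have h1 := hA.tsum_gridOne_le_condAOne (v := v) hw hU hq0 hq1 hp
  have h2 := hA.tsum_gridTwo_le (v := v) hw hU hq0 hq1 hp
  set d := (2 : ℝ≥0∞) ^ (rExp p q / q)
  rw [ENNReal.tsum_add]
  calc _ ≤ d * condAOne p q U v w +
        gridTwoConst p q Θ * (d * condAOne p q U v w + d * condATwo p q U v w) := by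
        refine add_le_add h1 (h2.trans (mul_le_mul' le_rfl (add_le_add h1 ?_)))
        exact le_mul_of_one_le_left zero_le htwo
    _ ≤ d * (condAOne p q U v w + condATwo p q U v w) +
        gridTwoConst p q Θ * (d * condAOne p q U v w + d * condATwo p q U v w) := by
        gcongr
        exact le_self_add
    _ = _ := by
        rw [gridCondConst]
        ring

/-- The constant in the sufficiency part. -/
def upperConst (p q : ℝ) (Θ : ℝ≥0) : ℝ≥0∞ :=
  sufficiencyConst p q Θ * gridCondConst p q Θ ^ (q / rExp p q)

theorem upperConst_ne_top (hq0 : 0 < q) (hq1 : q < 1) (hp : 1 < p) : upperConst p q Θ ≠ ∞ := by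
  have hr := rExp_pos hq0 hq1 hp
  exact ENNReal.mul_ne_top (sufficiencyConst_ne_top hq0 hq1 hp)
    (ENNReal.rpow_ne_top_of_nonneg (by positivity) (gridCondConst_ne_top hq0 hq1 hp))

theorem lintegral_hardyOp_le_of_bdd (hU : IsMonotoneKernel Θ U) (hq0 : 0 < q) (hq1 : q < 1)
    (hp : 1 < p) (hv : IsBddBelowWeight v) (hw : IsBddSupportWeight w) {f : ℝ → ℝ≥0}
    (hf : NonnegMeasurable f) : ∫⁻ x in Ioi 0, hardyOp U f x ^ q * w x ≤
      upperConst p q Θ * (condAOne p q U v w + condATwo p q U v w) ^ (q / rExp p q) *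
        (∫⁻ x in Ioi 0, (f x : ℝ≥0∞) ^ p * v x) ^ (q / p) := by
  have hr := rExp_pos hq0 hq1 hp
  obtain ⟨R, hR, hwR⟩ := hw.exists_tail
  obtain ⟨t, m, hA⟩ := exists_isAdaptedGrid hw.measurable hR hw.ne_zero hw.ne_top hwR
  refine (hA.hardy_le hw.measurable hU hq0 f).trans
    ((tsum_hardyOp_rpow_le hU hq0 hq1 hp hv hA.toIsDyadicGrid hf).trans ?_)
  rw [← mul_assoc]
  refine mul_le_mul' ?_ le_rfl
  rw [upperConst, mul_assoc, ← ENNReal.mul_rpow_of_nonneg _ _ (by positivity)]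
  refine mul_le_mul' le_rfl (ENNReal.rpow_le_rpow ?_ (by positivity))
  exact hA.tsum_grid_le hw.measurable hU hq0 hq1 hp

/-- The constant in the necessity part. -/
def lowerConst (p q : ℝ) (Θ : ℝ≥0) : ℝ≥0∞ :=
  (2 ^ (rExp p q / p) + (2 * (Θ : ℝ≥0∞) ^ q) ^ (rExp p q / p) * 2 ^ (rExp p q / p)) *
    (necessityConst p q Θ * 2 ^ (rExp p q / q))

theorem lowerConst_ne_top (hq0 : 0 < q) (hq1 : q < 1) (hp : 1 < p) : lowerConst p q Θ ≠ ∞ := by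
  have hr := rExp_pos hq0 hq1 hp
  have hp0 : 0 < p := by linarith
  have h2 (s : ℝ) (hs : 0 ≤ s) : (2 : ℝ≥0∞) ^ s ≠ ∞ := ENNReal.rpow_ne_top_of_nonneg hs (by simp)
  have h2p := h2 (rExp p q / p) (by positivity)
  exact ENNReal.mul_ne_top (ENNReal.add_ne_top.2 ⟨h2p,
    ENNReal.mul_ne_top (ENNReal.mul_rpow_ne_top hq0.le (by positivity) _ (by simp)) h2p⟩)
    (ENNReal.mul_ne_top (necessityConst_ne_top hq0 hq1 hp) (h2 _ (by positivity)))

theorem cond_le_of_bdd (hU : IsMonotoneKernel Θ U) (hq0 : 0 < q) (hq1 : q < 1)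
    (hp : 1 < p) (hv : IsBddBelowWeight v) (hw : IsBddSupportWeight w) {D : ℝ≥0∞}
    (hD : ∀ f : ℝ → ℝ≥0, NonnegMeasurable f → ∫⁻ x in Ioi 0, hardyOp U f x ^ q * w x ≤
      D * (∫⁻ x in Ioi 0, (f x : ℝ≥0∞) ^ p * v x) ^ (q / p)) :
    condAOne p q U v w + condATwo p q U v w ≤ lowerConst p q Θ * D ^ (rExp p q / q) := by
  have hr := rExp_pos hq0 hq1 hp
  obtain ⟨R, hR, hwR⟩ := hw.exists_tail
  obtain ⟨t, m, hA⟩ := exists_isAdaptedGrid hw.measurable hR hw.ne_zero hw.ne_top hwR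
  have hGI : GridInequality p q U v t m (2 * D) := fun f hf => by
    refine (hA.le_hardy hw.measurable hU hq0 f).trans ?_
    rw [mul_assoc]
    exact mul_le_mul' le_rfl (hD f hf)
  have h1 := hA.condAOne_le (v := v) hw.measurable hU hq0 hq1 hp
  have h2 := hA.condATwo_le (v := v) hw.measurable hU hq0 hq1 hp
  have h3 := tsum_grid_le_of_gridInequality hU hq0 hq1 hp hv hA.toIsDyadicGrid hGI
  have h4 : ∑' k, gridOne p q U v t m k ≤ ∑' k, (gridOne p q U v t m k + gridTwo p q U v t m k) :=
    ENNReal.tsum_le_tsum fun k => le_self_add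
  rw [ENNReal.mul_rpow_of_nonneg _ _ (by positivity)] at h3
  refine (add_le_add (h1.trans (mul_le_mul' le_rfl (h4.trans h3)))
    (h2.trans (mul_le_mul' le_rfl h3))).trans (le_of_eq ?_)
  rw [lowerConst]
  ring

end

noncomputable section

theorem ENNReal.iSup_mul_iSup_of_monotone {f g : ℕ → ℝ≥0∞} (hf : Monotone f) (hg : Monotone g) :
    ⨆ n, f n * g n = (⨆ n, f n) * ⨆ n, g n := by
  refine le_antisymm (iSup_le fun n => mul_le_mul' (le_iSup f n) (le_iSup g n)) ?_
  rw [ENNReal.iSup_mul]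
  refine iSup_le fun i => ?_
  rw [ENNReal.mul_iSup]
  exact iSup_le fun j => le_iSup_of_le (max i j)
    (mul_le_mul' (hf (le_max_left _ _)) (hg (le_max_right _ _)))

theorem ENNReal.iSup_rpow {f : ℕ → ℝ≥0∞} {s : ℝ} (hs : 0 < s) :
    ⨆ n, f n ^ s = (⨆ n, f n) ^ s :=
  ((ENNReal.orderIsoRpow s hs).map_iSup f).symm

theorem ENNReal.rpow_le_rpow_of_nonpos {a b : ℝ≥0∞} (h : a ≤ b) {s : ℝ} (hs : s ≤ 0) :
    b ^ s ≤ a ^ s := by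
  obtain ⟨u, rfl⟩ : ∃ u, s = -u := ⟨-s, (neg_neg s).symm⟩
  rw [ENNReal.rpow_neg, ENNReal.rpow_neg, ENNReal.inv_le_inv]
  exact ENNReal.rpow_le_rpow h (neg_nonpos.1 hs)

variable {Θ : ℝ≥0} {U : ℝ → ℝ → ℝ≥0} {v w : ℝ → ℝ≥0} {p q : ℝ}

section monotonicity

variable {v' w' : ℝ → ℝ≥0}

theorem sigmaInt_le_of_le (hp : 1 < p) (hv : v ≤ v') (z : ℝ) : sigmaInt p v' z ≤ sigmaInt p v z :=
  lintegral_mono fun s => ENNReal.rpow_le_rpow_of_nonpos (ENNReal.coe_le_coe.2 (hv s))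
    (one_sub_conjExp_neg hp).le

theorem kerInt_le_of_le (hp : 1 < p) (hv : v ≤ v') (t : ℝ) : kerInt p U v' t ≤ kerInt p U v t :=
  lintegral_mono fun s => mul_le_mul' le_rfl
    (ENNReal.rpow_le_rpow_of_nonpos (ENNReal.coe_le_coe.2 (hv s)) (one_sub_conjExp_neg hp).le)

theorem kerSup_le_of_weight_le (hq0 : 0 < q) (hq1 : q < 1) (hp : 1 < p) (hv : v ≤ v') (t : ℝ) :
    kerSup p q U v' t ≤ kerSup p q U v t :=
  iSup₂_mono fun z _ => mul_le_mul' le_rfl <| ENNReal.rpow_le_rpow (sigmaInt_le_of_le hp hv z)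
    (div_pos (rExp_pos hq0 hq1 hp) (conjExp_pos hp)).le

theorem lintegral_Ioi_le_of_le (hw : w' ≤ w) (t : ℝ) :
    ∫⁻ x in Ioi t, (w' x : ℝ≥0∞) ≤ ∫⁻ x in Ioi t, (w x : ℝ≥0∞) :=
  lintegral_mono fun x => ENNReal.coe_le_coe.2 (hw x)

theorem tailInt_le_of_le (hw : w' ≤ w) (t : ℝ) : tailInt q U w' t ≤ tailInt q U w t :=
  lintegral_mono fun x => mul_le_mul' (ENNReal.coe_le_coe.2 (hw x)) le_rfl

theorem condAOne_le_of_le (hq0 : 0 < q) (hq1 : q < 1) (hp : 1 < p) (hv : v ≤ v') (hw : w' ≤ w) :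
    condAOne p q U v' w' ≤ condAOne p q U v w := by
  have hr := rExp_pos hq0 hq1 hp
  refine lintegral_mono fun t => mul_le_mul' (mul_le_mul' (ENNReal.rpow_le_rpow
    (lintegral_Ioi_le_of_le hw t) ?_) (ENNReal.coe_le_coe.2 (hw t)))
    (ENNReal.rpow_le_rpow (kerInt_le_of_le hp hv t) (div_pos hr (conjExp_pos hp)).le)
  positivity

theorem condATwo_le_of_le (hq0 : 0 < q) (hq1 : q < 1) (hp : 1 < p) (hv : v ≤ v') (hw : w' ≤ w) :
    condATwo p q U v' w' ≤ condATwo p q U v w := by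
  have hr := rExp_pos hq0 hq1 hp
  refine lintegral_mono fun t => mul_le_mul' (mul_le_mul' (ENNReal.rpow_le_rpow
    (tailInt_le_of_le hw t) ?_) (ENNReal.coe_le_coe.2 (hw t))) (kerSup_le_of_weight_le hq0 hq1 hp hv t)
  positivity

end monotonicity

/-- The weight `v + 1 / (n + 1)`. -/
def liftWeight (v : ℝ → ℝ≥0) (n : ℕ) (x : ℝ) : ℝ≥0 := v x + ((n : ℝ≥0) + 1)⁻¹

/-- The weight `w` cut off at `n + 1`. -/
def cutWeight (w : ℝ → ℝ≥0) (n : ℕ) : ℝ → ℝ≥0 := (Iio ((n : ℝ) + 1)).indicator w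

theorem le_liftWeight (v : ℝ → ℝ≥0) (n : ℕ) : v ≤ liftWeight v n := fun _ => le_self_add

theorem liftWeight_antitone (v : ℝ → ℝ≥0) : Antitone (liftWeight v) := fun m n h x => by
  unfold liftWeight
  gcongr

theorem NonnegMeasurable.isBddBelowWeight_liftWeight (hv : NonnegMeasurable v) (n : ℕ) :
    IsBddBelowWeight (liftWeight v n) where
  measurable := hv.add_const _
  exists_le := ⟨((n : ℝ≥0) + 1)⁻¹, by positivity, fun _ => le_add_self⟩

theorem cutWeight_le (w : ℝ → ℝ≥0) (n : ℕ) : cutWeight w n ≤ w := indicator_le_self' fun _ _ => zero_le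

theorem cutWeight_monotone (w : ℝ → ℝ≥0) : Monotone (cutWeight w) := fun m n h =>
  indicator_le_indicator_of_subset (Iio_subset_Iio (by gcongr)) fun _ => zero_le

theorem NonnegMeasurable.cutWeight (hw : NonnegMeasurable w) (n : ℕ) :
    NonnegMeasurable (cutWeight w n) := AEMeasurable.indicator hw measurableSet_Iio

theorem iSup_cutWeight (w : ℝ → ℝ≥0) (x : ℝ) : ⨆ n, (cutWeight w n x : ℝ≥0∞) = w x := by
  refine le_antisymm (iSup_le fun n => ENNReal.coe_le_coe.2 (cutWeight_le w n x)) ?_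
  obtain ⟨n, hn⟩ := exists_nat_gt x
  refine le_iSup_of_le n ?_
  rw [cutWeight, indicator_of_mem (show x ∈ Iio ((n : ℝ) + 1) by simp only [mem_Iio]; linarith)]

theorem tendsto_natCast_add_one_inv :
    Filter.Tendsto (fun n : ℕ => ((((n : ℝ≥0) + 1)⁻¹ : ℝ≥0) : ℝ≥0∞)) Filter.atTop (nhds 0) := by
  rw [← ENNReal.coe_zero, ENNReal.tendsto_coe]
  simpa [Function.comp_def] using (tendsto_inv_atTop_nhds_zero_nat (𝕜 := ℝ≥0)).comp
    (Filter.tendsto_add_atTop_nat 1)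

theorem iSup_liftWeight_rpow (v : ℝ → ℝ≥0) {s : ℝ} (hs : s ≤ 0) (x : ℝ) :
    ⨆ n, (liftWeight v n x : ℝ≥0∞) ^ s = (v x : ℝ≥0∞) ^ s := by
  refine iSup_eq_of_tendsto (fun m n h => ENNReal.rpow_le_rpow_of_nonpos
    (ENNReal.coe_le_coe.2 (liftWeight_antitone v h x)) hs) ?_
  refine (ENNReal.continuous_rpow_const.tendsto _).comp ?_
  simp only [liftWeight, ENNReal.coe_add]
  simpa using tendsto_natCast_add_one_inv.const_add (v x : ℝ≥0∞)

theorem IsWeight.isBddSupportWeight_cutWeight (hw : IsWeight w) (n : ℕ) :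
    IsBddSupportWeight (cutWeight w n) := by
  have hn : (0 : ℝ) < n + 1 := by positivity
  have h0 : ∫⁻ x in Ioi 0, (cutWeight w n x : ℝ≥0∞) = ∫⁻ x in Ioo 0 ((n : ℝ) + 1), (w x : ℝ≥0∞) := by
    have : ∀ x, (cutWeight w n x : ℝ≥0∞) =
        (Iio ((n : ℝ) + 1)).indicator (fun x => (w x : ℝ≥0∞)) x := fun x => by
      unfold cutWeight
      by_cases hx : x ∈ Iio ((n : ℝ) + 1) <;> simp [hx, indicator]
    simp_rw [this]
    rw [lintegral_indicator measurableSet_Iio, Measure.restrict_restrict measurableSet_Iio,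
      inter_comm, Ioi_inter_Iio]
  refine ⟨hw.measurable.cutWeight n, ?_, ?_, n + 1, hn, ?_⟩
  · rw [h0]; exact (hw.pos _ hn).ne'
  · rw [h0]; exact (hw.finite _ hn).ne
  · rw [setLIntegral_congr_fun (g := fun _ => 0) measurableSet_Ioi, lintegral_zero]
    intro x hx
    have : x ∉ Iio ((n : ℝ) + 1) := by simpa using (mem_Ioi.1 hx).le
    simp [cutWeight, indicator_of_notMem this]

theorem iSup_sigmaInt_liftWeight (hp : 1 < p) (hv : NonnegMeasurable v) (z : ℝ) :
    ⨆ n, sigmaInt p (liftWeight v n) z = sigmaInt p v z := by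
  unfold sigmaInt
  rw [← lintegral_iSup']
  · simp_rw [iSup_liftWeight_rpow v (one_sub_conjExp_neg hp).le]
  · exact fun n => ((hv.isBddBelowWeight_liftWeight n).measurable.coe_restrict
      Ioo_subset_Ioi_self).pow_const _
  · exact Filter.Eventually.of_forall fun x m n h => ENNReal.rpow_le_rpow_of_nonpos
      (ENNReal.coe_le_coe.2 (liftWeight_antitone v h x)) (one_sub_conjExp_neg hp).le

theorem iSup_kerInt_liftWeight (hU : IsMonotoneKernel Θ U) (hp : 1 < p) (hv : NonnegMeasurable v)
    {t : ℝ} (ht : 0 ≤ t) : ⨆ n, kerInt p U (liftWeight v n) t = kerInt p U v t := by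
  unfold kerInt
  rw [← lintegral_iSup']
  · simp_rw [← ENNReal.mul_iSup, iSup_liftWeight_rpow v (one_sub_conjExp_neg hp).le]
  · exact fun n => ((hU.aemeasurable_left ht measurableSet_Ioo
      fun x hx => hx.1.le).coe_nnreal_ennreal.pow_const _).mul
      (((hv.isBddBelowWeight_liftWeight n).measurable.coe_restrict Ioo_subset_Ioi_self).pow_const _)
  · exact Filter.Eventually.of_forall fun x m n h => mul_le_mul' le_rfl
      (ENNReal.rpow_le_rpow_of_nonpos
        (ENNReal.coe_le_coe.2 (liftWeight_antitone v h x)) (one_sub_conjExp_neg hp).le)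

theorem iSup_kerSup_liftWeight (hq0 : 0 < q) (hq1 : q < 1) (hp : 1 < p) (hv : NonnegMeasurable v)
    (t : ℝ) : ⨆ n, kerSup p q U (liftWeight v n) t = kerSup p q U v t := by
  unfold kerSup
  rw [iSup_comm]
  refine iSup_congr fun z => ?_
  rw [iSup_comm]
  refine iSup_congr fun _ => ?_
  rw [← ENNReal.mul_iSup, ENNReal.iSup_rpow (div_pos (rExp_pos hq0 hq1 hp) (conjExp_pos hp)),
    iSup_sigmaInt_liftWeight hp hv]

theorem iSup_lintegral_cutWeight (hw : NonnegMeasurable w) {t : ℝ} (ht : 0 ≤ t) :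
    ⨆ n, ∫⁻ x in Ioi t, (cutWeight w n x : ℝ≥0∞) = ∫⁻ x in Ioi t, (w x : ℝ≥0∞) := by
  rw [← lintegral_iSup']
  · simp_rw [iSup_cutWeight]
  · exact fun n => (hw.cutWeight n).coe_restrict (Ioi_subset_Ioi ht)
  · exact Filter.Eventually.of_forall fun x m n h => ENNReal.coe_le_coe.2 (cutWeight_monotone w h x)

theorem iSup_tailInt_cutWeight (hU : IsMonotoneKernel Θ U) (hw : NonnegMeasurable w) {t : ℝ}
    (ht : 0 ≤ t) : ⨆ n, tailInt q U (cutWeight w n) t = tailInt q U w t := by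
  unfold tailInt
  have hUm : AEMeasurable (fun x => U t x) (volume.restrict (Ioi t)) :=
    aemeasurable_restrict_of_monotoneOn measurableSet_Ioi fun a ha b _ hab => by
      exact_mod_cast hU.mono ht (ht.trans (mem_Ioi.1 ha).le) hab
  rw [← lintegral_iSup']
  · simp_rw [← ENNReal.iSup_mul, iSup_cutWeight]
  · exact fun n => ((hw.cutWeight n).coe_restrict (Ioi_subset_Ioi ht)).mul
      (hUm.coe_nnreal_ennreal.pow_const _)
  · exact Filter.Eventually.of_forall fun x m n h => mul_le_mul'
      (ENNReal.coe_le_coe.2 (cutWeight_monotone w h x)) le_rfl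

theorem iSup_condAOne (hU : IsMonotoneKernel Θ U) (hq0 : 0 < q) (hq1 : q < 1) (hp : 1 < p)
    (hv : NonnegMeasurable v) (hw : NonnegMeasurable w) :
    ⨆ n, condAOne p q U (liftWeight v n) (cutWeight w n) = condAOne p q U v w := by
  have hr := rExp_pos hq0 hq1 hp
  have hp' := conjExp_pos hp
  have hrp : 0 < rExp p q / p := by positivity
  have hrp' : 0 < rExp p q / conjExp p := by positivity
  have hmono1 (t : ℝ) : Monotone fun n =>
      (∫⁻ x in Ioi t, (cutWeight w n x : ℝ≥0∞)) ^ (rExp p q / p) := fun m n h =>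
    ENNReal.rpow_le_rpow (lintegral_Ioi_le_of_le (cutWeight_monotone w h) t) hrp.le
  have hmono2 (t : ℝ) : Monotone fun n => (cutWeight w n t : ℝ≥0∞) := fun m n h =>
    ENNReal.coe_le_coe.2 (cutWeight_monotone w h t)
  have hmono3 (t : ℝ) : Monotone fun n => kerInt p U (liftWeight v n) t ^ (rExp p q / conjExp p) :=
    fun m n h => ENNReal.rpow_le_rpow (kerInt_le_of_le hp (liftWeight_antitone v h) t) hrp'.le
  change ⨆ n, ∫⁻ t in Ioi (0 : ℝ), (∫⁻ x in Ioi t, (cutWeight w n x : ℝ≥0∞)) ^ (rExp p q / p) *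
    (cutWeight w n t : ℝ≥0∞) * kerInt p U (liftWeight v n) t ^ (rExp p q / conjExp p) = _
  rw [← lintegral_iSup']
  · refine setLIntegral_congr_fun measurableSet_Ioi fun t ht => ?_
    have ht' : 0 ≤ t := (mem_Ioi.1 ht).le
    rw [ENNReal.iSup_mul_iSup_of_monotone ((hmono1 t).mul' (hmono2 t)) (hmono3 t),
      ENNReal.iSup_mul_iSup_of_monotone (hmono1 t) (hmono2 t), ENNReal.iSup_rpow hrp,
      ENNReal.iSup_rpow hrp', iSup_lintegral_cutWeight hw ht', iSup_cutWeight,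
      iSup_kerInt_liftWeight hU hp hv ht']
    rfl
  · refine fun n => (AEMeasurable.mul (AEMeasurable.pow_const ?_ _)
      ((hw.cutWeight n).coe_restrict subset_rfl)).mul
      ((kerInt_mono hU hp).measurable.aemeasurable.pow_const _)
    have : Antitone fun t => ∫⁻ x in Ioi t, (cutWeight w n x : ℝ≥0∞) := fun a b h =>
      lintegral_mono_set (Ioi_subset_Ioi h)
    exact this.measurable.aemeasurable
  · exact Filter.Eventually.of_forall fun t => ((hmono1 t).mul' (hmono2 t)).mul' (hmono3 t)

theorem iSup_condATwo (hU : IsMonotoneKernel Θ U) (hq0 : 0 < q) (hq1 : q < 1) (hp : 1 < p)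
    (hv : NonnegMeasurable v) (hw : NonnegMeasurable w) :
    ⨆ n, condATwo p q U (liftWeight v n) (cutWeight w n) = condATwo p q U v w := by
  have hr := rExp_pos hq0 hq1 hp
  have hrp : 0 < rExp p q / p := by positivity
  have hmono1 (t : ℝ) : Monotone fun n => tailInt q U (cutWeight w n) t ^ (rExp p q / p) :=
    fun m n h => ENNReal.rpow_le_rpow (tailInt_le_of_le (cutWeight_monotone w h) t) hrp.le
  have hmono2 (t : ℝ) : Monotone fun n => (cutWeight w n t : ℝ≥0∞) := fun m n h =>
    ENNReal.coe_le_coe.2 (cutWeight_monotone w h t)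
  have hmono3 (t : ℝ) : Monotone fun n => kerSup p q U (liftWeight v n) t := fun m n h =>
    kerSup_le_of_weight_le hq0 hq1 hp (liftWeight_antitone v h) t
  change ⨆ n, ∫⁻ t in Ioi (0 : ℝ), tailInt q U (cutWeight w n) t ^ (rExp p q / p) *
    (cutWeight w n t : ℝ≥0∞) * kerSup p q U (liftWeight v n) t = _
  rw [← lintegral_iSup']
  · refine setLIntegral_congr_fun measurableSet_Ioi fun t ht => ?_
    have ht' : 0 ≤ t := (mem_Ioi.1 ht).le
    rw [ENNReal.iSup_mul_iSup_of_monotone ((hmono1 t).mul' (hmono2 t)) (hmono3 t),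
      ENNReal.iSup_mul_iSup_of_monotone (hmono1 t) (hmono2 t), ENNReal.iSup_rpow hrp,
      iSup_tailInt_cutWeight hU hw ht', iSup_cutWeight, iSup_kerSup_liftWeight hq0 hq1 hp hv]
    rfl
  · refine fun n => (AEMeasurable.mul (AEMeasurable.pow_const ?_ _)
      ((hw.cutWeight n).coe_restrict subset_rfl)).mul
      (kerSup_mono hU hq0).measurable.aemeasurable
    exact aemeasurable_restrict_of_antitoneOn measurableSet_Ioi
      ((tailInt_antitoneOn hU hq0).mono Ioi_subset_Ici_self)
  · exact Filter.Eventually.of_forall fun t => ((hmono1 t).mul' (hmono2 t)).mul' (hmono3 t)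

theorem cond_le_of_lintegral_hardyOp_le (hU : IsMonotoneKernel Θ U) (hq0 : 0 < q) (hq1 : q < 1)
    (hp : 1 < p) (hv : NonnegMeasurable v) (hw : IsWeight w) {D : ℝ≥0∞}
    (hD : ∀ f : ℝ → ℝ≥0, NonnegMeasurable f → ∫⁻ x in Ioi 0, hardyOp U f x ^ q * w x ≤
      D * (∫⁻ x in Ioi 0, (f x : ℝ≥0∞) ^ p * v x) ^ (q / p)) :
    condAOne p q U v w + condATwo p q U v w ≤ lowerConst p q Θ * D ^ (rExp p q / q) := by
  have hqp : 0 ≤ q / p := by positivity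
  rw [← iSup_condAOne hU hq0 hq1 hp hv hw.measurable, ← iSup_condATwo hU hq0 hq1 hp hv hw.measurable,
    ENNReal.iSup_add_iSup_of_monotone
      (fun m n h => condAOne_le_of_le hq0 hq1 hp (liftWeight_antitone v h) (cutWeight_monotone w h))
      (fun m n h => condATwo_le_of_le hq0 hq1 hp (liftWeight_antitone v h) (cutWeight_monotone w h))]
  refine iSup_le fun n => cond_le_of_bdd hU hq0 hq1 hp (hv.isBddBelowWeight_liftWeight n)
    (hw.isBddSupportWeight_cutWeight n) fun f hf => ?_
  refine (lintegral_mono fun x => ?_).trans ((hD f hf).trans ?_)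
  · exact mul_le_mul' le_rfl (ENNReal.coe_le_coe.2 (cutWeight_le w n x))
  · exact mul_le_mul' le_rfl (ENNReal.rpow_le_rpow (lintegral_mono fun x => mul_le_mul' le_rfl
      (ENNReal.coe_le_coe.2 (le_liftWeight v n x))) hqp)

/-- The truncation `min f n` restricted to `(-∞, n)`. -/
def truncFun (f : ℝ → ℝ≥0) (n : ℕ) : ℝ → ℝ≥0 := (Iio (n : ℝ)).indicator fun x => min (f x) n

theorem truncFun_monotone (f : ℝ → ℝ≥0) : Monotone (truncFun f) := fun m n h x => by
  have h' : (m : ℝ) ≤ n := Nat.cast_le.2 h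
  by_cases hx : x ∈ Iio (m : ℝ)
  · rw [truncFun, truncFun, indicator_of_mem hx, indicator_of_mem (Iio_subset_Iio h' hx)]
    exact min_le_min le_rfl (Nat.cast_le.2 h)
  · simp [truncFun, indicator_of_notMem hx]

theorem truncFun_le (f : ℝ → ℝ≥0) (n : ℕ) : truncFun f n ≤ f := fun x => by
  unfold truncFun indicator
  split_ifs
  exacts [min_le_left _ _, zero_le]

theorem iSup_truncFun (f : ℝ → ℝ≥0) (x : ℝ) : ⨆ n, (truncFun f n x : ℝ≥0∞) = f x := by
  refine le_antisymm (iSup_le fun n => ENNReal.coe_le_coe.2 (truncFun_le f n x)) ?_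
  obtain ⟨n, hn⟩ := exists_nat_gt (max x (f x))
  refine le_iSup_of_le n ?_
  have h1 : x ∈ Iio (n : ℝ) := (le_max_left _ _).trans_lt hn
  have h2 : f x ≤ n := by exact_mod_cast ((le_max_right _ _).trans_lt hn).le
  rw [truncFun, indicator_of_mem h1, min_eq_left h2]

theorem NonnegMeasurable.truncFun {f : ℝ → ℝ≥0} (hf : NonnegMeasurable f) (n : ℕ) :
    NonnegMeasurable (truncFun f n) :=
  AEMeasurable.indicator (AEMeasurable.min hf aemeasurable_const) measurableSet_Iio

theorem lintegral_truncFun_rpow_ne_top (f : ℝ → ℝ≥0) (n : ℕ) (hp : 0 < p) :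
    ∫⁻ x in Ioi 0, (truncFun f n x : ℝ≥0∞) ^ p ≠ ∞ := by
  have h : ∀ x, (truncFun f n x : ℝ≥0∞) ^ p ≤
      (Iio (n : ℝ)).indicator (fun _ => (n : ℝ≥0∞) ^ p) x := fun x => by
    unfold truncFun
    by_cases hx : x ∈ Iio (n : ℝ)
    · rw [indicator_of_mem hx, indicator_of_mem hx]
      exact ENNReal.rpow_le_rpow (by exact_mod_cast min_le_right _ _) hp.le
    · simp [indicator_of_notMem hx, hp]
  refine ((lintegral_mono h).trans_lt ?_).ne
  rw [lintegral_indicator measurableSet_Iio, Measure.restrict_restrict measurableSet_Iio,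
    inter_comm, Ioi_inter_Iio, setLIntegral_const, Real.volume_Ioo]
  exact ENNReal.mul_lt_top (ENNReal.rpow_lt_top_of_nonneg hp.le (by simp)) ENNReal.ofReal_lt_top

theorem iSup_hardyOp_truncFun (hU : IsMonotoneKernel Θ U) {f : ℝ → ℝ≥0} (hf : NonnegMeasurable f)
    {t : ℝ} (ht : 0 ≤ t) : ⨆ n, hardyOp U (truncFun f n) t = hardyOp U f t := by
  unfold hardyOp
  rw [← lintegral_iSup']
  · simp_rw [← ENNReal.iSup_mul, iSup_truncFun]
  · exact fun n => ((hf.truncFun n).coe_restrict Ioo_subset_Ioi_self).mul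
      (hU.aemeasurable_left ht measurableSet_Ioo fun x hx => hx.1.le).coe_nnreal_ennreal
  · exact Filter.Eventually.of_forall fun x m n h => mul_le_mul'
      (ENNReal.coe_le_coe.2 (truncFun_monotone f h x)) le_rfl

theorem lintegral_hardyOp_le_of_lintegral_ne_top (hU : IsMonotoneKernel Θ U) (hq0 : 0 < q)
    (hq1 : q < 1) (hp : 1 < p) (hv : NonnegMeasurable v) (hw : IsBddSupportWeight w)
    {f : ℝ → ℝ≥0} (hf : NonnegMeasurable f) (hfp : ∫⁻ x in Ioi 0, (f x : ℝ≥0∞) ^ p ≠ ∞)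
    (hA : condAOne p q U v w + condATwo p q U v w ≠ ∞) :
    ∫⁻ x in Ioi 0, hardyOp U f x ^ q * w x ≤
      upperConst p q Θ * (condAOne p q U v w + condATwo p q U v w) ^ (q / rExp p q) *
        (∫⁻ x in Ioi 0, (f x : ℝ≥0∞) ^ p * v x) ^ (q / p) := by
  have hr := rExp_pos hq0 hq1 hp
  have hqr : 0 ≤ q / rExp p q := by positivity
  set X := ∫⁻ x in Ioi 0, (f x : ℝ≥0∞) ^ p * v x with hX
  set c := ∫⁻ x in Ioi 0, (f x : ℝ≥0∞) ^ p with hc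
  set B := upperConst p q Θ * (condAOne p q U v w + condATwo p q U v w) ^ (q / rExp p q) with hB
  have hBt : B ≠ ∞ := ENNReal.mul_ne_top (upperConst_ne_top hq0 hq1 hp)
    (ENNReal.rpow_ne_top_of_nonneg hqr hA)
  have hn (n : ℕ) : ∫⁻ x in Ioi 0, hardyOp U f x ^ q * w x ≤
      B * (X + c * (((n : ℝ≥0) + 1)⁻¹ : ℝ≥0)) ^ (q / p) := by
    refine (lintegral_hardyOp_le_of_bdd hU hq0 hq1 hp (hv.isBddBelowWeight_liftWeight n) hw
      hf).trans ?_
    refine mul_le_mul' (mul_le_mul' le_rfl (ENNReal.rpow_le_rpow (add_le_add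
      (condAOne_le_of_le hq0 hq1 hp (le_liftWeight v n) le_rfl)
      (condATwo_le_of_le hq0 hq1 hp (le_liftWeight v n) le_rfl)) hqr)) (le_of_eq ?_)
    congr 1
    simp only [liftWeight, ENNReal.coe_add, mul_add]
    rw [lintegral_add_right', lintegral_mul_const' _ _ ENNReal.coe_ne_top]
    exact ((hf.coe_restrict subset_rfl).pow_const _).mul_const _
  refine ge_of_tendsto' (x := Filter.atTop) (ENNReal.Tendsto.const_mul
    ((ENNReal.continuous_rpow_const.tendsto X).comp ?_) (Or.inr hBt)) hn
  simpa using (ENNReal.Tendsto.const_mul tendsto_natCast_add_one_inv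
    (Or.inr hfp)).const_add X

theorem lintegral_hardyOp_le (hU : IsMonotoneKernel Θ U) (hq0 : 0 < q) (hq1 : q < 1)
    (hp : 1 < p) (hv : NonnegMeasurable v) (hw : IsWeight w) {f : ℝ → ℝ≥0}
    (hf : NonnegMeasurable f) (hA : condAOne p q U v w + condATwo p q U v w ≠ ∞) :
    ∫⁻ x in Ioi 0, hardyOp U f x ^ q * w x ≤
      upperConst p q Θ * (condAOne p q U v w + condATwo p q U v w) ^ (q / rExp p q) *
        (∫⁻ x in Ioi 0, (f x : ℝ≥0∞) ^ p * v x) ^ (q / p) := by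
  have hr := rExp_pos hq0 hq1 hp
  have hp0 : 0 < p := by linarith
  have hqr : 0 ≤ q / rExp p q := by positivity
  have hqp : 0 ≤ q / p := by positivity
  have hmono1 (x : ℝ) : Monotone fun n => hardyOp U (truncFun f n) x ^ q := fun m n h =>
    ENNReal.rpow_le_rpow (lintegral_mono fun y => mul_le_mul'
      (ENNReal.coe_le_coe.2 (truncFun_monotone f h y)) le_rfl) hq0.le
  have hmono2 (x : ℝ) : Monotone fun n => (cutWeight w n x : ℝ≥0∞) := fun m n h =>
    ENNReal.coe_le_coe.2 (cutWeight_monotone w h x)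
  have hlim : ∫⁻ x in Ioi 0, hardyOp U f x ^ q * w x =
      ⨆ n, ∫⁻ x in Ioi 0, hardyOp U (truncFun f n) x ^ q * cutWeight w n x := by
    rw [← lintegral_iSup']
    · refine setLIntegral_congr_fun measurableSet_Ioi fun t ht => ?_
      rw [ENNReal.iSup_mul_iSup_of_monotone (hmono1 t) (hmono2 t), ENNReal.iSup_rpow hq0,
        iSup_hardyOp_truncFun hU hf (mem_Ioi.1 ht).le, iSup_cutWeight]
    · exact fun n => ((hardyOp_monotone hU _).measurable.aemeasurable.pow_const _).mul
        ((hw.measurable.cutWeight n).coe_restrict subset_rfl)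
    · exact Filter.Eventually.of_forall fun t => (hmono1 t).mul' (hmono2 t)
  rw [hlim]
  refine iSup_le fun n => ?_
  have hle := add_le_add
    (condAOne_le_of_le (U := U) hq0 hq1 hp (le_refl v) (cutWeight_le w n))
    (condATwo_le_of_le (U := U) hq0 hq1 hp (le_refl v) (cutWeight_le w n))
  refine (lintegral_hardyOp_le_of_lintegral_ne_top hU hq0 hq1 hp hv
    (hw.isBddSupportWeight_cutWeight n) (hf.truncFun n)
    (lintegral_truncFun_rpow_ne_top f n hp0) (ne_top_of_le_ne_top hA hle)).trans ?_
  refine mul_le_mul' (mul_le_mul' le_rfl (ENNReal.rpow_le_rpow hle hqr))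
    (ENNReal.rpow_le_rpow (lintegral_mono fun x => mul_le_mul' (ENNReal.rpow_le_rpow
      (ENNReal.coe_le_coe.2 (truncFun_le f n x)) hp0.le) le_rfl) hqp)

end

noncomputable section

section

variable {Θ : ℝ≥0} {U : ℝ → ℝ → ℝ≥0} {v w : ℝ → ℝ≥0} {p q : ℝ}

theorem hardyInequality_iff (hq0 : 0 < q) {C : ℝ≥0} : HardyInequality p q U v w C ↔
    ∀ f : ℝ → ℝ≥0, NonnegMeasurable f → ∫⁻ x in Ioi 0, hardyOp U f x ^ q * w x ≤
      (C : ℝ≥0∞) ^ q * (∫⁻ x in Ioi 0, (f x : ℝ≥0∞) ^ p * v x) ^ (q / p) := by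
  refine forall₂_congr fun f _ => ?_
  rw [weightedNorm, weightedNorm, one_div q, ENNReal.rpow_inv_le_iff hq0,
    ENNReal.mul_rpow_of_nonneg _ _ hq0.le, ← ENNReal.rpow_mul, one_div_mul_eq_div]

theorem HardyInequality.cond_le {C : ℝ≥0} (hC : HardyInequality p q U v w C)
    (hU : IsMonotoneKernel Θ U) (hq0 : 0 < q) (hq1 : q < 1) (hp : 1 < p) (hv : NonnegMeasurable v)
    (hw : IsWeight w) :
    condAOne p q U v w + condATwo p q U v w ≤ lowerConst p q Θ * (C : ℝ≥0∞) ^ rExp p q := by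
  have h := cond_le_of_lintegral_hardyOp_le hU hq0 hq1 hp hv hw ((hardyInequality_iff hq0).1 hC)
  rwa [← ENNReal.rpow_mul, mul_div_cancel₀ _ hq0.ne'] at h

theorem hardyInequality_of_cond_le (hU : IsMonotoneKernel Θ U) (hq0 : 0 < q) (hq1 : q < 1)
    (hp : 1 < p) (hv : NonnegMeasurable v) (hw : IsWeight w) {C : ℝ≥0}
    (hA : condAOne p q U v w + condATwo p q U v w ≠ ∞)
    (hC : upperConst p q Θ ^ (rExp p q / q) * (condAOne p q U v w + condATwo p q U v w) ≤
      (C : ℝ≥0∞) ^ rExp p q) : HardyInequality p q U v w C := by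
  have hr := rExp_pos hq0 hq1 hp
  have hqr : 0 ≤ q / rExp p q := by positivity
  refine (hardyInequality_iff hq0).2 fun f hf =>
    (lintegral_hardyOp_le hU hq0 hq1 hp hv hw hf hA).trans (mul_le_mul' ?_ le_rfl)
  have h := ENNReal.rpow_le_rpow hC hqr
  rwa [ENNReal.mul_rpow_of_nonneg _ _ hqr, ← ENNReal.rpow_mul, ← ENNReal.rpow_mul,
    div_mul_div_cancel₀ hq0.ne', div_self hr.ne', ENNReal.rpow_one, mul_div_cancel₀ _ hr.ne'] at h

theorem exists_hardyInequality (hU : IsMonotoneKernel Θ U) (hq0 : 0 < q) (hq1 : q < 1)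
    (hp : 1 < p) (hv : NonnegMeasurable v) (hw : IsWeight w)
    (hA : condAOne p q U v w + condATwo p q U v w ≠ ∞) :
    ∃ C : ℝ≥0, HardyInequality p q U v w C ∧ (C : ℝ≥0∞) ^ rExp p q =
      upperConst p q Θ ^ (rExp p q / q) * (condAOne p q U v w + condATwo p q U v w) := by
  have hr := rExp_pos hq0 hq1 hp
  set B := upperConst p q Θ ^ (rExp p q / q) * (condAOne p q U v w + condATwo p q U v w) with hB
  have hBt : B ≠ ∞ := ENNReal.mul_ne_top
    (ENNReal.rpow_ne_top_of_nonneg (by positivity) (upperConst_ne_top hq0 hq1 hp)) hA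
  have hC : ((B ^ (rExp p q)⁻¹).toNNReal : ℝ≥0∞) ^ rExp p q = B := by
    rw [ENNReal.coe_toNNReal (ENNReal.rpow_ne_top_of_nonneg (by positivity) hBt),
      ENNReal.rpow_inv_rpow hr.ne']
  exact ⟨_, hardyInequality_of_cond_le hU hq0 hq1 hp hv hw hA hC.ge, hC⟩

theorem isLeast_sInf_hardyInequality (hU : IsMonotoneKernel Θ U) (hq0 : 0 < q) (hq1 : q < 1)
    (hp : 1 < p) (hv : NonnegMeasurable v) (hw : IsWeight w)
    (hne : {C : ℝ≥0 | HardyInequality p q U v w C}.Nonempty) :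
    IsLeast {C : ℝ≥0 | HardyInequality p q U v w C}
      (sInf {C : ℝ≥0 | HardyInequality p q U v w C}) := by
  have hr := rExp_pos hq0 hq1 hp
  refine ⟨?_, fun C hC => csInf_le (OrderBot.bddBelow _) hC⟩
  obtain ⟨u, -, hu, huS⟩ := exists_seq_tendsto_sInf hne (OrderBot.bddBelow _)
  have hu' := ENNReal.tendsto_coe.2 hu
  by_cases h0 : sInf {C : ℝ≥0 | HardyInequality p q U v w C} = 0
  · have hA : condAOne p q U v w + condATwo p q U v w ≤ lowerConst p q Θ * (0 : ℝ≥0∞) ^ rExp p q := by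
      rw [h0] at hu'
      exact ge_of_tendsto' (x := Filter.atTop) (ENNReal.Tendsto.const_mul
        ((ENNReal.continuous_rpow_const.tendsto _).comp hu')
        (Or.inr (lowerConst_ne_top hq0 hq1 hp)))
        fun n => HardyInequality.cond_le (huS n) hU hq0 hq1 hp hv hw
    rw [ENNReal.zero_rpow_of_pos hr, mul_zero] at hA
    refine hardyInequality_of_cond_le hU hq0 hq1 hp hv hw
      (ne_top_of_le_ne_top ENNReal.zero_ne_top hA) ?_
    rw [le_zero_iff.1 hA, mul_zero]
    exact zero_le
  · exact fun f hf => ge_of_tendsto' (x := Filter.atTop)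
      (ENNReal.Tendsto.mul_const hu' (Or.inl (ENNReal.coe_ne_zero.2 h0))) fun n => huS n f hf

end

theorem mainTheorem3 (p q θ : ℝ) (hq0 : 0 < q) (hq1 : q < 1) (hp : 1 < p) (hθ : 0 < θ) :
    ∃ K : ℝ≥0, ∀ (U : ℝ → ℝ → ℝ≥0) (v w : ℝ → ℝ≥0),
      IsRegularKernel θ U → IsWeight v → IsWeight w →
        ((∃ C : ℝ≥0, 0 < C ∧ HardyInequality p q U v w C) ↔
          (condAOne p q U v w < ∞ ∧ condATwo p q U v w < ∞)) ∧
        ((∃ C : ℝ≥0, 0 < C ∧ HardyInequality p q U v w C) →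
          ∃ C : ℝ≥0, IsLeast {C : ℝ≥0 | HardyInequality p q U v w C} C ∧
            (C : ℝ≥0∞) ^ rExp p q ≤ K * (condAOne p q U v w + condATwo p q U v w) ∧
            condAOne p q U v w + condATwo p q U v w ≤ K * (C : ℝ≥0∞) ^ rExp p q) := by
  have hr := rExp_pos hq0 hq1 hp
  set Θ := max θ.toNNReal 1
  set K := max (upperConst p q Θ ^ (rExp p q / q)) (lowerConst p q Θ)
  have hL := lowerConst_ne_top (Θ := Θ) hq0 hq1 hp
  have hK : K ≠ ∞ := by
    refine (max_lt (ENNReal.rpow_lt_top_of_nonneg ?_ (upperConst_ne_top hq0 hq1 hp)) hL.lt_top).ne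
    positivity
  refine ⟨K.toNNReal, fun U v w hU hv hw => ?_⟩
  rw [ENNReal.coe_toNNReal hK, ← ENNReal.add_lt_top]
  have hU' := hU.isMonotoneKernel
  have hnec {C : ℝ≥0} (hC : HardyInequality p q U v w C) :=
    hC.cond_le hU' hq0 hq1 hp hv.measurable hw
  have hfin {C : ℝ≥0} (hC : HardyInequality p q U v w C) :
      condAOne p q U v w + condATwo p q U v w < ∞ :=
    (hnec hC).trans_lt (ENNReal.mul_lt_top hL.lt_top
      (ENNReal.rpow_lt_top_of_nonneg hr.le ENNReal.coe_ne_top))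
  refine ⟨⟨fun ⟨C, _, hC⟩ => hfin hC, fun hA => ?_⟩, fun ⟨C, _, hC⟩ => ?_⟩
  · obtain ⟨C, hC, -⟩ := exists_hardyInequality hU' hq0 hq1 hp hv.measurable hw hA.ne
    refine ⟨C + 1, by positivity, fun f hf => (hC f hf).trans (mul_le_mul' ?_ le_rfl)⟩
    exact ENNReal.coe_le_coe.2 le_self_add
  · have hleast := isLeast_sInf_hardyInequality hU' hq0 hq1 hp hv.measurable hw ⟨C, hC⟩
    obtain ⟨C', hC', hCr⟩ := exists_hardyInequality hU' hq0 hq1 hp hv.measurable hw (hfin hC).ne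
    refine ⟨_, hleast, ?_, (hnec hleast.1).trans (mul_le_mul' (le_max_right _ _) le_rfl)⟩
    refine (ENNReal.rpow_le_rpow (ENNReal.coe_le_coe.2 (hleast.2 hC')) hr.le).trans ?_
    exact hCr.le.trans (mul_le_mul' (le_max_left _ _) le_rfl)

end
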